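/- **Setting.** Let $d\ge 1$, $T>0$, $1/3<\gamma\le 1/2$, and let $\mathbf X=(X,\mathbb X)$ be a geometric $\gamma$-rough path on $[0,T]$ with values in $\mathbb R^d$, i.e. a $\gamma$-rough path which is a limit, in the rough path distance, of the natural lifts of $C^1$ paths. Let $b\in L^\infty([0,T];\mathrm{Lin}(\mathbb R^d))$ (that is, $|b_t(x)|\le L(1+|x|)$ for a.e. $(t,x)$, for some $L$) with distributional divergence $\operatorname{div} b\in L^\infty([0,T]\times\mathbb R^d)$, and let $\tilde b\in L^\infty([0,T];C_c^\infty(\mathbb R^d;\mathbb R^d))$. Let $\tilde\Phi_{q,t}(x)$, $0\le q\le t\le T$, be the flow of $\tilde b$ and $X$: $$\tilde\Phi_{q,t}(x)=x+\int_q^t\tilde b_r(\tilde\Phi_{q,r}(x))\,dr+X_t-X_q .$$ A function $u\in L^\infty([0,T]\times\mathbb R^d)$, with locally integrable time slices $u_t$ for every $t\in[0,T]$, is a weak controlled solution of $\partial_tu+b\cdot\nabla u+\nabla u\cdot d\mathbf X=0$ with initial condition $u_0=0$ if, writing $u_t(\varphi)=\int u_t\varphi\,dx$, for every $\varphi\in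 C_c^\infty(\mathbb R^d)$ the path $t\mapsto u_t(\varphi)$ is $\gamma$-controlled by $X$ with Gubinelli derivative $u_t(\nabla\varphi)$, and for all $t\in[0,T]$ $$u_t(\varphi)=\int_0^tu_s\big(b_s\cdot\nabla\varphi+(\operatorname{div}b_s)\varphi\big)\,ds+\int_0^tu_s(\nabla\varphi)\,d\mathbf X_s ,$$ where the last term is the controlled rough integral (limit of compensated Riemann sums) of $u(\nabla\varphi)$, whose Gubinelli derivative is $u(\nabla^2\varphi)$. **Statement.** Let $u$ be such a solution, let $\varphi_0\in C_c^\infty(\mathbb R^d)$ with $\operatorname{supp}\varphi_0\subset \bar B(0,R_\varphi)$, and let $t_0\in[0,T]$. For $q\in[0,t_0]$ put $$\tilde G_q^{t_0}(x)=\int_q^{t_0}(\operatorname{div}\tilde b_r)(\tilde\Phi_{q,r}(x))\,dr,\qquad \tilde\psi_q(x)=\varphi_0(\tilde\Phi_{q,t_0}(x))\,\exp\big(\tilde G^{t_0}_q(x)\big),$$ $$\tilde R=R_\varphi+2\big(T\|\tilde b\|_\infty+T^\gamma\|X\|_\gamma\big),$$ where $\|X\|_\gamma$ is the $\gamma$-Hölder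 seminorm of $X$ on $[0,T]$. 1. Each $\tilde\psi_q$ is $C^2$, $\tilde\psi_{t_0}=\varphi_0$, and $\tilde\psi$ is on $[0,t_0]$ a strong controlled solution of the rough continuity equation $\partial_t\tilde\psi+\tilde b\cdot\nabla\tilde\psi+(\operatorname{div}\tilde b)\tilde\psi+\nabla\tilde\psi\cdot d\mathbf X=0$. This means: $\tilde\psi$ is bounded, each $\tilde\psi_t$ is $C^1$, $\tilde\psi_t$ and $\nabla\tilde\psi_t$ are $\gamma$-Hölder in $t$ uniformly in $x$, for every $x$ the path $\nabla\tilde\psi_\cdot(x)$ is $\gamma$-controlled by $X$ with Gubinelli derivative $-\nabla^2\tilde\psi_\cdot(x)$, and for all $x$ and $0\le s\le t\le t_0$ $$\tilde\psi_t(x)-\tilde\psi_s(x)+\int_s^t\big(\tilde b_q\cdot\nabla\tilde\psi_q+(\operatorname{div}\tilde b_q)\tilde\psi_q\big)(x)\,dq+\int_s^t\nabla\tilde\psi_q(x)\,d\mathbf X_q=0 .$$ 2. For a.e. $q\in[0,t_0]$ the distributional divergence of $(b_q-\tilde b_q)\tilde\psi_q$ is $(b_q-\tilde b_q)\cdot\nabla\tilde\psi_q+\operatorname{div}(b_q-\tilde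 b_q)\,\tilde\psi_q$, its product with $u$ is integrable on $[0,t_0]\times\mathbb R^d$, and $$u_{t_0}(\varphi_0)=\int_0^{t_0}u_q\big(\operatorname{div}[(b_q-\tilde b_q)\tilde\psi_q]\big)\,dq .$$ 3. We have $$|u_{t_0}(\varphi_0)|\le C\,\|u\|_\infty\;\operatorname*{ess\,sup}_{q\in[0,t_0]}\int_{\bar B(0,\tilde R)}\Big[|\operatorname{div}(b-\tilde b)_q(x)|+|(b-\tilde b)_q(x)|\Big]\Big(|D\tilde\Phi_{q,t_0}(x)|+|\nabla\tilde G_q^{t_0}(x)|\Big)\,dx ,$$ with a constant $C$ that depends only on $d$, $T$ and upper bounds for $\|\varphi_0\|_\infty$, $\|\nabla\varphi_0\|_\infty$ and $\|\operatorname{div}\tilde b\|_\infty$ (in particular not on $u$, $b$, $X$, $\gamma$, $t_0$, $R_\varphi$, nor otherwise on $\tilde b$). -/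

import Mathlib

open MeasureTheory Set Filter Topology
open scoped ENNReal NNReal ContDiff

namespace RoughTransport

noncomputable section

/-- The space `ℝ^d` with its Euclidean norm. -/
abbrev Vec (d : ℕ) := EuclideanSpace ℝ (Fin d)

/-- Lebesgue measure on `[0,T] × ℝ^d`. -/
def slab (d : ℕ) (T : ℝ) : Measure (ℝ × Vec d) :=
  (volume.restrict (Icc 0 T)).prod volume

/-- Test functions: `φ ∈ C_c^∞(ℝ^d)`. -/
def IsTest {d : ℕ} (φ : Vec d → ℝ) : Prop :=
  ContDiff ℝ ∞ φ ∧ HasCompactSupport φ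

/-- The `i`-th partial derivative of a scalar function. -/
def pd {d : ℕ} (i : Fin d) (f : Vec d → ℝ) (x : Vec d) : ℝ :=
  fderiv ℝ f x (EuclideanSpace.single i 1)

/-- The classical divergence of a (differentiable) vector field. -/
def divergence {d : ℕ} (f : Vec d → Vec d) (x : Vec d) : ℝ :=
  ∑ i : Fin d, (fderiv ℝ f x (EuclideanSpace.single i 1)) i

/-- `g` is the distributional divergence of the vector field `f`. -/
structure IsWeakDiv {d : ℕ} (f : Vec d → Vec d) (g : Vec d → ℝ) : Prop where
  field_int : LocallyIntegrable f volume
  div_int : LocallyIntegrable g volume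
  parts : ∀ φ : Vec d → ℝ, IsTest φ → ∫ x, fderiv ℝ φ x (f x) = -∫ x, g x * φ x

/-- The pairing `u(φ) = ∫ u φ dx`. -/
def pair {d : ℕ} (u φ : Vec d → ℝ) : ℝ := ∫ x, u x * φ x

/-! ### Hölder paths and rough paths -/

/-- `y` is `γ`-Hölder on `[0,T]`. -/
def IsHolder {F : Type*} [NormedAddCommGroup F] (T γ : ℝ) (y : ℝ → F) : Prop :=
  ∃ C : ℝ, ∀ s ∈ Icc 0 T, ∀ t ∈ Icc 0 T, ‖y t - y s‖ ≤ C * |t - s| ^ γ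

/-- The `γ`-Hölder seminorm of `y` on `[0,T]` (the best Hölder constant). -/
def holderSeminorm {F : Type*} [NormedAddCommGroup F] (T γ : ℝ) (y : ℝ → F) : ℝ :=
  sInf {H : ℝ | 0 ≤ H ∧ ∀ s ∈ Icc 0 T, ∀ t ∈ Icc 0 T, ‖y t - y s‖ ≤ H * |t - s| ^ γ}

/-- `(X, 𝕏)` is a rough path of order `γ` on `[0,T]`; `𝕏 s t i j` plays the role of the
iterated integral `∫_s^t (X^i_r - X^i_s) dX^j_r`. -/
structure IsRoughPath {d : ℕ} (T γ : ℝ) (X : ℝ → Vec d)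
    (XX : ℝ → ℝ → Matrix (Fin d) (Fin d) ℝ) : Prop where
  holder : IsHolder T γ X
  area_cont : ∀ i j, ContinuousOn (fun p : ℝ × ℝ => XX p.1 p.2 i j) (Icc 0 T ×ˢ Icc 0 T)
  area_holder : ∃ C : ℝ, ∀ s ∈ Icc 0 T, ∀ t ∈ Icc 0 T, ∀ i j,
    |XX s t i j| ≤ C * |t - s| ^ (2 * γ)
  chen : ∀ s u t : ℝ, 0 ≤ s → s ≤ u → u ≤ t → t ≤ T → ∀ i j,
    XX s t i j - XX s u i j - XX u t i j = (X u i - X s i) * (X t j - X u j)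

/-- The second level of the natural lift of a `C^1` path. -/
def smoothLift {d : ℕ} (Y : ℝ → Vec d) (s t : ℝ) : Matrix (Fin d) (Fin d) ℝ :=
  fun i j => ∫ r in s..t, (Y r i - Y s i) * (deriv Y r) j

/-- A geometric rough path: a rough path which is a limit, in the rough path distance on
`[0,T]`, of natural lifts of `C^1` paths. -/
structure IsGeometricRoughPath {d : ℕ} (T γ : ℝ) (X : ℝ → Vec d)
    (XX : ℝ → ℝ → Matrix (Fin d) (Fin d) ℝ) : Prop extends IsRoughPath T γ X XX where
  approx : ∃ Y : ℕ → ℝ → Vec d, (∀ n, ContDiff ℝ 1 (Y n)) ∧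
    ∀ ε : ℝ, 0 < ε → ∃ N : ℕ, ∀ n, N ≤ n →
      ‖X 0 - Y n 0‖ ≤ ε ∧
      ∀ s ∈ Icc 0 T, ∀ t ∈ Icc 0 T,
        ‖(X t - Y n t) - (X s - Y n s)‖ ≤ ε * |t - s| ^ γ ∧
        ∀ i j, |XX s t i j - smoothLift (Y n) s t i j| ≤ ε * |t - s| ^ (2 * γ)

/-- The scalar path `y` is `γ`-controlled by `X` on `[0,T]` with derivative `y'`. -/
structure IsControlled {d : ℕ} (T γ : ℝ) (X : ℝ → Vec d) (y : ℝ → ℝ)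
    (y' : ℝ → Fin d → ℝ) : Prop where
  holder : IsHolder T γ y
  holder_deriv : ∀ i, IsHolder T γ (fun t => y' t i)
  remainder : ∃ C : ℝ, ∀ s ∈ Icc 0 T, ∀ t ∈ Icc 0 T,
    |y t - y s - ∑ i, y' s i * (X t i - X s i)| ≤ C * |t - s| ^ (2 * γ)

/-- `I` is the controlled rough integral over `[s,t]` of the vector path `a`, whose component
`a i` has derivative `a' · i ·`, against `(X, 𝕏)`: the limit, as the mesh of the partition
tends to `0`, of the compensated Riemann sums. -/
def HasRoughIntegral {d : ℕ} (X : ℝ → Vec d) (XX : ℝ → ℝ → Matrix (Fin d) (Fin d) ℝ)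
    (a : ℝ → Fin d → ℝ) (a' : ℝ → Fin d → Fin d → ℝ) (s t I : ℝ) : Prop :=
  ∀ ε : ℝ, 0 < ε → ∃ δ : ℝ, 0 < δ ∧ ∀ (n : ℕ) (p : ℕ → ℝ), p 0 = s → p n = t →
    (∀ k < n, p k ≤ p (k + 1) ∧ p (k + 1) - p k ≤ δ) →
    |(∑ k ∈ Finset.range n,
        ((∑ i, a (p k) i * (X (p (k + 1)) i - X (p k) i)) +
          ∑ i, ∑ j, a' (p k) i j * XX (p k) (p (k + 1)) j i)) - I| ≤ ε

/-! ### Drifts, flows and solutions -/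

/-- `b ∈ L^∞([0,T]; Lin(ℝ^d))`, and `divb ∈ L^∞([0,T] × ℝ^d)` is its distributional
divergence in the space variable. -/
structure IsLinDrift {d : ℕ} (T : ℝ) (b : ℝ → Vec d → Vec d) (divb : ℝ → Vec d → ℝ) :
    Prop where
  meas : AEStronglyMeasurable (Function.uncurry b) (slab d T)
  growth : ∃ L : ℝ, ∀ᵐ p ∂(slab d T), ‖b p.1 p.2‖ ≤ L * (1 + ‖p.2‖)
  div_mem : MemLp (Function.uncurry divb) ∞ (slab d T)
  isDiv : ∀ᵐ t ∂(volume.restrict (Icc 0 T)), IsWeakDiv (b t) (divb t)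

/-- `b ∈ L^∞([0,T]; C_c^∞(ℝ^d))`. -/
structure IsSmoothDrift {d : ℕ} (T : ℝ) (b : ℝ → Vec d → Vec d) : Prop where
  meas : AEStronglyMeasurable (Function.uncurry b) (slab d T)
  smooth : ∀ᵐ t ∂(volume.restrict (Icc 0 T)), ContDiff ℝ ∞ (b t) ∧ HasCompactSupport (b t)
  bound : ∀ n : ℕ, ∃ C : ℝ, ∀ᵐ t ∂(volume.restrict (Icc 0 T)), ∀ x,
    ‖iteratedFDeriv ℝ n (b t) x‖ ≤ C

/-- `Φ q t x` is the flow of `dx = b(x) dt + dX`: the position at time `t` of the solution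
which is at `x` at time `q ≤ t`. -/
def IsFlow {d : ℕ} (T : ℝ) (b : ℝ → Vec d → Vec d) (X : ℝ → Vec d)
    (Φ : ℝ → ℝ → Vec d → Vec d) : Prop :=
  ∀ q ∈ Icc 0 T, ∀ x : Vec d, ContinuousOn (fun t => Φ q t x) (Icc q T) ∧
    ∀ t ∈ Icc q T, Φ q t x = x + (∫ r in q..t, b r (Φ q r x)) + (X t - X q)

/-- Weak controlled solutions of `∂_t u + b · ∇u + ∇u · d𝐗 = 0` on `[0,T]` with initial
condition `u0`; the controlled path `u(φ)` has derivative `u(∇φ)`, hence `u(∇φ)` has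
derivative `u(∇²φ)`. -/
structure IsWeakControlledSolution {d : ℕ} (T γ : ℝ) (X : ℝ → Vec d)
    (XX : ℝ → ℝ → Matrix (Fin d) (Fin d) ℝ) (b : ℝ → Vec d → Vec d)
    (divb : ℝ → Vec d → ℝ) (u0 : Vec d → ℝ) (u : ℝ → Vec d → ℝ) : Prop where
  mem : MemLp (Function.uncurry u) ∞ (slab d T)
  slice : ∀ t ∈ Icc 0 T, LocallyIntegrable (u t) volume
  controlled : ∀ φ : Vec d → ℝ, IsTest φ →
    IsControlled T γ X (fun t => pair (u t) φ) (fun t i => pair (u t) (pd i φ))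
  equation : ∀ φ : Vec d → ℝ, IsTest φ → ∀ t ∈ Icc 0 T,
    HasRoughIntegral X XX (fun s i => pair (u s) (pd i φ))
      (fun s i j => pair (u s) (pd j (pd i φ))) 0 t
      (pair (u t) φ - pair u0 φ -
        ∫ s in (0 : ℝ)..t, pair (u s) (fun x => fderiv ℝ φ x (b s x) + divb s x * φ x))

/-- Strong controlled solutions of `∂_t v + b · ∇v + c v + ∇v · d𝐗 = 0` on `[0,T]`, where
`h t x i j` is the derivative of the controlled path `∂_i v_t(x)` in the direction `X^j`. -/
structure IsStrongControlledSolution {d : ℕ} (T γ : ℝ) (X : ℝ → Vec d)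
    (XX : ℝ → ℝ → Matrix (Fin d) (Fin d) ℝ) (b : ℝ → Vec d → Vec d) (c : ℝ → Vec d → ℝ)
    (v : ℝ → Vec d → ℝ) (h : ℝ → Vec d → Fin d → Fin d → ℝ) : Prop where
  diff : ∀ t ∈ Icc 0 T, ContDiff ℝ 1 (v t)
  bounded : ∃ C : ℝ, ∀ t ∈ Icc 0 T, ∀ x, |v t x| ≤ C
  holder : ∃ C : ℝ, ∀ s ∈ Icc 0 T, ∀ t ∈ Icc 0 T, ∀ x,
    |v t x - v s x| ≤ C * |t - s| ^ γ ∧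
    ‖fderiv ℝ (v t) x - fderiv ℝ (v s) x‖ ≤ C * |t - s| ^ γ
  controlled : ∀ x i, IsControlled T γ X (fun t => pd i (v t) x) (fun t => h t x i)
  equation : ∀ x, ∀ s t : ℝ, 0 ≤ s → s ≤ t → t ≤ T →
    HasRoughIntegral X XX (fun r i => pd i (v r) x) (fun r => h r x) s t
      (-(v t x - v s x) - ∫ q in s..t, (fderiv ℝ (v q) x (b q x) + c q x * v q x))

/-! ### The backward solution and the radius -/

/-- `G_q^{t₀}(x) = ∫_q^{t₀} (div b_r)(Φ_{q,r}(x)) dr`. -/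
def backG {d : ℕ} (b : ℝ → Vec d → Vec d) (Φ : ℝ → ℝ → Vec d → Vec d) (t₀ q : ℝ)
    (x : Vec d) : ℝ :=
  ∫ r in q..t₀, divergence (b r) (Φ q r x)

/-- `ψ_q(x) = φ₀(Φ_{q,t₀}(x)) exp(G_q^{t₀}(x))`. -/
def backSol {d : ℕ} (b : ℝ → Vec d → Vec d) (Φ : ℝ → ℝ → Vec d → Vec d) (φ₀ : Vec d → ℝ)
    (t₀ q : ℝ) (x : Vec d) : ℝ :=
  φ₀ (Φ q t₀ x) * Real.exp (backG b Φ t₀ q x)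

/-- `div[(b - b̃) ψ] = (b - b̃) · ∇ψ + div(b - b̃) ψ`. -/
def divDiff {d : ℕ} (b : ℝ → Vec d → Vec d) (divb : ℝ → Vec d → ℝ) (b' : ℝ → Vec d → Vec d)
    (ψ : ℝ → Vec d → ℝ) (q : ℝ) (x : Vec d) : ℝ :=
  fderiv ℝ (ψ q) x (b q x - b' q x) + (divb q x - divergence (b' q) x) * ψ q x

/-- `R̃ = R_φ + 2 (T ‖b‖_∞ + T^γ ‖X‖_γ)`. -/
def supportRadius {d : ℕ} (T γ Rφ : ℝ) (b : ℝ → Vec d → Vec d) (X : ℝ → Vec d) : ℝ :=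
  Rφ + 2 * (T * (eLpNorm (Function.uncurry b) ∞ (slab d T)).toReal
    + T ^ γ * holderSeminorm T γ X)

end

end RoughTransport

open RoughTransport

/-! The proof is a duality argument: `t ↦ u_t(ψ_t)` is followed from `0`, where it vanishes, to
`t₀`, where it equals `u_{t₀}(φ₀)`. Over a short interval the noise moves `u` and `ψ` by the same
translation, so it cancels, and only the difference of the two drifts survives.

Three facts carry this.

(a) The rough term is a translation. For a geometric rough path the symmetric part of the second
level is half the tensor square of the increment (`IsGeometricRoughPath.add_swap`, `contraction`).
Hence the compensated Riemann summand is the second order Taylor polynomial of a translation by `X_t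
- X_s`, and both equations can be compared with that translation up to `O((t - s)^{3γ})`, where `3γ
> 1`.

(b) The backward solution is transported. Since the noise is additive it does not appear in the
derivative of the flow equation in `x`. The trajectories from all starting times are put in one
Banach space of bounded paths, where the flow equation is inverted by the inverse function theorem
(`contDiff_solution`); a linear Volterra operator subtracted from the identity is always invertible.
This gives smoothness uniformly in the two times. The cocycle identity `IsRegularFlow.backSol_comp`
then shows that `ψ_s - ψ_t(· + X_t - X_s)` is `O(t - s)` with all its derivatives, and
`exists_expansion` identifies its first order part as the time integral of `div(b̃ψ)` up to `O((t -
s)^{1+γ})`. Taylor expansion and (a) turn this into the strong controlled equation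
(`IsBackwardTransport.isStrongControlledSolution`).

(c) Uniformity in the test function. The definition of a weak solution gives sewing bounds whose
constants depend on the test function in an unknown way, whereas the argument tests with `ψ_t` for
every `t`. Composed with a fixed mollifier, the normalised remainders are continuous functionals on
bounded continuous functions and are pointwise bounded, so Banach–Steinhaus makes the bound uniform
(`exists_abs_remainder_mollify_le`). Its constant may blow up with the kernel, but it multiplies `(t
- s)^{3γ}` and disappears when the partition is refined. The error of removing the mollifier is
linear in `t - s` with a factor `ε` and a constant free of the kernel, so it disappears afterwards
as `ε → 0` (`exists_abs_increment_sub_le`, `pair_eq_integral_defect`).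

For the estimate, the gradient of `ψ` is bounded by `|DΦ| + |∇G|` directly. The term `div(b - b̃) ψ`
contains no derivative of the flow; there the Liouville formula `det_fderiv_flow` gives a lower
bound for `|DΦ|`, which can therefore be inserted at the cost of a constant. -/

namespace RoughTransport

noncomputable section

/-! ### Partition sums and the sewing estimate -/

/-- `S` is the sum of the increments `Ξ` along a partition of `[s,t]` with mesh at most `δ`. -/
def IsPartitionSum (Ξ : ℝ → ℝ → ℝ) (δ s t S : ℝ) : Prop :=
  ∃ (n : ℕ) (p : ℕ → ℝ), p 0 = s ∧ p n = t ∧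
    (∀ k < n, p k ≤ p (k + 1) ∧ p (k + 1) - p k ≤ δ) ∧
    ∑ k ∈ Finset.range n, Ξ (p k) (p (k + 1)) = S

/-- Partition sums of `Ξ` over `[s,t]` tend to `I` as the mesh tends to `0`. -/
def HasIncrementIntegral (Ξ : ℝ → ℝ → ℝ) (s t I : ℝ) : Prop :=
  ∀ ε : ℝ, 0 < ε → ∃ δ : ℝ, 0 < δ ∧ ∀ S, IsPartitionSum Ξ δ s t S → |S - I| ≤ ε

/-- Sewing only uses the summand as a scalar function of two times, so the rough path structure is
hidden in one increment function. -/
theorem hasRoughIntegral_iff {d : ℕ} {X : ℝ → Vec d} {XX : ℝ → ℝ → Matrix (Fin d) (Fin d) ℝ}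
    {a : ℝ → Fin d → ℝ} {a' : ℝ → Fin d → Fin d → ℝ} {s t I : ℝ} :
    HasRoughIntegral X XX a a' s t I ↔ HasIncrementIntegral
      (fun s t => (∑ i, a s i * (X t i - X s i)) + ∑ i, ∑ j, a' s i j * XX s t j i) s t I := by
  constructor
  · intro h ε hε
    obtain ⟨δ, hδ, H⟩ := h ε hε
    refine ⟨δ, hδ, ?_⟩
    rintro S ⟨n, p, h0, hn, hp, rfl⟩
    exact H n p h0 hn hp
  · intro h ε hε
    obtain ⟨δ, hδ, H⟩ := h ε hε
    exact ⟨δ, hδ, fun n p h0 hn hp => H _ ⟨n, p, h0, hn, hp, rfl⟩⟩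

namespace IsPartitionSum

variable {Ξ : ℝ → ℝ → ℝ} {δ δ' s r t S S' : ℝ}

theorem single (hst : s ≤ t) (hδ : t - s ≤ δ) : IsPartitionSum Ξ δ s t (Ξ s t) := by
  refine ⟨1, fun k => if k = 0 then s else t, by simp, by simp, ?_, by simp⟩
  intro k hk
  obtain rfl : k = 0 := by omega
  simpa using ⟨hst, by linarith⟩

theorem mono (h : IsPartitionSum Ξ δ s t S) (hδ : δ ≤ δ') : IsPartitionSum Ξ δ' s t S := by
  obtain ⟨n, p, h0, hn, hp, hS⟩ := h
  exact ⟨n, p, h0, hn, fun k hk => ⟨(hp k hk).1, (hp k hk).2.trans hδ⟩, hS⟩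

theorem append (h : IsPartitionSum Ξ δ s r S) (h' : IsPartitionSum Ξ δ r t S') :
    IsPartitionSum Ξ δ s t (S + S') := by
  obtain ⟨n, p, h0, hn, hp, rfl⟩ := h
  obtain ⟨m, p', h0', hm, hp', rfl⟩ := h'
  set P : ℕ → ℝ := fun k => if k < n then p k else p' (k - n) with hP
  have hlt : ∀ k ≤ n, P k = p k := by
    intro k hk
    rcases hk.lt_or_eq with h | rfl
    · simp [hP, h]
    · simp [hP, h0', hn]
  have hge : ∀ k, P (n + k) = p' k := by
    intro k
    simp [hP]
  refine ⟨n + m, P, by rw [hlt 0 (Nat.zero_le _), h0], by rw [hge, hm], ?_, ?_⟩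
  · intro k hk
    rcases lt_or_ge k n with h | h
    · rw [hlt k h.le, hlt (k + 1) h]
      exact hp k h
    · obtain ⟨j, rfl⟩ := Nat.exists_eq_add_of_le h
      rw [hge, add_assoc, hge]
      exact hp' j (by omega)
  · rw [Finset.sum_range_add]
    congr 1
    · refine Finset.sum_congr rfl fun k hk => ?_
      have hk := Finset.mem_range.1 hk
      rw [hlt k hk.le, hlt (k + 1) hk]
    · refine Finset.sum_congr rfl fun k _ => ?_
      rw [hge, add_assoc, hge]

/-- A telescoping estimate: a function whose increments are close to `Ξ` has increments close to
the partition sums of `Ξ`. -/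
theorem abs_sub_le {J : ℝ → ℝ} {C ε θ a b : ℝ} (hC : 0 ≤ C) (hθ : 1 ≤ θ)
    (hJ : ∀ s t, a ≤ s → s ≤ t → t ≤ b → |J t - J s - Ξ s t| ≤ C * (t - s) ^ θ + ε * (t - s))
    (h : IsPartitionSum Ξ δ a b S) :
    |S - (J b - J a)| ≤ (C * δ ^ (θ - 1) + ε) * (b - a) := by
  obtain ⟨n, p, rfl, rfl, hp, rfl⟩ := h
  have mono : ∀ k ≤ n, p 0 ≤ p k := by
    intro k
    induction k with
    | zero => intro _; exact le_rfl
    | succ k ih => intro hk; exact (ih (by omega)).trans (hp k (by omega)).1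
  have mono' : ∀ k ≤ n, p (n - k) ≤ p n := by
    intro k
    induction k with
    | zero => intro _; exact le_rfl
    | succ k ih =>
      intro hk
      have := (hp (n - (k + 1)) (by omega)).1
      rw [show n - (k + 1) + 1 = n - k by omega] at this
      exact this.trans (ih (by omega))
  rw [← Finset.sum_range_sub (fun k => J (p k)), ← Finset.sum_range_sub p, ← Finset.sum_sub_distrib,
    Finset.mul_sum]
  refine (Finset.abs_sum_le_sum_abs _ _).trans (Finset.sum_le_sum fun k hk => ?_)
  have hk := Finset.mem_range.1 hk
  have h1 := hJ (p k) (p (k + 1)) (mono k hk.le) (hp k hk).1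
    (by have := mono' (n - (k + 1)) (by omega); rwa [show n - (n - (k + 1)) = k + 1 by omega] at this)
  rw [abs_sub_comm]
  refine h1.trans ?_
  have hx : 0 ≤ p (k + 1) - p k := sub_nonneg.2 (hp k hk).1
  have : (p (k + 1) - p k) ^ θ ≤ δ ^ (θ - 1) * (p (k + 1) - p k) := by
    rcases hx.eq_or_lt with h | h
    · rw [← h, Real.zero_rpow (by linarith), mul_zero]
    · calc (p (k + 1) - p k) ^ θ = (p (k + 1) - p k) ^ (θ - 1) * (p (k + 1) - p k) := by
            conv_rhs => rw [← Real.rpow_add_one h.ne']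
            congr 1; ring
        _ ≤ _ := by
            exact mul_le_mul_of_nonneg_right
              (Real.rpow_le_rpow hx (hp k hk).2 (by linarith)) hx
  nlinarith [mul_le_mul_of_nonneg_left this hC]

end IsPartitionSum

theorem tendsto_rpow_mul_add (C D θ : ℝ) (hθ : 1 < θ) {η : ℝ} (hη : 0 < η) :
    ∃ δ : ℝ, 0 < δ ∧ C * δ ^ (θ - 1) * D ≤ η := by
  have h : Tendsto (fun δ : ℝ => C * δ ^ (θ - 1) * D) (𝓝[>] 0) (𝓝 (C * 0 ^ (θ - 1) * D)) := by
    have : Continuous (fun δ : ℝ => C * δ ^ (θ - 1) * D) :=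
      (continuous_const.mul (Real.continuous_rpow_const (by linarith))).mul continuous_const
    exact (this.tendsto 0).mono_left nhdsWithin_le_nhds
  rw [Real.zero_rpow (by linarith)] at h
  simp only [mul_zero, zero_mul] at h
  obtain ⟨δ, h1, h2⟩ := ((h.eventually (gt_mem_nhds hη)).and self_mem_nhdsWithin).exists
  exact ⟨δ, h2, h1.le⟩

/-- Local expansions with a superlinear error identify the integral. -/
theorem hasIncrementIntegral_of_local {Ξ : ℝ → ℝ → ℝ} {J : ℝ → ℝ} {C θ a b : ℝ}
    (hC : 0 ≤ C) (hθ : 1 < θ)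
    (hJ : ∀ s t, a ≤ s → s ≤ t → t ≤ b → |J t - J s - Ξ s t| ≤ C * (t - s) ^ θ) :
    HasIncrementIntegral Ξ a b (J b - J a) := by
  intro ε hε
  obtain ⟨δ, hδ, h⟩ := tendsto_rpow_mul_add C (b - a) θ hθ hε
  refine ⟨δ, hδ, fun S hS => ?_⟩
  have := hS.abs_sub_le (J := J) (ε := 0) hC hθ.le (by simpa using hJ)
  rw [add_zero] at this
  exact this.trans h

/-- Bisection costs the defect `C τ^θ` plus two halves `2 K (τ/2)^θ = K 2^{1-θ} τ^θ`. The hypothesis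
`hK` says that `K` survives this recursion, so the bound does not deteriorate with the depth. -/
theorem exists_isPartitionSum_dyadic {Ξ : ℝ → ℝ → ℝ} {C K θ a b : ℝ}
    (hK : K * 2 ^ (1 - θ) + C ≤ K)
    (hΞ : ∀ s r t, a ≤ s → s ≤ r → r ≤ t → t ≤ b →
      |Ξ s t - Ξ s r - Ξ r t| ≤ C * (t - s) ^ θ) (hK0 : 0 ≤ K) (n : ℕ) :
    ∀ s t, a ≤ s → s ≤ t → t ≤ b → ∃ S, IsPartitionSum Ξ ((t - s) / 2 ^ n) s t S ∧
      |S - Ξ s t| ≤ K * (t - s) ^ θ := by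
  induction n with
  | zero =>
    intro s t _ hst _
    refine ⟨Ξ s t, .single hst (by simp), ?_⟩
    rw [sub_self, abs_zero]
    exact mul_nonneg hK0 (Real.rpow_nonneg (by linarith) _)
  | succ n ih =>
    intro s t has hst htb
    set m := (s + t) / 2 with hm
    obtain ⟨S, hS, hS'⟩ := ih s m has (by linarith) (by linarith)
    obtain ⟨R, hR, hR'⟩ := ih m t (by linarith) (by linarith) htb
    refine ⟨S + R, ?_, ?_⟩
    · refine IsPartitionSum.append (r := m) ?_ ?_
      · convert hS using 1
        rw [hm, pow_succ]; field_simp; ring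
      · convert hR using 1
        rw [hm, pow_succ]; field_simp; ring
    · have h3 := hΞ s m t has (by linarith) (by linarith) htb
      have e : ∀ x, x = (t - s) / 2 → K * x ^ θ = K * 2 ^ (1 - θ) * (t - s) ^ θ / 2 := by
        rintro _ rfl
        rw [Real.div_rpow (by linarith) (by norm_num), Real.rpow_sub (by norm_num), Real.rpow_one]
        ring
      rw [e _ (by rw [hm]; ring)] at hS' hR'
      have h5 : 0 ≤ (t - s) ^ θ := Real.rpow_nonneg (by linarith) _
      have := mul_le_mul_of_nonneg_right hK h5
      calc |S + R - Ξ s t| = |(S - Ξ s m) + (R - Ξ m t) - (Ξ s t - Ξ s m - Ξ m t)| := by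
            congr 1; ring
        _ ≤ |S - Ξ s m| + |R - Ξ m t| + |Ξ s t - Ξ s m - Ξ m t| :=
            (abs_sub _ _).trans (add_le_add_left (abs_add_le _ _) _)
        _ ≤ K * (t - s) ^ θ := by linarith

/-- The sewing estimate for an integral that is known to exist. -/
theorem HasIncrementIntegral.sewing_bound {Ξ : ℝ → ℝ → ℝ} {J : ℝ → ℝ} {C θ T : ℝ} (hθ : 1 < θ)
    (hC : 0 ≤ C)
    (hΞ : ∀ s r t, 0 ≤ s → s ≤ r → r ≤ t → t ≤ T →
      |Ξ s t - Ξ s r - Ξ r t| ≤ C * (t - s) ^ θ)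
    (hJ : ∀ t ∈ Icc 0 T, HasIncrementIntegral Ξ 0 t (J t)) :
    ∃ K, ∀ s t, 0 ≤ s → s ≤ t → t ≤ T → |J t - J s - Ξ s t| ≤ K * (t - s) ^ θ := by
  have h2 : (2 : ℝ) ^ (1 - θ) < 1 := Real.rpow_lt_one_of_one_lt_of_neg (by norm_num) (by linarith)
  set K := C / (1 - 2 ^ (1 - θ)) with hKd
  have hK : K * 2 ^ (1 - θ) + C ≤ K := by
    have : K * (1 - 2 ^ (1 - θ)) = C := div_mul_cancel₀ _ (by linarith)
    linarith
  have hK0 : 0 ≤ K := div_nonneg hC (by linarith)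
  refine ⟨K, fun s t hs hst ht => ?_⟩
  have dy := exists_isPartitionSum_dyadic hK hΞ hK0
  -- No integral over `[s,t]` is assumed. It is reached by joining a fine partition of `[0,s]` with
  -- a fine one of `[s,t]`: the first part is compared with `J s`, the union with `J t`.
  refine le_of_forall_pos_le_add fun ε hε => ?_
  obtain ⟨δ, hδ, h⟩ := hJ s ⟨hs, hst.trans ht⟩ (ε / 2) (by linarith)
  obtain ⟨δ', hδ', h'⟩ := hJ t ⟨hs.trans hst, ht⟩ (ε / 2) (by linarith)
  have lim : ∀ x : ℝ, ∃ n : ℕ, x / 2 ^ n ≤ min δ δ' := by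
    intro x
    have : Tendsto (fun n : ℕ => x / 2 ^ n) atTop (𝓝 0) :=
      tendsto_const_nhds.div_atTop (tendsto_pow_atTop_atTop_of_one_lt (by norm_num))
    exact ((this.eventually (gt_mem_nhds (lt_min hδ hδ'))).exists).imp fun n hn => hn.le
  obtain ⟨n, hn⟩ := lim (s - 0)
  obtain ⟨m, hm⟩ := lim (t - s)
  obtain ⟨S, hS, -⟩ := dy n 0 s le_rfl hs (hst.trans ht)
  obtain ⟨R, hR, hR'⟩ := dy m s t hs hst ht
  have h1 := h S (hS.mono (hn.trans (min_le_left _ _)))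
  have h2 := h' (S + R) ((hS.mono (hn.trans (min_le_right _ _))).append
    (hR.mono (hm.trans (min_le_right _ _))))
  rw [abs_le] at *
  constructor <;> linarith

/-- A function with superlinear increments, up to a linear error. -/
theorem abs_sub_le_of_local {J : ℝ → ℝ} {C ε θ a b : ℝ} (hab : a ≤ b) (hC : 0 ≤ C) (hθ : 1 < θ)
    (hJ : ∀ s t, a ≤ s → s ≤ t → t ≤ b → |J t - J s| ≤ C * (t - s) ^ θ + ε * (t - s)) :
    |J b - J a| ≤ ε * (b - a) := by
  refine le_of_forall_pos_le_add fun η hη => ?_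
  obtain ⟨δ, hδ, h⟩ := tendsto_rpow_mul_add C (b - a) θ hθ hη
  have : Tendsto (fun n : ℕ => (b - a) / 2 ^ n) atTop (𝓝 0) :=
    tendsto_const_nhds.div_atTop (tendsto_pow_atTop_atTop_of_one_lt (by norm_num))
  obtain ⟨n, hn⟩ := (this.eventually (gt_mem_nhds hδ)).exists
  -- The zero increment is used only to produce partitions of small mesh.
  obtain ⟨S, hS, hS'⟩ := exists_isPartitionSum_dyadic (Ξ := fun _ _ => 0) (C := 0) (K := 0)
    (θ := θ) (a := a) (b := b) (by simp) (by intros; simp) le_rfl n a b le_rfl hab le_rfl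
  have hS0 : S = 0 := by simpa using hS'
  have := (hS.mono hn.le).abs_sub_le (J := J) hC hθ.le (by simpa using hJ)
  rw [hS0, zero_sub, abs_neg] at this
  linarith [add_mul (C * δ ^ (θ - 1)) ε (b - a)]

/-! ### Rough paths -/

theorem tendsto_const_mul_le {a b : ℝ} (h : ∀ ε : ℝ, 0 < ε → a ≤ ε * b) : a ≤ 0 := by
  have : Tendsto (fun ε : ℝ => ε * b) (𝓝[>] 0) (𝓝 (0 * b)) :=
    ((continuous_id.mul continuous_const).tendsto 0).mono_left nhdsWithin_le_nhds
  rw [zero_mul] at this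
  exact ge_of_tendsto this (eventually_nhdsWithin_of_forall fun ε hε => h ε hε)

theorem hasDerivAt_apply {d : ℕ} {Y : ℝ → Vec d} (hY : ContDiff ℝ 1 Y) (r : ℝ) (i : Fin d) :
    HasDerivAt (fun r => Y r i) ((deriv Y r) i) r := by
  have h := (hY.differentiable one_ne_zero r).hasDerivAt
  exact (EuclideanSpace.proj i : Vec d →L[ℝ] ℝ).hasFDerivAt.comp_hasDerivAt r h

/-- Integration by parts for the two components. -/
theorem smoothLift_add_swap {d : ℕ} {Y : ℝ → Vec d} (hY : ContDiff ℝ 1 Y) (s t : ℝ) (i j : Fin d) :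
    smoothLift Y s t i j + smoothLift Y s t j i = (Y t i - Y s i) * (Y t j - Y s j) := by
  have hc : ∀ i, Continuous fun r => (deriv Y r) i := fun i =>
    (EuclideanSpace.proj i : Vec d →L[ℝ] ℝ).continuous.comp (hY.continuous_deriv le_rfl)
  have hY' : ∀ i, Continuous fun r => Y r i := fun i =>
    (EuclideanSpace.proj i : Vec d →L[ℝ] ℝ).continuous.comp hY.continuous
  unfold smoothLift
  have c1 : ∀ i j, Continuous fun r => (Y r i - Y s i) * (deriv Y r) j := fun i j =>
    ((hY' i).sub continuous_const).mul (hc j)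
  rw [← intervalIntegral.integral_add ((c1 i j).intervalIntegrable _ _)
    ((c1 j i).intervalIntegrable _ _)]
  have : ∀ r ∈ uIcc s t, HasDerivAt (fun r => (Y r i - Y s i) * (Y r j - Y s j))
      ((Y r i - Y s i) * (deriv Y r) j + (Y r j - Y s j) * (deriv Y r) i) r := by
    intro r _
    exact (((hasDerivAt_apply hY r i).sub_const (Y s i)).mul
      ((hasDerivAt_apply hY r j).sub_const (Y s j))).congr_deriv (by ring)
  rw [intervalIntegral.integral_eq_sub_of_hasDerivAt this
    (((c1 i j).add (c1 j i)).intervalIntegrable _ _)]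
  ring

theorem abs_apply_le {d : ℕ} (v : Vec d) (i : Fin d) : |v i| ≤ ‖v‖ := by
  simpa using PiLp.norm_apply_le v i

/-- The symmetric part of a geometric rough path is determined by its first level. -/
theorem IsGeometricRoughPath.add_swap {d : ℕ} {T γ : ℝ} {X : ℝ → Vec d}
    {XX : ℝ → ℝ → Matrix (Fin d) (Fin d) ℝ} (h : IsGeometricRoughPath T γ X XX)
    {s t : ℝ} (hs : s ∈ Icc 0 T) (ht : t ∈ Icc 0 T) (i j : Fin d) :
    XX s t i j + XX s t j i = (X t i - X s i) * (X t j - X s j) := by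
  obtain ⟨Y, hY, hYX⟩ := h.approx
  rw [← sub_eq_zero, ← abs_nonpos_iff]
  set A := |t - s| ^ γ
  set B := |t - s| ^ (2 * γ)
  have hA : 0 ≤ A := Real.rpow_nonneg (abs_nonneg _) _
  have hB : 0 ≤ B := Real.rpow_nonneg (abs_nonneg _) _
  set x := |X t i - X s i|
  set y := |X t j - X s j|
  have hx : 0 ≤ x := abs_nonneg _
  have hy : 0 ≤ y := abs_nonneg _
  -- The restriction `ε ≤ 1` makes the quadratic term `ε² A²` linear in `ε`, so that a single limit
  -- `ε → 0` suffices.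
  have key : ∀ ε : ℝ, 0 < ε → ε ≤ 1 →
      |XX s t i j + XX s t j i - (X t i - X s i) * (X t j - X s j)|
        ≤ ε * (2 * B + A * x + A * y + A * A) := by
    intro ε hε hε1
    obtain ⟨N, hN⟩ := hYX ε hε
    obtain ⟨h1, h2⟩ := (hN N le_rfl).2 s hs t ht
    have e := smoothLift_add_swap (hY N) s t i j
    have hi : |(X t i - X s i) - (Y N t i - Y N s i)| ≤ ε * A := by
      refine le_trans ?_ h1
      refine le_trans (le_of_eq ?_) (abs_apply_le _ i)
      simp only [PiLp.sub_apply]; congr 1; ring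
    have hj : |(X t j - X s j) - (Y N t j - Y N s j)| ≤ ε * A := by
      refine le_trans ?_ h1
      refine le_trans (le_of_eq ?_) (abs_apply_le _ j)
      simp only [PiLp.sub_apply]; congr 1; ring
    set a := X t i - X s i
    set b := X t j - X s j
    set a' := Y N t i - Y N s i
    set b' := Y N t j - Y N s j
    have e2 : XX s t i j + XX s t j i - a * b = (XX s t i j - smoothLift (Y N) s t i j)
        + (XX s t j i - smoothLift (Y N) s t j i) - (a - a') * b - a * (b - b')
        + (a - a') * (b - b') := by
      linear_combination e
    have t1 : |(a - a') * b| ≤ ε * A * y := by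
      rw [abs_mul]; exact mul_le_mul_of_nonneg_right hi hy
    have t2 : |a * (b - b')| ≤ x * (ε * A) := by
      rw [abs_mul]; exact mul_le_mul_of_nonneg_left hj hx
    have t3 : |(a - a') * (b - b')| ≤ ε * A * A := by
      rw [abs_mul]
      calc _ ≤ (ε * A) * (ε * A) := mul_le_mul hi hj (abs_nonneg _) (by positivity)
        _ ≤ (ε * A) * (1 * A) := by gcongr
        _ = _ := by ring
    rw [e2]
    have g := h2 i j
    have g' := h2 j i
    rw [abs_le] at *
    constructor <;> linarith
  refine tendsto_const_mul_le (b := 2 * B + A * x + A * y + A * A) fun ε hε => ?_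
  rcases le_total ε 1 with h | h
  · exact key ε hε h
  · exact (key 1 one_pos le_rfl).trans (by gcongr)

theorem IsHolder.exists_nonneg {F : Type*} [NormedAddCommGroup F] {T γ : ℝ} {y : ℝ → F}
    (h : IsHolder T γ y) :
    ∃ C : ℝ, 0 ≤ C ∧ ∀ s ∈ Icc 0 T, ∀ t ∈ Icc 0 T, ‖y t - y s‖ ≤ C * |t - s| ^ γ := by
  obtain ⟨C, hC⟩ := h
  refine ⟨|C|, abs_nonneg _, fun s hs t ht => (hC s hs t ht).trans ?_⟩
  gcongr
  exact le_abs_self C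

theorem holderSeminorm_nonneg {F : Type*} [NormedAddCommGroup F] (T γ : ℝ) (y : ℝ → F) :
    0 ≤ holderSeminorm T γ y := Real.sInf_nonneg fun _ h => h.1

/-- The infimum of the Hölder constants is itself one: for fixed times the condition is a closed
lower bound on the constant, or is void when the power vanishes. -/
theorem IsHolder.norm_sub_le {F : Type*} [NormedAddCommGroup F] {T γ : ℝ} {y : ℝ → F}
    (h : IsHolder T γ y) {s t : ℝ} (hs : s ∈ Icc 0 T) (ht : t ∈ Icc 0 T) :
    ‖y t - y s‖ ≤ holderSeminorm T γ y * |t - s| ^ γ := by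
  obtain ⟨C, hC0, hC⟩ := h.exists_nonneg
  have hpos : 0 ≤ |t - s| ^ γ := Real.rpow_nonneg (abs_nonneg _) _
  rcases hpos.eq_or_lt with h0 | h0
  · have := hC s hs t ht
    rwa [← h0, mul_zero] at this ⊢
  · rw [← div_le_iff₀ h0]
    refine le_csInf ⟨C, hC0, hC⟩ fun H hH => ?_
    rw [div_le_iff₀ h0]
    exact hH.2 s hs t ht

theorem IsHolder.continuousOn {F : Type*} [NormedAddCommGroup F] {T γ : ℝ} {y : ℝ → F}
    (h : IsHolder T γ y) (hγ : 0 < γ) : ContinuousOn y (Icc 0 T) := by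
  obtain ⟨C, hC0, hC⟩ := h.exists_nonneg
  intro s hs
  rw [ContinuousWithinAt, tendsto_iff_norm_sub_tendsto_zero]
  have : Tendsto (fun t => C * |t - s| ^ γ) (𝓝[Icc 0 T] s) (𝓝 (C * |s - s| ^ γ)) := by
    have hc : Continuous fun t => C * |t - s| ^ γ := continuous_const.mul
      ((continuous_abs.comp (continuous_id.sub continuous_const)).rpow_const
        (fun _ => Or.inr hγ.le))
    exact (hc.tendsto s).mono_left nhdsWithin_le_nhds
  rw [sub_self, abs_zero, Real.zero_rpow hγ.ne', mul_zero] at this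
  refine squeeze_zero' (Eventually.of_forall fun _ => norm_nonneg _) ?_ this
  filter_upwards [self_mem_nhdsWithin] with t ht using hC s hs t ht

/-- The rough integral of a controlled path is close to its local expansion. -/
theorem IsControlled.sewing_bound {d : ℕ} {T γ : ℝ} (hγ : 1 / 3 < γ) {X : ℝ → Vec d}
    {XX : ℝ → ℝ → Matrix (Fin d) (Fin d) ℝ} (hX : IsRoughPath T γ X XX)
    {a : ℝ → Fin d → ℝ} {a' : ℝ → Fin d → Fin d → ℝ}
    (ha : ∀ i, IsControlled T γ X (fun t => a t i) (fun t => a' t i)) {J : ℝ → ℝ}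
    (hJ : ∀ t ∈ Icc 0 T, HasRoughIntegral X XX a a' 0 t (J t)) :
    ∃ K, ∀ s t, 0 ≤ s → s ≤ t → t ≤ T →
      |J t - J s - ((∑ i, a s i * (X t i - X s i)) + ∑ i, ∑ j, a' s i j * XX s t j i)|
        ≤ K * (t - s) ^ (3 * γ) := by
  obtain ⟨CX, hCX0, hCX⟩ := hX.holder.exists_nonneg
  obtain ⟨CA, hCA⟩ := hX.area_holder
  choose CR hCR using fun i => (ha i).remainder
  choose CH hCH using fun i j => (ha i).holder_deriv j
  refine HasIncrementIntegral.sewing_bound (θ := 3 * γ)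
    (C := ∑ i, |CR i| * CX + ∑ i, ∑ j, |CH i j| * |CA|) (by linarith) (by positivity) ?_
    (fun t ht => hasRoughIntegral_iff.1 (hJ t ht))
  intro s r t hs hsr hrt ht
  have ms : s ∈ Icc 0 T := ⟨hs, by linarith⟩
  have mr : r ∈ Icc 0 T := ⟨by linarith, by linarith⟩
  have mt : t ∈ Icc 0 T := ⟨by linarith, by linarith⟩
  have hts : 0 ≤ t - s := by linarith
  have pw : ∀ {x c : ℝ}, 0 ≤ x → x ≤ t - s → 0 ≤ c → |x| ^ c ≤ (t - s) ^ c := by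
    intro x c h1 h2 h3
    rw [abs_of_nonneg h1]
    exact Real.rpow_le_rpow h1 h2 h3
  -- Chen's relation reduces the defect to remainder times increment (order `2γ + γ`) and increment
  -- of the derivative times area (order `γ + 2γ`).
  have e : (∑ i, a s i * (X t i - X s i)) + (∑ i, ∑ j, a' s i j * XX s t j i)
      - ((∑ i, a s i * (X r i - X s i)) + ∑ i, ∑ j, a' s i j * XX s r j i)
      - ((∑ i, a r i * (X t i - X r i)) + ∑ i, ∑ j, a' r i j * XX r t j i)
      = -(∑ i, (a r i - a s i - ∑ j, a' s i j * (X r j - X s j)) * (X t i - X r i)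
        + ∑ i, ∑ j, (a' r i j - a' s i j) * XX r t j i) := by
    have ch : ∀ i j, XX s t j i = XX s r j i + XX r t j i + (X r j - X s j) * (X t i - X r i) :=
      fun i j => by linarith [hX.chen s r t hs hsr hrt ht j i]
    simp only [ch, sub_mul, Finset.sum_mul, mul_add, mul_sub, Finset.sum_add_distrib,
      Finset.sum_sub_distrib]
    have : ∀ i j, a' s i j * ((X r j - X s j) * (X t i - X r i))
      = a' s i j * (X r j) * (X t i) - a' s i j * (X s j) * (X t i)
        - (a' s i j * (X r j) * (X r i) - a' s i j * (X s j) * (X r i)) := fun i j => by ring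
    simp only [mul_assoc]
    ring
  rw [e, abs_neg, add_mul]
  have h1 : ∀ i, |(a r i - a s i - ∑ j, a' s i j * (X r j - X s j)) * (X t i - X r i)|
      ≤ |CR i| * CX * (t - s) ^ (3 * γ) := by
    intro i
    rw [abs_mul]
    have q1 : |a r i - a s i - ∑ j, a' s i j * (X r j - X s j)| ≤ |CR i| * (t - s) ^ (2 * γ) :=
      (hCR i s ms r mr).trans (mul_le_mul (le_abs_self _) (pw (by linarith) (by linarith)
        (by linarith)) (by positivity) (by positivity))
    have q2 : |X t i - X r i| ≤ CX * (t - s) ^ γ :=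
      ((abs_apply_le (X t - X r) i).trans (hCX r mr t mt)).trans
        (mul_le_mul_of_nonneg_left (pw (by linarith) (by linarith) (by linarith)) hCX0)
    refine (mul_le_mul q1 q2 (abs_nonneg _) (by positivity)).trans (le_of_eq ?_)
    rw [show 3 * γ = 2 * γ + γ by ring, Real.rpow_add_of_nonneg hts (by linarith) (by linarith)]
    ring
  have h2 : ∀ i j, |(a' r i j - a' s i j) * XX r t j i| ≤ |CH i j| * |CA| * (t - s) ^ (3 * γ) := by
    intro i j
    rw [abs_mul]
    have q1 : |a' r i j - a' s i j| ≤ |CH i j| * (t - s) ^ γ :=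
      (hCH i j s ms r mr).trans (mul_le_mul (le_abs_self _) (pw (by linarith) (by linarith)
        (by linarith)) (by positivity) (by positivity))
    have q2 : |XX r t j i| ≤ |CA| * (t - s) ^ (2 * γ) :=
      (hCA r mr t mt j i).trans (mul_le_mul (le_abs_self _) (pw (by linarith) (by linarith)
        (by linarith)) (by positivity) (by positivity))
    refine (mul_le_mul q1 q2 (abs_nonneg _) (by positivity)).trans (le_of_eq ?_)
    rw [show 3 * γ = γ + 2 * γ by ring, Real.rpow_add_of_nonneg hts (by linarith) (by linarith)]
    ring
  refine (abs_add_le _ _).trans (add_le_add ?_ ?_)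
  · rw [Finset.sum_mul]
    exact (Finset.abs_sum_le_sum_abs _ _).trans (Finset.sum_le_sum fun i _ => h1 i)
  · rw [Finset.sum_mul]
    refine (Finset.abs_sum_le_sum_abs _ _).trans (Finset.sum_le_sum fun i _ => ?_)
    rw [Finset.sum_mul]
    exact (Finset.abs_sum_le_sum_abs _ _).trans (Finset.sum_le_sum fun j _ => h2 i j)

/-! ### Taylor estimates -/

section Taylor

variable {E F : Type*} [NormedAddCommGroup E] [NormedSpace ℝ E] [NormedAddCommGroup F]
  [NormedSpace ℝ F] {f : E → F} {C : ℝ}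

theorem norm_sub_le_of_norm_fderiv_le (hf : ContDiff ℝ 1 f) (h : ∀ x, ‖fderiv ℝ f x‖ ≤ C)
    (a b : E) : ‖f b - f a‖ ≤ C * ‖b - a‖ :=
  convex_univ.norm_image_sub_le_of_norm_fderiv_le
    (fun x _ => hf.differentiable one_ne_zero x) (fun x _ => h x) (mem_univ a) (mem_univ b)

theorem norm_fderiv_sub_le (hf : ContDiff ℝ 2 f) (h : ∀ x, ‖iteratedFDeriv ℝ 2 f x‖ ≤ C)
    (a b : E) : ‖fderiv ℝ f b - fderiv ℝ f a‖ ≤ C * ‖b - a‖ := by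
  refine norm_sub_le_of_norm_fderiv_le (hf.fderiv_right (m := 1) (by norm_num)) (fun x => ?_) a b
  rw [← norm_iteratedFDeriv_one, norm_iteratedFDeriv_fderiv]
  exact h x

theorem norm_sub_sub_fderiv_le (hf : ContDiff ℝ 2 f) (h : ∀ x, ‖iteratedFDeriv ℝ 2 f x‖ ≤ C)
    (a v : E) : ‖f (a + v) - f a - fderiv ℝ f a v‖ ≤ C * ‖v‖ ^ 2 := by
  have hC : 0 ≤ C := (norm_nonneg _).trans (h a)
  have := (convex_segment a (a + v)).norm_image_sub_le_of_norm_fderiv_le' (f := f)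
    (φ := fderiv ℝ f a) (C := C * ‖v‖) (fun x _ => hf.differentiable two_ne_zero x) ?_
    (left_mem_segment ℝ _ _) (right_mem_segment ℝ _ _)
  · simpa [pow_two, mul_assoc] using this
  · intro x hx
    refine (norm_fderiv_sub_le hf h a x).trans (mul_le_mul_of_nonneg_left ?_ hC)
    simpa using norm_sub_le_of_mem_segment hx

end Taylor

/-! ### Gronwall's inequality in integral form -/

/-- Extending `w` by constants beyond the interval makes its primitive differentiable everywhere, so
the differential form of Gronwall's inequality applies to the right hand side. -/
theorem integral_gronwall {w : ℝ → ℝ} {a L q t₁ : ℝ} (hL : 0 ≤ L) (hq : q ≤ t₁)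
    (hw : ContinuousOn w (Icc q t₁)) (h : ∀ t ∈ Icc q t₁, w t ≤ a + L * ∫ r in q..t, w r) :
    ∀ t ∈ Icc q t₁, w t ≤ a * Real.exp (L * (t - q)) := by
  set W : ℝ → ℝ := IccExtend hq ((Icc q t₁).domRestrict w) with hW
  have hWc : Continuous W := (continuousOn_iff_continuous_domRestrict.1 hw).Icc_extend'
  have hWw : ∀ t ∈ Icc q t₁, W t = w t := fun t ht => by
    rw [hW, IccExtend_of_mem hq _ ht]; rfl
  set g : ℝ → ℝ := fun t => a + L * ∫ r in q..t, W r with hg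
  have hgd : ∀ t, HasDerivAt g (L * W t) t := fun t =>
    ((intervalIntegral.integral_hasDerivAt_right (hWc.intervalIntegrable _ _)
      (hWc.stronglyMeasurableAtFilter _ _) hWc.continuousAt).const_mul L).const_add a
  have hwg : ∀ t ∈ Icc q t₁, w t ≤ g t := by
    intro t ht
    refine (h t ht).trans (le_of_eq ?_)
    simp only [hg]
    congr 2
    refine intervalIntegral.integral_congr fun r hr => ?_
    rw [uIcc_of_le ht.1] at hr
    exact (hWw r ⟨hr.1, hr.2.trans ht.2⟩).symm
  intro t ht
  have := le_gronwallBound_of_liminf_deriv_right_le (f := g) (f' := fun t => L * W t) (δ := a)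
    (K := L) (ε := 0) (a := q) (b := t₁)
    (fun t _ => (hgd t).continuousAt.continuousWithinAt)
    (fun x _ r hr => ((hgd x).hasDerivWithinAt (s := Ici x)).liminf_right_slope_le hr)
    (by simp [hg]) (fun x hx => by
      have hx' : x ∈ Icc q t₁ := ⟨hx.1, hx.2.le⟩
      rw [hWw x hx', add_zero]
      exact mul_le_mul_of_nonneg_left (hwg x hx') hL) t ht
  rw [gronwallBound_ε0] at this
  exact (hwg t ht).trans this

/-! ### Families of smooth functions -/

/-- A family of smooth functions, measurable in the parameter, all of whose derivatives are
bounded uniformly in the parameter. -/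
structure IsBddFamily {E F : Type*} [NormedAddCommGroup E] [NormedSpace ℝ E]
    [NormedAddCommGroup F] [NormedSpace ℝ F] (f : ℝ → E → F) : Prop where
  smooth : ∀ r, ContDiff ℝ ∞ (f r)
  meas : ∀ x, StronglyMeasurable fun r => f r x
  bound : ∀ n : ℕ, ∃ C, ∀ r x, ‖iteratedFDeriv ℝ n (f r) x‖ ≤ C

/-- In finite dimension an operator is a fixed continuous linear combination of its values on a
basis. -/
theorem stronglyMeasurable_clm_of_apply {α E F : Type*} [MeasurableSpace α]
    [NormedAddCommGroup E] [NormedSpace ℝ E] [FiniteDimensional ℝ E] [NormedAddCommGroup F]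
    [NormedSpace ℝ F] {B : α → E →L[ℝ] F} (h : ∀ v, StronglyMeasurable fun a => B a v) :
    StronglyMeasurable B := by
  let b := Module.finBasis ℝ E
  have : B = fun a => ∑ i, (ContinuousLinearMap.smulRightL ℝ E F
      (LinearMap.toContinuousLinearMap (b.coord i))) (B a (b i)) := by
    funext a
    ext v
    conv_lhs => rw [← b.sum_repr v, map_sum]
    simp
  rw [this]
  exact Finset.stronglyMeasurable_fun_sum _ fun i _ =>
    (ContinuousLinearMap.continuous _).comp_stronglyMeasurable (h (b i))

namespace IsBddFamily

variable {E F G : Type*} [NormedAddCommGroup E] [NormedSpace ℝ E]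
    [NormedAddCommGroup F] [NormedSpace ℝ F] [NormedAddCommGroup G] [NormedSpace ℝ G]
    {f : ℝ → E → F}

theorem exists_bound (hf : IsBddFamily f) : ∃ C, ∀ r x, ‖f r x‖ ≤ C := by
  simpa using hf.bound 0

theorem exists_bound_fderiv (hf : IsBddFamily f) : ∃ C, ∀ r x, ‖_root_.fderiv ℝ (f r) x‖ ≤ C := by
  simpa using hf.bound 1

theorem contDiff (hf : IsBddFamily f) (n : ℕ) (r : ℝ) : ContDiff ℝ n (f r) :=
  (hf.smooth r).of_le (by exact_mod_cast le_top)

theorem clm_comp (hf : IsBddFamily f) (B : F →L[ℝ] G) : IsBddFamily fun r x => B (f r x) where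
  smooth r := B.contDiff.comp (hf.smooth r)
  meas x := B.continuous.comp_stronglyMeasurable (hf.meas x)
  bound n := by
    obtain ⟨C, hC⟩ := hf.bound n
    refine ⟨‖B‖ * C, fun r x => ?_⟩
    exact (B.norm_iteratedFDeriv_comp_left (hf.contDiff n r).contDiffAt le_rfl).trans
      (by gcongr; exact hC r x)

theorem fderiv [FiniteDimensional ℝ E] (hf : IsBddFamily f) :
    IsBddFamily fun r => _root_.fderiv ℝ (f r) where
  smooth r := (hf.smooth r).fderiv_right le_rfl
  meas x := by
    refine stronglyMeasurable_clm_of_apply fun v => ?_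
    -- A directional derivative is a pointwise limit of difference quotients, each measurable in the
    -- parameter.
    refine stronglyMeasurable_of_tendsto atTop
      (f := fun (n : ℕ) r => (n : ℝ) • (f r (x + (n : ℝ)⁻¹ • v) - f r x))
      (fun n => ((hf.meas _).sub (hf.meas _)).const_smul _) ?_
    rw [tendsto_pi_nhds]
    intro r
    have h := ((hf.contDiff 1 r).differentiable one_ne_zero x).hasFDerivAt
    exact h.lim (α := ℕ) (c := fun n => (n : ℝ)) v
      (by simpa using tendsto_natCast_atTop_atTop) 
  bound n := by
    obtain ⟨C, hC⟩ := hf.bound (n + 1)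
    exact ⟨C, fun r x => by rw [norm_iteratedFDeriv_fderiv]; exact hC r x⟩

theorem stronglyMeasurable_uncurry [FiniteDimensional ℝ E] [MeasurableSpace E] [BorelSpace E]
    (hf : IsBddFamily f) : StronglyMeasurable (Function.uncurry f) := by
  have : StronglyMeasurable (Function.uncurry fun x r => f r x) :=
    stronglyMeasurable_uncurry_of_continuous_of_stronglyMeasurable
      (fun r => (hf.smooth r).continuous) hf.meas
  exact this.comp_measurable measurable_swap

theorem stronglyMeasurable_comp [FiniteDimensional ℝ E] (hf : IsBddFamily f) {y : ℝ → E}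
    (hy : StronglyMeasurable y) : StronglyMeasurable fun r => f r (y r) := by
  borelize E
  exact hf.stronglyMeasurable_uncurry.comp_measurable (measurable_id.prodMk hy.measurable)

end IsBddFamily

/-! ### Spaces of bounded families of paths -/

/-- A starting time in `[0,T]` and a running time. -/
structure TimePair (T : ℝ) where
  start : Icc (0 : ℝ) T
  time : ℝ

/-- With the discrete topology every bounded function is a bounded continuous one. The trajectories
from all starting times then form a single point of a Banach space, and smoothness in `x` is
automatically uniform in both times. -/
instance (T : ℝ) : TopologicalSpace (TimePair T) := ⊥

instance (T : ℝ) : DiscreteTopology (TimePair T) := ⟨rfl⟩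

open BoundedContinuousFunction

section PathSpace

variable {T : ℝ} {E F : Type} [NormedAddCommGroup E] [NormedSpace ℝ E]
    [NormedAddCommGroup F] [NormedSpace ℝ F]

/-- Bounded families of measurable paths, indexed by their starting time. -/
def pathSpace (T : ℝ) (F : Type) [NormedAddCommGroup F] [NormedSpace ℝ F] :
    Submodule ℝ (TimePair T →ᵇ F) where
  carrier := {v | ∀ q, StronglyMeasurable fun r => v ⟨q, r⟩}
  add_mem' hv hw q := (hv q).add (hw q)
  zero_mem' _ := stronglyMeasurable_const
  smul_mem' c _ hv q := (hv q).const_smul c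

theorem isClosed_pathSpace : IsClosed (pathSpace T F : Set (TimePair T →ᵇ F)) := by
  refine isClosed_of_closure_subset fun v hv => ?_
  obtain ⟨w, hw, hlim⟩ := mem_closure_iff_seq_limit.1 hv
  intro q
  refine stronglyMeasurable_of_tendsto atTop (fun n => hw n q) ?_
  rw [tendsto_pi_nhds]
  intro r
  exact ((continuous_eval_const (⟨q, r⟩ : TimePair T)).tendsto v).comp hlim

instance [CompleteSpace F] : CompleteSpace (pathSpace T F) :=
  isClosed_pathSpace.completeSpace_coe

/-- Build an element of `pathSpace`. -/
def mkPath (v : TimePair T → F) (C : ℝ) (hC : ∀ p, ‖v p‖ ≤ C)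
    (hv : ∀ q, StronglyMeasurable fun r => v ⟨q, r⟩) : pathSpace T F :=
  ⟨ofNormedAddCommGroupDiscrete v C hC, hv⟩

@[simp] theorem mkPath_apply (v : TimePair T → F) (C : ℝ) (hC : ∀ p, ‖v p‖ ≤ C)
    (hv : ∀ q, StronglyMeasurable fun r => v ⟨q, r⟩) (p : TimePair T) :
    (mkPath v C hC hv).1 p = v p := rfl

theorem norm_apply_le (v : pathSpace T F) (p : TimePair T) : ‖v.1 p‖ ≤ ‖v‖ :=
  v.1.norm_coe_le_norm p

theorem norm_path_le {v : pathSpace T F} {C : ℝ} (hC : 0 ≤ C) (h : ∀ p, ‖v.1 p‖ ≤ C) : ‖v‖ ≤ C :=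
  (BoundedContinuousFunction.norm_le hC).2 h

theorem path_ext {v w : pathSpace T F} (h : ∀ p, v.1 p = w.1 p) : v = w :=
  Subtype.ext (BoundedContinuousFunction.ext h)

/-- Evaluation at a pair of times. -/
def evalPath (p : TimePair T) : pathSpace T F →L[ℝ] F :=
  LinearMap.mkContinuous
    { toFun := fun v => v.1 p, map_add' := fun _ _ => rfl, map_smul' := fun _ _ => rfl } 1
    fun v => by simpa using norm_apply_le v p

@[simp] theorem evalPath_apply (p : TimePair T) (v : pathSpace T F) : evalPath p v = v.1 p := rfl

/-- Constant paths. -/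
def constPath : F →L[ℝ] pathSpace T F :=
  LinearMap.mkContinuous
    { toFun := fun x => mkPath (fun _ => x) ‖x‖ (fun _ => le_rfl) fun _ => stronglyMeasurable_const
      map_add' := fun _ _ => rfl
      map_smul' := fun _ _ => rfl } 1
    fun x => by
      rw [one_mul]
      exact norm_path_le (norm_nonneg x) fun _ => le_rfl

@[simp] theorem constPath_apply (x : F) (p : TimePair T) : (constPath x).1 p = x := rfl

/-- The pointwise action of a family of operators. -/
def mulPath : pathSpace T (E →L[ℝ] F) →L[ℝ] pathSpace T E →L[ℝ] pathSpace T F :=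
  LinearMap.mkContinuous₂
    (LinearMap.mk₂ ℝ
      (fun B y => mkPath (fun p => B.1 p (y.1 p)) (‖B‖ * ‖y‖)
        (fun p => ((B.1 p).le_opNorm _).trans
          (mul_le_mul (norm_apply_le B p) (norm_apply_le y p) (norm_nonneg _) (norm_nonneg _)))
        fun q => isBoundedBilinearMap_apply.continuous.comp_stronglyMeasurable
          ((B.2 q).prodMk (y.2 q)))
      (fun _ _ _ => path_ext fun _ => rfl) (fun _ _ _ => path_ext fun _ => rfl)
      (fun B y z => path_ext fun p => (B.1 p).map_add (y.1 p) (z.1 p))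
      (fun c B y => path_ext fun p => (B.1 p).map_smul c (y.1 p))) 1
    fun B y => by
      rw [one_mul]
      exact norm_path_le (by positivity) fun p => ((B.1 p).le_opNorm _).trans
          (mul_le_mul (norm_apply_le B p) (norm_apply_le y p) (norm_nonneg _) (norm_nonneg _))

@[simp] theorem mulPath_apply (B : pathSpace T (E →L[ℝ] F)) (y : pathSpace T E) (p : TimePair T) :
    (mulPath B y).1 p = B.1 p (y.1 p) := rfl

/-- The running time, clamped to the interval between the starting time and `T`. -/
def TimePair.clamp (p : TimePair T) : ℝ := max p.start (min p.time T)

theorem TimePair.start_le_clamp (p : TimePair T) : (p.start : ℝ) ≤ p.clamp := le_max_left _ _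

theorem TimePair.clamp_le (p : TimePair T) : p.clamp ≤ T := max_le p.start.2.2 (min_le_right _ _)

theorem TimePair.clamp_of_mem {q : Icc (0 : ℝ) T} {t : ℝ} (h1 : q ≤ t) (h2 : t ≤ T) :
    (⟨q, t⟩ : TimePair T).clamp = t := by
  simp only [TimePair.clamp]
  rw [min_eq_left h2, max_eq_right h1]

theorem intervalIntegrable_path (v : pathSpace T F) (q : Icc (0 : ℝ) T) (a b : ℝ) :
    IntervalIntegrable (fun r => v.1 ⟨q, r⟩) volume a b :=
  intervalIntegrable_const (c := ‖v‖) |>.mono_fun (v.2 q).aestronglyMeasurable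
    (Eventually.of_forall fun r => by simpa using norm_apply_le v _)

theorem norm_integral_path_le (v : pathSpace T F) (p : TimePair T) :
    ‖∫ r in (p.start : ℝ)..p.clamp, v.1 ⟨p.start, r⟩‖ ≤ ‖v‖ * (p.clamp - p.start) := by
  have := intervalIntegral.norm_integral_le_of_norm_le_const (a := p.start) (b := p.clamp)
    (f := fun r => v.1 ⟨p.start, r⟩) (C := ‖v‖) fun r _ => norm_apply_le v _
  rwa [abs_of_nonneg (sub_nonneg.2 p.start_le_clamp)] at this

theorem TimePair.clamp_sub_le (p : TimePair T) : p.clamp - p.start ≤ |T| :=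
  (sub_le_self _ p.start.2.1).trans (p.clamp_le.trans (le_abs_self T))

theorem stronglyMeasurable_integral_path (v : pathSpace T F) (q : Icc (0 : ℝ) T) :
    StronglyMeasurable fun t =>
      ∫ r in (q : ℝ)..(⟨q, t⟩ : TimePair T).clamp, v.1 ⟨q, r⟩ := by
  have h := intervalIntegral.continuous_primitive (intervalIntegrable_path v q) q
  have : Continuous fun t : ℝ => (⟨q, t⟩ : TimePair T).clamp := by
    unfold TimePair.clamp; fun_prop
  exact (h.comp this).stronglyMeasurable

/-- Integration from the starting time to the running time. -/
def integralPath : pathSpace T F →L[ℝ] pathSpace T F :=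
  LinearMap.mkContinuous
    { toFun := fun v => mkPath (fun p => ∫ r in (p.start : ℝ)..p.clamp, v.1 ⟨p.start, r⟩)
        (‖v‖ * |T|)
        (fun p => (norm_integral_path_le v p).trans (by gcongr; exact p.clamp_sub_le))
        (stronglyMeasurable_integral_path v)
      map_add' := fun v w => path_ext fun p =>
        intervalIntegral.integral_add (intervalIntegrable_path v _ _ _)
          (intervalIntegrable_path w _ _ _)
      map_smul' := fun c v => path_ext fun p => intervalIntegral.integral_smul c _ } |T|
    fun v => by
      rw [mul_comm]
      exact norm_path_le (by positivity) fun p =>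
        (norm_integral_path_le v p).trans (by gcongr; exact p.clamp_sub_le)

@[simp] theorem integralPath_apply (v : pathSpace T F) (p : TimePair T) :
    (integralPath v).1 p = ∫ r in (p.start : ℝ)..p.clamp, v.1 ⟨p.start, r⟩ := rfl

/-- Each application of the Volterra operator integrates a power of the elapsed time, which is where
the factorial comes from. -/
theorem norm_pow_integralPath_le (B : pathSpace T (E →L[ℝ] E)) (n : ℕ) (v : pathSpace T E)
    (p : TimePair T) : ‖(((integralPath.comp (mulPath B)) ^ n) v).1 p‖ ≤
      ‖B‖ ^ n * (p.clamp - p.start) ^ n / n.factorial * ‖v‖ := by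
  induction n generalizing p with
  | zero =>
    rw [pow_zero, pow_zero, pow_zero, Nat.factorial_zero, Nat.cast_one, one_mul, div_one, one_mul]
    exact norm_apply_le v p
  | succ n ih =>
    rw [pow_succ', mul_apply_eq_comp]
    set w := ((integralPath.comp (mulPath B)) ^ n) v
    simp only [ContinuousLinearMap.comp_apply, integralPath_apply, mulPath_apply]
    set c := ‖B‖ ^ (n + 1) / n.factorial * ‖v‖ with hc
    have hb : ∀ r ∈ Icc (p.start : ℝ) p.clamp, ‖(B.1 ⟨p.start, r⟩) (w.1 ⟨p.start, r⟩)‖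
        ≤ c * (r - p.start) ^ n := by
      intro r hr
      have h1 := ih ⟨p.start, r⟩
      rw [TimePair.clamp_of_mem hr.1 (hr.2.trans p.clamp_le)] at h1
      calc _ ≤ ‖B.1 ⟨p.start, r⟩‖ * ‖w.1 ⟨p.start, r⟩‖ := (B.1 _).le_opNorm _
        _ ≤ ‖B‖ * (‖B‖ ^ n * (r - p.start) ^ n / n.factorial * ‖v‖) :=
            mul_le_mul (norm_apply_le B _) h1 (norm_nonneg _) (norm_nonneg _)
        _ = _ := by rw [hc]; ring
    refine (intervalIntegral.norm_integral_le_of_norm_le p.start_le_clamp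
      (g := fun r => c * (r - p.start) ^ n)
      (Eventually.of_forall fun r hr => hb r ⟨hr.1.le, hr.2⟩)
      ((by fun_prop : Continuous fun r => c * (r - (p.start : ℝ)) ^ n).intervalIntegrable _ _)).trans
      (le_of_eq ?_)
    rw [intervalIntegral.integral_const_mul,
      intervalIntegral.integral_comp_sub_right (fun r => r ^ n) (p.start : ℝ), integral_pow]
    rw [hc, Nat.factorial_succ, sub_self, zero_pow n.succ_ne_zero, sub_zero]
    generalize ‖B‖ ^ (n + 1) = β
    generalize ‖v‖ = ν
    generalize (p.clamp - p.start) ^ (n + 1) = τ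
    have h1 : (n.factorial : ℝ) ≠ 0 := by exact_mod_cast n.factorial_ne_zero
    have h2 : (n : ℝ) + 1 ≠ 0 := by positivity
    push_cast
    field_simp

/-- `1 - K` is a factor of `1 - K ^ n`, and the two factors commute. -/
theorem isUnit_one_sub_of_pow {R : Type*} [Ring R] {K : R} {n : ℕ} (h : IsUnit (1 - K ^ n)) :
    IsUnit (1 - K) := by
  rw [← mul_neg_geom_sum K n] at h
  refine ((Commute.isUnit_mul_iff ?_).1 h).1
  exact Commute.sum_right _ _ _ fun i _ =>
    (Commute.one_left _).sub_left ((Commute.refl K).pow_right i)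

/-- Linear Volterra equations are uniquely solvable. -/
theorem isUnit_one_sub_integralPath (B : pathSpace T (E →L[ℝ] E)) [CompleteSpace E] :
    IsUnit (1 - integralPath.comp (mulPath B) : pathSpace T E →L[ℝ] pathSpace T E) := by
  set K : pathSpace T E →L[ℝ] pathSpace T E := integralPath.comp (mulPath B)
  have hK : ∀ n, ‖K ^ n‖ ≤ (‖B‖ * |T|) ^ n / n.factorial := by
    intro n
    refine ContinuousLinearMap.opNorm_le_bound _ (by positivity) fun v => ?_
    refine norm_path_le (by positivity) fun p => (norm_pow_integralPath_le B n v p).trans ?_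
    rw [mul_pow]
    gcongr
    · exact sub_nonneg.2 p.start_le_clamp
    · exact p.clamp_sub_le
  -- The factorial makes some power a strict contraction whatever the size of `T` and of `B`; no
  -- subdivision of the time interval is needed.
  obtain ⟨n, hn⟩ := ((FloorSemiring.tendsto_pow_div_factorial_atTop (‖B‖ * |T|)).eventually
    (gt_mem_nhds one_pos)).exists
  have h := isUnit_one_sub_of_norm_lt_one (x := K ^ n) ((hK n).trans_lt hn)
  exact isUnit_one_sub_of_pow h

variable [FiniteDimensional ℝ E]

/-- The superposition operator of a bounded family. -/
def nemytskii {f : ℝ → E → F} (hf : IsBddFamily f) (y : pathSpace T E) :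
    pathSpace T F :=
  mkPath (fun p => f p.time (y.1 p)) hf.exists_bound.choose
    (fun _ => hf.exists_bound.choose_spec _ _) fun q => hf.stronglyMeasurable_comp (y.2 q)

@[simp] theorem nemytskii_apply {f : ℝ → E → F} (hf : IsBddFamily f) (y : pathSpace T E)
    (p : TimePair T) : (nemytskii hf y).1 p = f p.time (y.1 p) := rfl

/-- The pointwise Taylor remainder is quadratic with one constant for all times and points, hence
quadratic in the sup norm. -/
theorem hasFDerivAt_nemytskii {f : ℝ → E → F} (hf : IsBddFamily f) (y : pathSpace T E) :
    HasFDerivAt (nemytskii (T := T) hf) (mulPath (nemytskii hf.fderiv y)) y := by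
  obtain ⟨C, hC⟩ := hf.bound 2
  rw [hasFDerivAt_iff_isLittleO_nhds_zero]
  refine (Asymptotics.isBigO_of_le' (c := |C|) (g := fun h => ‖h‖ ^ 2) _ fun h => ?_).trans_isLittleO
    (Asymptotics.isLittleO_norm_pow_id one_lt_two)
  rw [norm_pow, norm_norm]
  refine norm_path_le (by positivity) fun p => ?_
  refine (norm_sub_sub_fderiv_le (hf.contDiff 2 p.time) (hC p.time) (y.1 p) (h.1 p)).trans ?_
  gcongr
  · exact le_abs_self C
  · exact norm_apply_le h p

/-- The derivative is the superposition operator of `fderiv ℝ (f r)` followed by a bounded linear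
map. The target `F` is quantified inside the induction because differentiation changes it. -/
theorem contDiff_nemytskii (n : ℕ) : ∀ {F : Type} [NormedAddCommGroup F] [NormedSpace ℝ F]
    {f : ℝ → E → F} (hf : IsBddFamily f), ContDiff ℝ n (nemytskii (T := T) hf) := by
  induction n with
  | zero =>
    intro F _ _ f hf
    exact contDiff_zero.2 (continuous_iff_continuousAt.2 fun y =>
      (hasFDerivAt_nemytskii hf y).continuousAt)
  | succ n ih =>
    intro F _ _ f hf
    exact contDiff_succ_iff_hasFDerivAt.2
      ⟨_, mulPath.contDiff.comp (ih hf.fderiv), hasFDerivAt_nemytskii hf⟩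

/-- Solutions of a differential equation, perturbed by a fixed path, depend smoothly on their
starting point. -/
theorem contDiff_solution {f : ℝ → E → E} (hf : IsBddFamily f) {Z : E → pathSpace T E}
    (ζ : pathSpace T E) (hZc : Continuous Z)
    (hZ : ∀ x, Z x = constPath x + ζ + integralPath (nemytskii hf (Z x))) (n : ℕ) :
    ContDiff ℝ n Z := by
  -- The inverse function theorem needs at least one derivative, so `n + 1` is used to cover `n =
  -- 0`.
  suffices H : ContDiff ℝ ((n + 1 : ℕ) : ℕ∞ω) Z from H.of_le (by exact_mod_cast n.le_succ)
  -- The flow equation reads `P (Z x) = constPath x + ζ`, with right side affine in `x`; it remains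
  -- to see that `P` is a local diffeomorphism.
  set P : pathSpace T E → pathSpace T E := fun y => y - integralPath (nemytskii hf y) with hP
  have hPc : ContDiff ℝ ((n + 1 : ℕ) : ℕ∞ω) P :=
    contDiff_id.sub (integralPath.contDiff.comp (contDiff_nemytskii _ hf))
  have hn : ((n + 1 : ℕ) : ℕ∞ω) ≠ 0 := by exact_mod_cast n.succ_ne_zero
  have hPd : ∀ y, HasFDerivAt P
      (1 - integralPath.comp (mulPath (nemytskii hf.fderiv y)) :
        pathSpace T E →L[ℝ] pathSpace T E) y := fun y =>
    (hasFDerivAt_id y).sub (integralPath.hasFDerivAt.comp y (hasFDerivAt_nemytskii hf y))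
  refine contDiff_iff_contDiffAt.2 fun x => ?_
  have hu := isUnit_one_sub_integralPath (nemytskii (T := T) hf.fderiv (Z x))
  set e := ContinuousLinearEquiv.ofUnit hu.unit with he
  have hPe : HasFDerivAt P (e : pathSpace T E →L[ℝ] pathSpace T E) (Z x) := hPd (Z x)
  have hloc := (hPc.contDiffAt (x := Z x)).to_localInverse hPe hn
  have hPZ : ∀ x', P (Z x') = constPath x' + ζ := by
    intro x'
    exact sub_eq_of_eq_add (hZ x')
  have hl := (hPc.contDiffAt (x := Z x)).hasStrictFDerivAt' hPe hn |>.eventually_left_inverse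
  -- The local inverse recovers only arguments close to `Z x`; continuity of `Z` is what keeps `Z
  -- x'` there.
  have hev : Z =ᶠ[𝓝 x] fun x' =>
      (hPc.contDiffAt (x := Z x)).localInverse hPe hn (constPath x' + ζ) := by
    filter_upwards [(hZc.tendsto x).eventually hl] with x' hx'
    rw [← hPZ x']
    exact hx'.symm
  refine ContDiffAt.congr_of_eventuallyEq ?_ hev
  refine ContDiffAt.comp x (by rw [← hPZ x]; exact hloc) ?_
  have h1 : ContDiff ℝ ((n + 1 : ℕ) : ℕ∞ω) (constPath : E →L[ℝ] pathSpace T E) :=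
    ContinuousLinearMap.contDiff _
  exact (h1.add contDiff_const).contDiffAt

/-- Solutions depend continuously on their starting point. -/
theorem continuous_solution {f : ℝ → E → E} (hf : IsBddFamily f) {Z : E → pathSpace T E}
    (ζ : pathSpace T E)
    (hc : ∀ x (q : Icc (0 : ℝ) T), ContinuousOn (fun t => (Z x).1 ⟨q, t⟩) (Icc q T))
    (hcl : ∀ x (p : TimePair T), (Z x).1 ⟨p.start, p.clamp⟩ = (Z x).1 p)
    (hZ : ∀ x, Z x = constPath x + ζ + integralPath (nemytskii hf (Z x))) :
    Continuous Z := by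
  obtain ⟨L, hL⟩ := hf.exists_bound_fderiv
  have hL0 : 0 ≤ |L| := abs_nonneg L
  have key : ∀ x x' (p : TimePair T), ‖(Z x).1 p - (Z x').1 p‖ ≤
      Real.exp (|L| * |T|) * ‖x - x'‖ := by
    intro x x' p
    have hqT : (p.start : ℝ) ≤ T := p.start.2.2
    have := integral_gronwall (w := fun t => ‖(Z x).1 ⟨p.start, t⟩ - (Z x').1 ⟨p.start, t⟩‖)
      (a := ‖x - x'‖) hL0 hqT ((hc x p.start).sub (hc x' p.start)).norm ?_ p.clamp
      ⟨p.start_le_clamp, p.clamp_le⟩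
    · simp only [hcl] at this
      refine this.trans ?_
      rw [mul_comm]
      gcongr
      exact p.clamp_sub_le
    · intro t ht
      have e : ∀ x, (Z x).1 ⟨p.start, t⟩ = x + ζ.1 ⟨p.start, t⟩ +
          ∫ r in (p.start : ℝ)..t, f r ((Z x).1 ⟨p.start, r⟩) := by
        intro x
        conv_lhs => rw [hZ x]
        have := TimePair.clamp_of_mem ht.1 ht.2
        simp [this]
      rw [e x, e x']
      have ii := intervalIntegrable_path (T := T) (nemytskii hf (Z x)) p.start p.start t
      have ii' := intervalIntegrable_path (T := T) (nemytskii hf (Z x')) p.start p.start t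
      simp only [nemytskii_apply] at ii ii'
      rw [add_sub_add_comm, add_sub_add_right_eq_sub, ← intervalIntegral.integral_sub ii ii']
      refine (norm_add_le _ _).trans (add_le_add_right ?_ _)
      rw [← intervalIntegral.integral_const_mul]
      refine intervalIntegral.norm_integral_le_of_norm_le ht.1
        (Eventually.of_forall fun r _ => ?_) ?_
      · exact norm_sub_le_of_norm_fderiv_le (hf.contDiff 1 r)
          (fun z => (hL r z).trans (le_abs_self L)) _ _
      · refine (ContinuousOn.intervalIntegrable ?_).const_mul _
        rw [uIcc_of_le ht.1]
        exact (((hc x p.start).sub (hc x' p.start)).norm).mono (Icc_subset_Icc_right ht.2)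
  refine (LipschitzWith.of_dist_le_mul (K := (Real.exp (|L| * |T|)).toNNReal) fun x x' => ?_).continuous
  rw [Real.coe_toNNReal _ (Real.exp_pos _).le, dist_eq_norm, dist_eq_norm]
  exact norm_path_le (by positivity) (key x x')

end PathSpace

/-! ### A regular version of a smooth drift -/

/-- A set of full Lebesgue measure is dense. -/
theorem forall_of_ae_of_isClosed {d : ℕ} {s : Set (Vec d)} (hs : IsClosed s)
    (h : ∀ᵐ x, x ∈ s) (x : Vec d) : x ∈ s := by
  have := (Measure.dense_of_ae h).closure_eq
  have h2 : s = univ := hs.closure_eq.symm.trans this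
  exact h2 ▸ mem_univ x

theorem ae_slab_of_ae {d : ℕ} {T : ℝ} {p : ℝ → Prop}
    (h : ∀ᵐ t ∂(volume.restrict (Icc 0 T)), p t) : ∀ᵐ z ∂(slab d T), p z.1 :=
  Measure.quasiMeasurePreserving_fst.ae h

theorem divergence_zero {d : ℕ} (x : Vec d) : divergence (0 : Vec d → Vec d) x = 0 := by
  simp [divergence]

theorem IsSmoothDrift.ae_norm_le {d : ℕ} {T : ℝ} {b : ℝ → Vec d → Vec d} (hb : IsSmoothDrift T b) :
    ∀ᵐ t ∂(volume.restrict (Icc 0 T)), ∀ x,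
      ‖b t x‖ ≤ (eLpNorm (Function.uncurry b) ∞ (slab d T)).toReal := by
  obtain ⟨C, hC⟩ := hb.bound 0
  have hfin : eLpNorm (Function.uncurry b) ∞ (slab d T) ≠ ⊤ := by
    refine (memLp_top_of_bound hb.meas C ?_).eLpNorm_ne_top
    filter_upwards [ae_slab_of_ae hC] with z hz
    have : ‖b z.1 z.2‖ ≤ C := by simpa using hz z.2
    exact this
  have h : ∀ᵐ z ∂(slab d T), ‖b z.1 z.2‖ ≤ (eLpNorm (Function.uncurry b) ∞ (slab d T)).toReal := by
    filter_upwards [ae_le_eLpNormEssSup (f := Function.uncurry b) (μ := slab d T)] with z hz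
    rw [eLpNorm_exponent_top] at hfin ⊢
    rw [← toReal_enorm]
    exact ENNReal.toReal_mono hfin hz
  filter_upwards [Measure.ae_ae_of_ae_prod h, hb.smooth] with t ht hs
  exact forall_of_ae_of_isClosed (isClosed_le hs.1.continuous.norm continuous_const) ht

/-- A smooth drift agrees for almost every time with a family that is regular at all times. -/
theorem IsSmoothDrift.exists_regular {d : ℕ} {T : ℝ} {b : ℝ → Vec d → Vec d}
    (hb : IsSmoothDrift T b) {M : ℝ} (hM0 : 0 ≤ M)
    (hM : ∀ᵐ t ∂(volume.restrict (Icc 0 T)), ∀ x, |divergence (b t) x| ≤ M) :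
    ∃ f : ℝ → Vec d → Vec d, IsBddFamily f ∧
      (∀ᵐ t ∂(volume.restrict (Icc 0 T)), f t = b t) ∧
      (∀ t x, |divergence (f t) x| ≤ M) ∧
      ∀ t x, ‖f t x‖ ≤ (eLpNorm (Function.uncurry b) ∞ (slab d T)).toReal := by
  choose C hC using hb.bound
  obtain ⟨g, hg, hgb⟩ := hb.meas
  have hgood : ∀ᵐ t ∂(volume.restrict (Icc 0 T)), ContDiff ℝ ∞ (b t) ∧
      (∀ n x, ‖iteratedFDeriv ℝ n (b t) x‖ ≤ C n) ∧ (∀ x, |divergence (b t) x| ≤ M) ∧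
      (∀ x, ‖b t x‖ ≤ (eLpNorm (Function.uncurry b) ∞ (slab d T)).toReal) ∧
      (b t =ᵐ[volume] fun x => g (t, x)) := by
    filter_upwards [hb.smooth, ae_all_iff.2 hC, hM, hb.ae_norm_le, Measure.ae_ae_of_ae_prod hgb]
      with t h1 h2 h3 h4 h5
    exact ⟨h1.1, h2, h3, h4, h5⟩
  -- All bad times are put in one measurable null set, on which the drift is replaced by `0`.
  obtain ⟨N, hN, hNm, hN0⟩ := exists_measurable_superset_of_null (ae_iff.1 hgood)
  have hS : ∀ t ∈ Nᶜ, _ := fun t ht => not_not.1 fun h => ht (hN h)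
  have hSc : ∀ t, t ∈ Nᶜ ∨ t ∉ Nᶜ := fun t => em _
  refine ⟨Nᶜ.indicator b, ⟨fun t => ?_, fun x => ?_, fun n => ⟨|C n|, fun t x => ?_⟩⟩, ?_,
    fun t x => ?_, fun t x => ?_⟩
  · rcases hSc t with ht | ht
    · rw [indicator_of_mem ht]; exact (hS t ht).1
    · rw [indicator_of_notMem ht]; exact contDiff_const
  -- Measurability of `b` is known only jointly and almost everywhere. Averages in space are
  -- integrals of the measurable representative `g`, hence measurable in time, and they converge to
  -- `b t x` because good slices are continuous.
  · let φ : ℕ → ContDiffBump (0 : Vec d) := fun n =>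
      ⟨1 / (2 * ((n : ℝ) + 1)), 1 / ((n : ℝ) + 1), by positivity, by
        apply one_div_lt_one_div_of_lt <;> [positivity; linarith [(Nat.cast_nonneg n : (0:ℝ) ≤ n)]]⟩
    have hφ : Tendsto (fun n => (φ n).rOut) atTop (𝓝 0) := tendsto_one_div_add_atTop_nhds_zero_nat
    refine stronglyMeasurable_of_tendsto atTop (f := fun n => Nᶜ.indicator fun t =>
      ∫ y, (φ n).normed volume y • g (t, x - y)) (fun n => ?_) ?_
    · refine StronglyMeasurable.indicator ?_ hNm.compl
      refine StronglyMeasurable.integral_prod_right (f := fun t y => (φ n).normed volume y •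
        g (t, x - y)) ?_
      have h1 : StronglyMeasurable fun p : ℝ × Vec d => (φ n).normed volume p.2 :=
        ((φ n).continuous_normed.comp continuous_snd).stronglyMeasurable
      have h2 : StronglyMeasurable fun p : ℝ × Vec d => g (p.1, x - p.2) :=
        hg.comp_measurable (by fun_prop)
      exact h1.smul h2
    · rw [tendsto_pi_nhds]
      intro t
      rcases hSc t with ht | ht
      · simp only [indicator_of_mem ht]
        obtain ⟨h1, -, -, -, h5⟩ := hS t ht
        have := ContDiffBump.convolution_tendsto_right_of_continuous (μ := volume) hφ h1.continuous x
        refine this.congr fun n => ?_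
        rw [convolution_congr _ (ae_eq_refl _) h5]
        rfl
      · simp only [indicator_of_notMem ht]
        exact tendsto_const_nhds
  · rcases hSc t with ht | ht
    · rw [indicator_of_mem ht]; exact ((hS t ht).2.1 n x).trans (le_abs_self _)
    · rw [indicator_of_notMem ht, iteratedFDeriv_zero]; simp
  · have : ∀ᵐ t ∂(volume.restrict (Icc 0 T)), t ∈ Nᶜ := by
      rw [ae_iff]; simpa using hN0
    filter_upwards [this] with t ht using indicator_of_mem ht b
  · rcases hSc t with ht | ht
    · rw [indicator_of_mem ht]; exact (hS t ht).2.2.1 x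
    · rw [indicator_of_notMem ht, divergence_zero, abs_zero]; exact hM0
  · rcases hSc t with ht | ht
    · rw [indicator_of_mem ht]; exact (hS t ht).2.2.2.1 x
    · rw [indicator_of_notMem ht]; simp

/-! ### Divergence as a trace -/

/-- The trace, as a continuous linear functional on operators. -/
def traceCLM (d : ℕ) : (Vec d →L[ℝ] Vec d) →L[ℝ] ℝ :=
  ∑ i, (EuclideanSpace.proj i : Vec d →L[ℝ] ℝ).comp
    (ContinuousLinearMap.apply ℝ (Vec d) (EuclideanSpace.single i (1 : ℝ)))

theorem traceCLM_apply {d : ℕ} (A : Vec d →L[ℝ] Vec d) :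
    traceCLM d A = ∑ i, (A (EuclideanSpace.single i 1)) i := by
  simp [traceCLM]

theorem divergence_eq_trace {d : ℕ} (f : Vec d → Vec d) (x : Vec d) :
    divergence f x = traceCLM d (fderiv ℝ f x) := (traceCLM_apply _).symm

theorem IsBddFamily.divergence {d : ℕ} {f : ℝ → Vec d → Vec d} (hf : IsBddFamily f) :
    IsBddFamily fun r => RoughTransport.divergence (f r) := by
  have e : (fun r => RoughTransport.divergence (f r)) =
      fun r x => traceCLM d (_root_.fderiv ℝ (f r) x) :=
    funext fun r => funext fun x => divergence_eq_trace _ x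
  rw [e]
  exact hf.fderiv.clm_comp (traceCLM d)

/-! ### The flow -/

/-- The data of a flow along a regular drift, driven by a Hölder path. -/
structure IsRegularFlow {d : ℕ} (T γ : ℝ) (f : ℝ → Vec d → Vec d) (X : ℝ → Vec d)
    (Φ : ℝ → ℝ → Vec d → Vec d) : Prop where
  pos : 0 < γ
  drift : IsBddFamily f
  path : IsHolder T γ X
  flow : IsFlow T f X Φ

theorem IsFlow.congr {d : ℕ} {T : ℝ} {b f : ℝ → Vec d → Vec d} {X : ℝ → Vec d}
    {Φ : ℝ → ℝ → Vec d → Vec d} (h : IsFlow T b X Φ)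
    (hf : ∀ᵐ t ∂(volume.restrict (Icc 0 T)), f t = b t) : IsFlow T f X Φ := by
  intro q hq x
  refine ⟨(h q hq x).1, fun t ht => ?_⟩
  rw [(h q hq x).2 t ht]
  congr 2
  refine intervalIntegral.integral_congr_ae ?_
  filter_upwards [(ae_restrict_iff' measurableSet_Icc).1 hf] with r hr hrm
  rw [uIoc_of_le ht.1] at hrm
  rw [hr ⟨hq.1.trans hrm.1.le, hrm.2.trans ht.2⟩]

namespace IsRegularFlow

variable {d : ℕ} {T γ : ℝ} {f : ℝ → Vec d → Vec d} {X : ℝ → Vec d} {Φ : ℝ → ℝ → Vec d → Vec d}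

theorem norm_path_sub_le (h : IsRegularFlow T γ f X Φ) {s t : ℝ} (hs : s ∈ Icc 0 T)
    (ht : t ∈ Icc 0 T) : ‖X t - X s‖ ≤ T ^ γ * holderSeminorm T γ X := by
  refine (h.path.norm_sub_le hs ht).trans ?_
  rw [mul_comm]
  refine mul_le_mul_of_nonneg_right ?_ (holderSeminorm_nonneg _ _ _)
  refine Real.rpow_le_rpow (abs_nonneg _) ?_ h.pos.le
  rw [abs_le]
  constructor <;> linarith [hs.1, hs.2, ht.1, ht.2]

theorem norm_flow_sub_le (h : IsRegularFlow T γ f X Φ) {N : ℝ} (hN : ∀ t x, ‖f t x‖ ≤ N)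
    {q t : ℝ} (hq : q ∈ Icc 0 T) (ht : t ∈ Icc q T) (x : Vec d) :
    ‖Φ q t x - x‖ ≤ T * N + T ^ γ * holderSeminorm T γ X := by
  rw [(h.flow q hq x).2 t ht, add_assoc, add_sub_cancel_left]
  refine (norm_add_le _ _).trans (add_le_add ?_ (h.norm_path_sub_le hq ⟨hq.1.trans ht.1, ht.2⟩))
  refine (intervalIntegral.norm_integral_le_of_norm_le_const fun r _ => hN r _).trans ?_
  rw [mul_comm, abs_of_nonneg (sub_nonneg.2 ht.1)]
  have : 0 ≤ N := (norm_nonneg _).trans (hN q x)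
  gcongr
  linarith [hq.1, ht.2]

/-- The trajectories started at `x`, as an element of the path space. -/
theorem exists_path (h : IsRegularFlow T γ f X Φ) : ∃ Z : Vec d → pathSpace T (Vec d),
    (∀ x (p : TimePair T), (Z x).1 p = Φ p.start p.clamp x) ∧
    (∀ n : ℕ, ContDiff ℝ n Z) := by
  obtain ⟨N, hN⟩ := h.drift.exists_bound
  have mem : ∀ p : TimePair T, p.clamp ∈ Icc (p.start : ℝ) T :=
    fun p => ⟨p.start_le_clamp, p.clamp_le⟩
  have mem0 : ∀ p : TimePair T, p.clamp ∈ Icc (0 : ℝ) T :=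
    fun p => ⟨p.start.2.1.trans p.start_le_clamp, p.clamp_le⟩
  have clc : ∀ q : Icc (0 : ℝ) T, Continuous fun t : ℝ => (⟨q, t⟩ : TimePair T).clamp := by
    intro q; unfold TimePair.clamp; fun_prop
  have meas : ∀ x (q : Icc (0 : ℝ) T),
      StronglyMeasurable fun r => Φ q (⟨q, r⟩ : TimePair T).clamp x := fun x q =>
    ((h.flow q q.2 x).1.comp_continuous (clc q) fun t => mem ⟨q, t⟩).stronglyMeasurable
  set ρ := T * N + T ^ γ * holderSeminorm T γ X
  let Z : Vec d → pathSpace T (Vec d) := fun x =>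
    mkPath (fun p => Φ p.start p.clamp x) (‖x‖ + ρ)
      (fun p => by
        have := h.norm_flow_sub_le hN p.start.2 (mem p) x
        linarith [norm_le_norm_add_norm_sub' (Φ p.start p.clamp x) x]) (meas x)
  have hXc := h.path.continuousOn h.pos
  -- The rough driver enters as a forcing independent of `x`; its low regularity therefore does not
  -- limit the smoothness of the flow.
  let ζ : pathSpace T (Vec d) := mkPath (fun p => X p.clamp - X p.start)
    (T ^ γ * holderSeminorm T γ X) (fun p => h.norm_path_sub_le p.start.2 (mem0 p))
    fun q => (hXc.comp_continuous (clc q) fun t => mem0 ⟨q, t⟩).stronglyMeasurable.sub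
      (stronglyMeasurable_const (b := X q))
  have hZ : ∀ x, Z x = constPath x + ζ + integralPath (nemytskii h.drift (Z x)) := by
    intro x
    refine path_ext fun p => ?_
    have e := (h.flow p.start p.start.2 x).2 p.clamp (mem p)
    have e2 : ∫ r in (p.start : ℝ)..p.clamp, f r (Φ p.start r x) =
        ∫ r in (p.start : ℝ)..p.clamp, f r (Φ p.start (⟨p.start, r⟩ : TimePair T).clamp x) := by
      refine intervalIntegral.integral_congr fun r hr => ?_
      rw [uIcc_of_le p.start_le_clamp] at hr
      simp only [TimePair.clamp_of_mem hr.1 (hr.2.trans p.clamp_le)]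
    rw [e2] at e
    refine e.trans ?_
    rw [add_right_comm]
    rfl
  refine ⟨Z, fun _ _ => rfl, contDiff_solution h.drift ζ (continuous_solution h.drift ζ ?_ ?_ hZ) hZ⟩
  · intro x q
    refine (h.flow q q.2 x).1.congr fun t ht => ?_
    simp only [Z, mkPath_apply, TimePair.clamp_of_mem ht.1 ht.2]
  · intro x p
    simp only [Z, mkPath_apply, TimePair.clamp_of_mem p.start_le_clamp p.clamp_le]

/-- `g` is only measurable in time, so integrability is obtained from boundedness. Projecting the
time onto `[q,T]` makes the trajectory continuous on the whole line, which gives measurability of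
the composition. -/
theorem continuousOn_drift (h : IsRegularFlow T γ f X Φ) {F : Type*} [NormedAddCommGroup F]
    [NormedSpace ℝ F] {g : ℝ → Vec d → F} (hg : IsBddFamily g) {q : ℝ} (hq : q ∈ Icc 0 T)
    (x : Vec d) {s t : ℝ} (hs : s ∈ Icc q T) (ht : t ∈ Icc q T) :
    IntervalIntegrable (fun r => g r (Φ q r x)) volume s t := by
  obtain ⟨C, hC⟩ := hg.exists_bound
  have hqT : q ≤ T := hq.2
  have hcont : Continuous fun r => Φ q (projIcc q T hqT r) x :=
    (h.flow q hq x).1.comp_continuous (continuous_subtype_val.comp continuous_projIcc)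
      fun r => (projIcc q T hqT r).2
  have hm := hg.stronglyMeasurable_comp hcont.stronglyMeasurable
  have h1 : IntervalIntegrable (fun r => g r (Φ q (projIcc q T hqT r) x)) volume s t :=
    (intervalIntegrable_const (c := C)).mono_fun hm.aestronglyMeasurable
      (Eventually.of_forall fun r => (hC r _).trans (le_abs_self C))
  refine h1.congr fun r hr => ?_
  have hr : r ∈ Icc q T := (uIcc_subset_Icc hs ht) (uIoc_subset_uIcc hr)
  rw [projIcc_of_mem hqT hr]

/-- The flow property. -/
theorem comp (h : IsRegularFlow T γ f X Φ) {s t u : ℝ} (hs : 0 ≤ s) (hst : s ≤ t) (htu : t ≤ u)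
    (hu : u ≤ T) (x : Vec d) : Φ s u x = Φ t u (Φ s t x) := by
  obtain ⟨L, hL⟩ := h.drift.exists_bound_fderiv
  have ms : s ∈ Icc 0 T := ⟨hs, by linarith⟩
  have mt : t ∈ Icc 0 T := ⟨by linarith, by linarith⟩
  have mst : t ∈ Icc s T := ⟨hst, by linarith⟩
  have hc1 : ContinuousOn (fun r => Φ s r x) (Icc t u) :=
    (h.flow s ms x).1.mono (Icc_subset_Icc hst hu)
  have hc2 : ContinuousOn (fun r => Φ t r (Φ s t x)) (Icc t u) :=
    (h.flow t mt _).1.mono (Icc_subset_Icc_right hu)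
  have := integral_gronwall (w := fun r => ‖Φ s r x - Φ t r (Φ s t x)‖) (a := 0) (abs_nonneg L) htu
    (hc1.sub hc2).norm ?_ u ⟨htu, le_rfl⟩
  · rw [zero_mul, norm_le_zero_iff, sub_eq_zero] at this
    exact this
  · intro r hr
    have mr : r ∈ Icc s T := ⟨hst.trans hr.1, hr.2.trans hu⟩
    have mr' : r ∈ Icc t T := ⟨hr.1, hr.2.trans hu⟩
    have mtt : t ∈ Icc t T := ⟨le_rfl, htu.trans hu⟩
    have mss : s ∈ Icc s T := ⟨le_rfl, ms.2⟩
    have i1 := h.continuousOn_drift h.drift ms x mss mst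
    have i2 := h.continuousOn_drift h.drift ms x mst mr
    have i3 := h.continuousOn_drift h.drift mt (Φ s t x) mtt mr'
    have e : Φ s r x - Φ t r (Φ s t x) =
        ∫ q in t..r, (f q (Φ s q x) - f q (Φ t q (Φ s t x))) := by
      rw [intervalIntegral.integral_sub i2 i3, (h.flow t mt _).2 r mr', (h.flow s ms x).2 r mr,
        (h.flow s ms x).2 t mst, ← intervalIntegral.integral_add_adjacent_intervals i1 i2]
      abel
    rw [e, zero_add, ← intervalIntegral.integral_const_mul]
    refine intervalIntegral.norm_integral_le_of_norm_le hr.1 (Eventually.of_forall fun q _ => ?_) ?_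
    · exact norm_sub_le_of_norm_fderiv_le (h.drift.contDiff 1 q)
        (fun z => (hL q z).trans (le_abs_self L)) _ _
    · refine (ContinuousOn.intervalIntegrable ?_).const_mul _
      rw [uIcc_of_le hr.1]
      exact ((hc1.sub hc2).norm).mono (Icc_subset_Icc_right hr.2)

theorem backG_add (h : IsRegularFlow T γ f X Φ) {s t u : ℝ} (hs : 0 ≤ s) (hst : s ≤ t)
    (htu : t ≤ u) (hu : u ≤ T) (x : Vec d) :
    backG f Φ u s x = backG f Φ t s x + backG f Φ u t (Φ s t x) := by
  have ms : s ∈ Icc 0 T := ⟨hs, by linarith⟩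
  have mst : t ∈ Icc s T := ⟨hst, by linarith⟩
  unfold backG
  rw [← intervalIntegral.integral_add_adjacent_intervals
    (h.continuousOn_drift h.drift.divergence ms x ⟨le_rfl, ms.2⟩ mst)
    (h.continuousOn_drift h.drift.divergence ms x mst ⟨hst.trans htu, hu⟩)]
  congr 1
  refine intervalIntegral.integral_congr fun r hr => ?_
  rw [uIcc_of_le htu] at hr
  simp only [h.comp hs hst hr.1 (hr.2.trans hu) x]

/-- This cocycle identity is the source of every statement about the dependence of `ψ` on time. -/
theorem backSol_comp (h : IsRegularFlow T γ f X Φ) (φ₀ : Vec d → ℝ) {s t u : ℝ} (hs : 0 ≤ s)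
    (hst : s ≤ t) (htu : t ≤ u) (hu : u ≤ T) (x : Vec d) :
    backSol f Φ φ₀ u s x = backSol f Φ φ₀ u t (Φ s t x) * Real.exp (backG f Φ t s x) := by
  unfold backSol
  rw [h.backG_add hs hst htu hu, h.comp hs hst htu hu, Real.exp_add]
  ring

end IsRegularFlow

theorem backG_congr {d : ℕ} {T : ℝ} {b f : ℝ → Vec d → Vec d} {Φ : ℝ → ℝ → Vec d → Vec d}
    (hf : ∀ᵐ t ∂(volume.restrict (Icc 0 T)), f t = b t) {t₀ q : ℝ} (hq : 0 ≤ q) (hqt : q ≤ t₀)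
    (ht : t₀ ≤ T) : backG b Φ t₀ q = backG f Φ t₀ q := by
  funext x
  refine intervalIntegral.integral_congr_ae ?_
  filter_upwards [(ae_restrict_iff' measurableSet_Icc).1 hf] with r hr hrm
  rw [uIoc_of_le hqt] at hrm
  rw [hr ⟨hq.trans hrm.1.le, hrm.2.trans ht⟩]

/-! ### Families of smooth functions of a given size -/

/-- A family of smooth functions `F i`, all of whose derivatives are `O(τ i)` locally uniformly. -/
structure IsSized {ι E G : Type*} [NormedAddCommGroup E] [NormedSpace ℝ E]
    [NormedAddCommGroup G] [NormedSpace ℝ G] (τ : ι → ℝ) (F : ι → E → G) : Prop where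
  smooth : ∀ i, ContDiff ℝ ∞ (F i)
  bound : ∀ (n : ℕ) (R : ℝ), ∃ C, ∀ i x, ‖x‖ ≤ R → ‖iteratedFDeriv ℝ n (F i) x‖ ≤ C * τ i

/-- The binomial weights in the Leibniz rule add up to `2 ^ n`. The constant is chosen before the
functions, so that it can be used for a whole family. -/
theorem exists_norm_iteratedFDeriv_bilinear_le {E G H K : Type*} [NormedAddCommGroup E]
    [NormedSpace ℝ E] [NormedAddCommGroup G] [NormedSpace ℝ G] [NormedAddCommGroup H]
    [NormedSpace ℝ H] [NormedAddCommGroup K] [NormedSpace ℝ K] (B : G →L[ℝ] H →L[ℝ] K) (N : ℕ) :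
    ∃ c, 0 ≤ c ∧ ∀ n ≤ N, ∀ {f : E → G} {g : E → H} {x : E} {a b : ℝ}, ContDiff ℝ n f →
      ContDiff ℝ n g → (∀ k ≤ n, ‖iteratedFDeriv ℝ k f x‖ ≤ a) →
      (∀ k ≤ n, ‖iteratedFDeriv ℝ k g x‖ ≤ b) →
      ‖iteratedFDeriv ℝ n (fun y => B (f y) (g y)) x‖ ≤ c * a * b := by
  refine ⟨‖B‖ * 2 ^ N, mul_nonneg B.opNorm_nonneg (by positivity), ?_⟩
  intro n hn f g x a b hf hg ha hb
  have ha0 : 0 ≤ a := (norm_nonneg _).trans (ha 0 (Nat.zero_le _))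
  have hb0 : 0 ≤ b := (norm_nonneg _).trans (hb 0 (Nat.zero_le _))
  refine (B.norm_iteratedFDeriv_le_of_bilinear hf hg x le_rfl).trans ?_
  rw [mul_assoc, mul_assoc]
  refine mul_le_mul_of_nonneg_left ?_ B.opNorm_nonneg
  have : (2 : ℝ) ^ n * (a * b) = ∑ k ∈ Finset.range (n + 1), (n.choose k : ℝ) * (a * b) := by
    rw [← Finset.sum_mul]
    congr 1
    exact_mod_cast (Nat.sum_range_choose n).symm
  refine le_trans ?_ (mul_le_mul_of_nonneg_right (pow_le_pow_right₀ one_le_two hn)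
    (mul_nonneg ha0 hb0))
  rw [this]
  refine Finset.sum_le_sum fun k hk => ?_
  rw [mul_assoc]
  exact mul_le_mul_of_nonneg_left (mul_le_mul (ha k (Nat.lt_succ_iff.1 (Finset.mem_range.1 hk)))
    (hb _ (Nat.sub_le _ _)) (norm_nonneg _) ha0) (Nat.cast_nonneg _)

namespace IsSized

variable {ι : Type*} {E G H K : Type} [NormedAddCommGroup E] [NormedSpace ℝ E]
    [NormedAddCommGroup G] [NormedSpace ℝ G] [NormedAddCommGroup H] [NormedSpace ℝ H]
    [NormedAddCommGroup K] [NormedSpace ℝ K]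
    {τ σ : ι → ℝ} {F F' : ι → E → G}

theorem contDiff (hF : IsSized τ F) (n : ℕ) (i : ι) : ContDiff ℝ n (F i) :=
  (hF.smooth i).of_le (by exact_mod_cast le_top)

theorem exists_bound (hF : IsSized τ F) (R : ℝ) :
    ∃ C, ∀ i x, ‖x‖ ≤ R → ‖F i x‖ ≤ C * τ i := by
  simpa using hF.bound 0 R

/-- A common constant for all derivatives up to a given order. -/
theorem exists_bound_of_le (hF : IsSized τ F) (hτ : ∀ i, 0 ≤ τ i) (n : ℕ) (R : ℝ) :
    ∃ C, 1 ≤ C ∧ ∀ k ≤ n, ∀ i x, ‖x‖ ≤ R → ‖iteratedFDeriv ℝ k (F i) x‖ ≤ C * τ i := by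
  choose C hC using fun k => hF.bound k R
  refine ⟨1 + ∑ k ∈ Finset.range (n + 1), |C k|,
    le_add_of_nonneg_right (Finset.sum_nonneg fun _ _ => abs_nonneg _), fun k hk i x hx => ?_⟩
  refine (hC k i x hx).trans (mul_le_mul_of_nonneg_right ?_ (hτ i))
  have := Finset.single_le_sum (f := fun k => |C k|) (fun _ _ => abs_nonneg _)
    (Finset.mem_range.2 (Nat.lt_succ_of_le hk))
  linarith [le_abs_self (C k)]

theorem fderiv (hF : IsSized τ F) : IsSized τ fun i => _root_.fderiv ℝ (F i) where
  smooth i := (hF.smooth i).fderiv_right le_rfl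
  bound n R := by
    obtain ⟨C, hC⟩ := hF.bound (n + 1) R
    exact ⟨C, fun i x hx => by rw [norm_iteratedFDeriv_fderiv]; exact hC i x hx⟩

theorem add (hF : IsSized τ F) (hF' : IsSized τ F') : IsSized τ fun i x => F i x + F' i x where
  smooth i := (hF.smooth i).add (hF'.smooth i)
  bound n R := by
    obtain ⟨C, hC⟩ := hF.bound n R
    obtain ⟨C', hC'⟩ := hF'.bound n R
    refine ⟨C + C', fun i x hx => ?_⟩
    have : iteratedFDeriv ℝ n (fun x => F i x + F' i x) x = _ :=
      iteratedFDeriv_add_apply (hF.contDiff n i).contDiffAt (hF'.contDiff n i).contDiffAt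
    rw [this, add_mul]
    exact (norm_add_le _ _).trans (add_le_add (hC i x hx) (hC' i x hx))

theorem bilinear (B : G →L[ℝ] H →L[ℝ] K) {F' : ι → E → H} (hτ : ∀ i, 0 ≤ τ i)
    (hσ : ∀ i, 0 ≤ σ i) (hF : IsSized τ F) (hF' : IsSized σ F') :
    IsSized (fun i => τ i * σ i) fun i x => B (F i x) (F' i x) where
  smooth i := B.isBoundedBilinearMap.contDiff.comp₂ (hF.smooth i) (hF'.smooth i)
  bound n R := by
    obtain ⟨C, hC1, hC⟩ := hF.exists_bound_of_le hτ n R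
    obtain ⟨C', hC1', hC'⟩ := hF'.exists_bound_of_le hσ n R
    obtain ⟨c, -, hc⟩ := exists_norm_iteratedFDeriv_bilinear_le (E := E) B n
    refine ⟨c * C * C', fun i x hx => ?_⟩
    refine (hc n le_rfl (hF.contDiff n i) (hF'.contDiff n i)
      (fun k hk => hC k hk i x hx) (fun k hk => hC' k hk i x hx)).trans (le_of_eq (by ring))

theorem congr_size (hF : IsSized τ F) (h : ∀ i, τ i = σ i) : IsSized σ F :=
  (funext h : τ = σ) ▸ hF

theorem clm_comp (hF : IsSized τ F) (B : G →L[ℝ] H) : IsSized τ fun i x => B (F i x) where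
  smooth i := B.contDiff.comp (hF.smooth i)
  bound n R := by
    obtain ⟨C, hC⟩ := hF.bound n R
    refine ⟨‖B‖ * C, fun i x hx => ?_⟩
    rw [mul_assoc]
    exact (B.norm_iteratedFDeriv_comp_left (hF.contDiff n i).contDiffAt le_rfl).trans
      (by gcongr; exact hC i x hx)

/-- Images of one smooth function under a family of operators. -/
theorem of_clm [FiniteDimensional ℝ E] {w : E → G} (hw : ∀ n : ℕ, ContDiff ℝ n w)
    (B : ι → G →L[ℝ] H) (hB : ∀ i, ‖B i‖ ≤ τ i) : IsSized τ fun i x => B i (w x) where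
  smooth i := contDiff_infty.2 fun n => (B i).contDiff.comp (hw n)
  bound n R := by
    obtain ⟨C, hC⟩ := (isCompact_closedBall (0 : E) R).exists_bound_of_continuousOn
      ((hw n).continuous_iteratedFDeriv le_rfl).continuousOn
    refine ⟨C, fun i x hx => ?_⟩
    refine ((B i).norm_iteratedFDeriv_comp_left (hw n).contDiffAt le_rfl).trans ?_
    rw [mul_comm]
    exact mul_le_mul (hC x (mem_closedBall_zero_iff.2 hx)) (hB i) (norm_nonneg _)
      ((norm_nonneg _).trans (hC x (mem_closedBall_zero_iff.2 hx)))

theorem comp {h : ι → G → H} (hh : IsSized (fun _ => 1) h) (hF : IsSized (fun _ => 1) F) :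
    IsSized (fun _ => 1) fun i x => h i (F i x) where
  smooth i := (hh.smooth i).comp (hF.smooth i)
  bound n R := by
    obtain ⟨D, hD1, hD⟩ := hF.exists_bound_of_le (fun _ => zero_le_one) n R
    obtain ⟨C, hC1, hC⟩ := hh.exists_bound_of_le (fun _ => zero_le_one) n D
    refine ⟨n.factorial * C * D ^ n, fun i x hx => ?_⟩
    rw [mul_one]
    refine norm_iteratedFDeriv_comp_le (hh.contDiff n i) (hF.contDiff n i) le_rfl x
      (fun k hk => ?_) (fun k h1 hk => ?_)
    · have h0 := hD 0 (Nat.zero_le _) i x hx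
      rw [norm_iteratedFDeriv_zero, mul_one] at h0
      simpa using hC k hk i _ h0
    -- The bound for compositions asks for `D ^ k` at order `k`; taking `D ≥ 1` makes the common
    -- constant `D` sufficient for `k ≥ 1`.
    · exact (hD k hk i x hx).trans (by rw [mul_one]; exact le_self_pow₀ hD1 (by omega))

theorem mono_size_const (hF : IsSized τ F) {c : ℝ} (hσ : ∀ i, τ i ≤ c) (hτ : ∀ i, 0 ≤ τ i) :
    IsSized (fun _ => 1) F where
  smooth := hF.smooth
  bound n R := by
    obtain ⟨C, hC1, hC⟩ := hF.exists_bound_of_le hτ n R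
    exact ⟨C * c, fun i x hx => (hC n le_rfl i x hx).trans (by rw [mul_one]; gcongr; exact hσ i)⟩

/-- Moving the argument of a bounded family by a family of size `τ` changes it by a family of
size `τ`. -/
theorem comp_add_sub_comp {B A : ι → E → G} (hB : IsSized (fun _ => 1) B) (hA : IsSized τ A)
    (hτ : ∀ i, 0 ≤ τ i) {c : ℝ} (hc : ∀ i, τ i ≤ c) {h : ι → G → H}
    (hh : IsSized (fun _ => 1) h) :
    IsSized τ fun i x => h i (B i x + A i x) - h i (B i x) := by
  have hA1 := hA.mono_size_const hc hτ
  have hBA := hB.add hA1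
  have smooth : ∀ {H : Type} [NormedAddCommGroup H] [NormedSpace ℝ H] {h : ι → G → H},
      IsSized (fun _ => 1) h → ∀ i,
      ContDiff ℝ ∞ fun x => h i (B i x + A i x) - h i (B i x) := fun hh i =>
    ((hh.smooth i).comp (hBA.smooth i)).sub ((hh.smooth i).comp (hB.smooth i))
  -- The induction runs over all `h` and all targets at once, since its step applies the hypothesis
  -- to the derivative of `h`.
  suffices H : ∀ n : ℕ, ∀ {H : Type} [NormedAddCommGroup H] [NormedSpace ℝ H] {h : ι → G → H},
      IsSized (fun _ => 1) h → ∀ R : ℝ, ∃ C, ∀ k ≤ n, ∀ i x, ‖x‖ ≤ R →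
        ‖iteratedFDeriv ℝ k (fun x => h i (B i x + A i x) - h i (B i x)) x‖ ≤ C * τ i by
    refine ⟨smooth hh, fun n R => ?_⟩
    obtain ⟨C, hC⟩ := H n hh R
    exact ⟨C, hC n le_rfl⟩
  intro n
  have zero : ∀ {H : Type} [NormedAddCommGroup H] [NormedSpace ℝ H] {h : ι → G → H},
      IsSized (fun _ => 1) h → ∀ R : ℝ, ∃ C, ∀ i x, ‖x‖ ≤ R →
        ‖h i (B i x + A i x) - h i (B i x)‖ ≤ C * τ i := by
    intro H _ _ h hh R
    obtain ⟨C, hC⟩ := hA.exists_bound R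
    obtain ⟨D, hD⟩ := hB.exists_bound R
    obtain ⟨D', hD'⟩ := hBA.exists_bound R
    obtain ⟨L, hL⟩ := hh.fderiv.exists_bound (max D D')
    refine ⟨|L| * C, fun i x hx => ?_⟩
    have h2 := hD i x hx
    have h3 := hD' i x hx
    rw [mul_one] at h2 h3
    have := (convex_closedBall (0 : G) (max D D')).norm_image_sub_le_of_norm_fderiv_le
      (f := h i) (C := |L|) (fun y _ => (hh.contDiff 1 i).differentiable one_ne_zero y)
      (fun y hy => (hL i y (mem_closedBall_zero_iff.1 hy)).trans
        (by rw [mul_one]; exact le_abs_self L))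
      (mem_closedBall_zero_iff.2 (h2.trans (le_max_left _ _)))
      (mem_closedBall_zero_iff.2 (h3.trans (le_max_right _ _)))
    refine this.trans ?_
    rw [add_sub_cancel_left, mul_assoc]
    exact mul_le_mul_of_nonneg_left (hC i x hx) (abs_nonneg _)
  induction n with
  | zero =>
    intro H _ _ h hh R
    obtain ⟨C, hC⟩ := zero hh R
    refine ⟨C, fun k hk i x hx => ?_⟩
    obtain rfl : k = 0 := by omega
    rw [norm_iteratedFDeriv_zero]
    exact hC i x hx
  | succ n ih =>
    intro H _ _ h hh R
    obtain ⟨C₀, hC₀⟩ := zero hh R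
    obtain ⟨C, hC⟩ := ih hh.fderiv R
    let L := ContinuousLinearMap.compL ℝ E G H
    have m1 : ∀ i : ι, (0 : ℝ) ≤ (fun _ : ι => (1 : ℝ)) i := fun _ => zero_le_one
    obtain ⟨C₂, hC₂1, hC₂⟩ := (bilinear L m1 hτ (hh.fderiv.comp hBA) hA.fderiv).exists_bound_of_le
      (fun i => by simpa using hτ i) n R
    obtain ⟨b, hb1, hb⟩ := hB.fderiv.exists_bound_of_le m1 n R
    -- The first term has the same form with `h` replaced by its derivative, so the induction
    -- hypothesis applies; in the second the smallness comes from the derivative of `A`.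
    have hder : ∀ i, (_root_.fderiv ℝ fun x => h i (B i x + A i x) - h i (B i x)) =
        (fun x => L (_root_.fderiv ℝ (h i) (B i x + A i x) - _root_.fderiv ℝ (h i) (B i x))
            (_root_.fderiv ℝ (B i) x)) +
          fun x => L (_root_.fderiv ℝ (h i) (B i x + A i x)) (_root_.fderiv ℝ (A i) x) := by
      intro i
      funext x
      have dh := fun y => ((hh.contDiff 1 i).differentiable one_ne_zero y).hasFDerivAt
      have dB := ((hB.contDiff 1 i).differentiable one_ne_zero x).hasFDerivAt
      have dA := ((hA.contDiff 1 i).differentiable one_ne_zero x).hasFDerivAt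
      have d1 := (dh (B i x + A i x)).comp x (dB.add dA)
      have d2 := (dh (B i x)).comp x dB
      refine (d1.sub d2).fderiv.trans ?_
      ext v
      simp [L]
      abel
    obtain ⟨c, hc0, hc⟩ := exists_norm_iteratedFDeriv_bilinear_le (E := E) L n
    refine ⟨max C₀ (c * |C| * b + |C₂|), fun k hk i x hx => ?_⟩
    rcases k with _ | k
    · rw [norm_iteratedFDeriv_zero]
      exact (hC₀ i x hx).trans (mul_le_mul_of_nonneg_right (le_max_left _ _) (hτ i))
    · refine le_trans ?_ (mul_le_mul_of_nonneg_right (le_max_right _ _) (hτ i))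
      have hkn : k ≤ n := by omega
      rw [← norm_iteratedFDeriv_fderiv, hder i]
      have s1 : ContDiff ℝ k fun x => L (_root_.fderiv ℝ (h i) (B i x + A i x) -
          _root_.fderiv ℝ (h i) (B i x)) (_root_.fderiv ℝ (B i) x) :=
        L.isBoundedBilinearMap.contDiff.comp₂ ((smooth hh.fderiv i).of_le (by exact_mod_cast le_top))
          (hB.fderiv.contDiff k i)
      have s2 := (bilinear L m1 hτ (hh.fderiv.comp hBA) hA.fderiv).contDiff k i
      rw [iteratedFDeriv_add_apply s1.contDiffAt s2.contDiffAt, add_mul]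
      refine (norm_add_le _ _).trans (add_le_add ?_ ?_)
      · refine (hc k hkn
          ((smooth hh.fderiv i).of_le (by exact_mod_cast le_top)) (hB.fderiv.contDiff k i)
          (fun j hj => (hC j (hj.trans hkn) i x hx).trans
            (mul_le_mul_of_nonneg_right (le_abs_self C) (hτ i)))
          (fun j hj => hb j (hj.trans hkn) i x hx)).trans (le_of_eq (by ring))
      · refine (hC₂ k hkn i x hx).trans ?_
        rw [one_mul]
        exact mul_le_mul_of_nonneg_right (le_abs_self _) (hτ i)

end IsSized

/-! ### Families transported along a path -/

/-- A family of smooth functions on `[0,T]`, all of whose derivatives are bounded, which moves along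
the path `X` up to an error of linear size. -/
structure IsTransported {d : ℕ} (T R : ℝ) (X : ℝ → Vec d) (ψ : ℝ → Vec d → ℝ) : Prop where
  smooth : ∀ q ∈ Icc 0 T, ContDiff ℝ ∞ (ψ q)
  bound : ∀ n : ℕ, ∃ C, 0 ≤ C ∧ ∀ q ∈ Icc 0 T, ∀ x, ‖iteratedFDeriv ℝ n (ψ q) x‖ ≤ C
  support : ∀ q ∈ Icc 0 T, ∀ x, ψ q x ≠ 0 → ‖x‖ ≤ R
  increment : ∀ n : ℕ, ∃ C, 0 ≤ C ∧ ∀ s t, 0 ≤ s → s ≤ t → t ≤ T → ∀ x,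
    ‖iteratedFDeriv ℝ n (fun x => ψ s x - ψ t (x + (X t - X s))) x‖ ≤ C * (t - s)

section Iterated

variable {E F : Type*} [NormedAddCommGroup E] [NormedSpace ℝ E] [NormedAddCommGroup F]
  [NormedSpace ℝ F] {f g : E → F}

theorem norm_fderiv_eq (f : E → F) (x : E) : ‖fderiv ℝ f x‖ = ‖iteratedFDeriv ℝ 1 f x‖ := by
  rw [norm_iteratedFDeriv_one]

theorem norm_fderiv_fderiv_eq (f : E → F) (x : E) :
    ‖fderiv ℝ (fderiv ℝ f) x‖ = ‖iteratedFDeriv ℝ 2 f x‖ := by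
  rw [norm_fderiv_eq, norm_iteratedFDeriv_fderiv]

theorem norm_iteratedFDeriv_sub_le {n : ℕ} {C : ℝ} (hf : ContDiff ℝ (n + 1 : ℕ) f)
    (h : ∀ x, ‖iteratedFDeriv ℝ (n + 1) f x‖ ≤ C) (a b : E) :
    ‖iteratedFDeriv ℝ n f b - iteratedFDeriv ℝ n f a‖ ≤ C * ‖b - a‖ := by
  refine convex_univ.norm_image_sub_le_of_norm_fderiv_le (𝕜 := ℝ)
    (fun x _ => (hf.differentiable_iteratedFDeriv (by exact_mod_cast n.lt_succ_self)) x)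
    (fun x _ => ?_) (mem_univ a) (mem_univ b)
  rw [norm_fderiv_iteratedFDeriv]
  exact h x

theorem fderiv_fderiv_sub {x : E} (hf : ContDiff ℝ 2 f) (hg : ContDiff ℝ 2 g) :
    fderiv ℝ (fderiv ℝ fun x => f x - g x) x =
      fderiv ℝ (fderiv ℝ f) x - fderiv ℝ (fderiv ℝ g) x := by
  have e : (fderiv ℝ fun x => f x - g x) = fun x => fderiv ℝ f x - fderiv ℝ g x := funext fun x =>
    fderiv_fun_sub (hf.differentiable two_ne_zero x) (hg.differentiable two_ne_zero x)
  rw [e]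
  exact fderiv_fun_sub ((hf.fderiv_right (m := 1) (by norm_num)).differentiable one_ne_zero x)
    ((hg.fderiv_right (m := 1) (by norm_num)).differentiable one_ne_zero x)

end Iterated

/-- Used throughout to absorb linear errors into Hölder errors on a bounded interval. -/
theorem le_rpow_mul_rpow {T γ τ : ℝ} (hτ : 0 ≤ τ) (hτT : τ ≤ T) (hγ : 0 < γ) (hγ1 : γ ≤ 1) :
    τ ≤ T ^ (1 - γ) * τ ^ γ := by
  rcases hτ.eq_or_lt with h | h
  · rw [← h, Real.zero_rpow hγ.ne', mul_zero]
  · calc τ = τ ^ (1 - γ) * τ ^ γ := by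
          rw [← Real.rpow_add h, sub_add_cancel, Real.rpow_one]
      _ ≤ _ := by
          gcongr

namespace IsTransported

variable {d : ℕ} {T R γ : ℝ} {X : ℝ → Vec d} {ψ : ℝ → Vec d → ℝ}

theorem contDiff (h : IsTransported T R X ψ) {q : ℝ} (hq : q ∈ Icc 0 T) (n : ℕ) :
    ContDiff ℝ n (ψ q) := (h.smooth q hq).of_le (by exact_mod_cast le_top)

theorem exists_abs_le (h : IsTransported T R X ψ) :
    ∃ C, 0 ≤ C ∧ ∀ q ∈ Icc 0 T, ∀ x, |ψ q x| ≤ C := by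
  simpa using h.bound 0

theorem exists_fderiv_le (h : IsTransported T R X ψ) :
    ∃ C, 0 ≤ C ∧ ∀ q ∈ Icc 0 T, ∀ x, ‖fderiv ℝ (ψ q) x‖ ≤ C := by
  simpa using h.bound 1

/-- All spatial derivatives are Hölder continuous in time. -/
theorem holder (h : IsTransported T R X ψ) (hX : IsHolder T γ X) (hγ : 0 < γ) (hγ1 : γ ≤ 1)
    (n : ℕ) : ∃ C, 0 ≤ C ∧ ∀ s ∈ Icc 0 T, ∀ t ∈ Icc 0 T, ∀ x,
      ‖iteratedFDeriv ℝ n (fun x => ψ t x - ψ s x) x‖ ≤ C * |t - s| ^ γ := by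
  obtain ⟨C₁, h1, hC₁⟩ := h.bound (n + 1)
  obtain ⟨C₂, h2, hC₂⟩ := h.increment n
  obtain ⟨H, hH, hXH⟩ := hX.exists_nonneg
  rcases lt_or_ge T 0 with hT | hT
  · exact ⟨0, le_rfl, fun s hs => absurd (hs.1.trans hs.2) (not_le.2 hT)⟩
  have key : ∀ s t, 0 ≤ s → s ≤ t → t ≤ T → ∀ x,
      ‖iteratedFDeriv ℝ n (fun x => ψ t x - ψ s x) x‖ ≤
        (C₁ * H + C₂ * T ^ (1 - γ)) * |t - s| ^ γ := by
    intro s t hs hst ht x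
    have ms : s ∈ Icc 0 T := ⟨hs, hst.trans ht⟩
    have mt : t ∈ Icc 0 T := ⟨hs.trans hst, ht⟩
    have hshift : ContDiff ℝ n fun x => ψ t (x + (X t - X s)) :=
      (h.contDiff mt n).comp (contDiff_id.add contDiff_const)
    have e0 : iteratedFDeriv ℝ n (fun x => ψ t x - ψ s x) x =
        iteratedFDeriv ℝ n (ψ t) x - iteratedFDeriv ℝ n (ψ s) x :=
      iteratedFDeriv_sub_apply (h.contDiff mt n).contDiffAt (h.contDiff ms n).contDiffAt
    have e1 : iteratedFDeriv ℝ n (fun x => ψ s x - ψ t (x + (X t - X s))) x =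
        iteratedFDeriv ℝ n (ψ s) x - iteratedFDeriv ℝ n (ψ t) (x + (X t - X s)) := by
      rw [← iteratedFDeriv_comp_add_right]
      exact iteratedFDeriv_sub_apply (h.contDiff ms n).contDiffAt hshift.contDiffAt
    -- At a fixed point the change in time is the transported increment, of order `t - s`, plus a
    -- spatial displacement by `X t - X s`, which limits the regularity to `γ`.
    have e : iteratedFDeriv ℝ n (fun x => ψ t x - ψ s x) x =
        -(iteratedFDeriv ℝ n (ψ t) (x + (X t - X s)) - iteratedFDeriv ℝ n (ψ t) x) -
        iteratedFDeriv ℝ n (fun x => ψ s x - ψ t (x + (X t - X s))) x := by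
      rw [e0, e1]; abel
    have b1 := norm_iteratedFDeriv_sub_le (h.contDiff mt (n + 1)) (hC₁ t mt) x (x + (X t - X s))
    rw [add_sub_cancel_left] at b1
    have hτ : 0 ≤ t - s := by linarith
    have b2 : t - s ≤ T ^ (1 - γ) * (t - s) ^ γ :=
      le_rpow_mul_rpow hτ (by linarith) hγ hγ1
    have b3 := hXH s ms t mt
    rw [abs_of_nonneg hτ] at b3 ⊢
    rw [e]
    refine (norm_sub_le _ _).trans ?_
    rw [norm_neg]
    calc _ ≤ C₁ * (H * (t - s) ^ γ) + C₂ * (T ^ (1 - γ) * (t - s) ^ γ) :=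
          add_le_add (b1.trans (by gcongr)) ((hC₂ s t hs hst ht x).trans (by gcongr))
      _ = _ := by ring
  refine ⟨C₁ * H + C₂ * T ^ (1 - γ), by positivity, fun s hs t ht x => ?_⟩
  rcases le_total s t with hst | hst
  · exact key s t hs.1 hst ht.2 x
  · have e : (fun x => ψ t x - ψ s x) = -fun x => ψ s x - ψ t x := by
      funext x; simp
    rw [e, iteratedFDeriv_neg, abs_sub_comm]
    simpa using key t s ht.1 hst hs.2 x

theorem abs_sub_le (h : IsTransported T R X ψ) (hX : IsHolder T γ X) (hγ : 0 < γ) (hγ1 : γ ≤ 1) :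
    ∃ C, 0 ≤ C ∧ ∀ s ∈ Icc 0 T, ∀ t ∈ Icc 0 T, ∀ x, |ψ t x - ψ s x| ≤ C * |t - s| ^ γ := by
  simpa using h.holder hX hγ hγ1 0

theorem norm_fderiv_sub_le (h : IsTransported T R X ψ) (hX : IsHolder T γ X) (hγ : 0 < γ)
    (hγ1 : γ ≤ 1) : ∃ C, 0 ≤ C ∧ ∀ s ∈ Icc 0 T, ∀ t ∈ Icc 0 T, ∀ x,
      ‖fderiv ℝ (ψ t) x - fderiv ℝ (ψ s) x‖ ≤ C * |t - s| ^ γ := by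
  obtain ⟨C, hC0, hC⟩ := h.holder hX hγ hγ1 1
  refine ⟨C, hC0, fun s hs t ht x => ?_⟩
  have := hC s hs t ht x
  rwa [← norm_fderiv_eq, fderiv_fun_sub ((h.contDiff ht 1).differentiable one_ne_zero x)
    ((h.contDiff hs 1).differentiable one_ne_zero x)] at this

theorem norm_fderiv_fderiv_sub_le (h : IsTransported T R X ψ) (hX : IsHolder T γ X) (hγ : 0 < γ)
    (hγ1 : γ ≤ 1) : ∃ C, 0 ≤ C ∧ ∀ s ∈ Icc 0 T, ∀ t ∈ Icc 0 T, ∀ x,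
      ‖fderiv ℝ (fderiv ℝ (ψ t)) x - fderiv ℝ (fderiv ℝ (ψ s)) x‖ ≤ C * |t - s| ^ γ := by
  obtain ⟨C, hC0, hC⟩ := h.holder hX hγ hγ1 2
  refine ⟨C, hC0, fun s hs t ht x => ?_⟩
  have := hC s hs t ht x
  rwa [← norm_fderiv_fderiv_eq, fderiv_fderiv_sub (h.contDiff ht 2) (h.contDiff hs 2)] at this

theorem continuousOn_of_norm_sub_le {F : Type*} [NormedAddCommGroup F] {y : ℝ → F} {C : ℝ}
    (hγ : 0 < γ) (h : ∀ s ∈ Icc 0 T, ∀ t ∈ Icc 0 T, ‖y t - y s‖ ≤ C * |t - s| ^ γ) :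
    ContinuousOn y (Icc 0 T) :=
  IsHolder.continuousOn ⟨C, h⟩ hγ

theorem continuousOn_apply (h : IsTransported T R X ψ) (hX : IsHolder T γ X) (hγ : 0 < γ)
    (hγ1 : γ ≤ 1) (x : Vec d) : ContinuousOn (fun q => ψ q x) (Icc 0 T) := by
  obtain ⟨C, -, hC⟩ := h.abs_sub_le hX hγ hγ1
  exact continuousOn_of_norm_sub_le hγ fun s hs t ht => hC s hs t ht x

theorem continuousOn_fderiv (h : IsTransported T R X ψ) (hX : IsHolder T γ X) (hγ : 0 < γ)
    (hγ1 : γ ≤ 1) (x : Vec d) : ContinuousOn (fun q => fderiv ℝ (ψ q) x) (Icc 0 T) := by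
  obtain ⟨C, -, hC⟩ := h.norm_fderiv_sub_le hX hγ hγ1
  exact continuousOn_of_norm_sub_le hγ fun s hs t ht => hC s hs t ht x

end IsTransported

/-! ### The backward solution is transported -/

/-- Ordered pairs of times in `[0,T]`. -/
def TimeInterval (T : ℝ) := {p : ℝ × ℝ // 0 ≤ p.1 ∧ p.1 ≤ p.2 ∧ p.2 ≤ T}

/-- The length of a time interval. -/
def TimeInterval.length {T : ℝ} (p : TimeInterval T) : ℝ := p.1.2 - p.1.1

theorem TimeInterval.length_nonneg {T : ℝ} (p : TimeInterval T) : 0 ≤ p.length :=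
  sub_nonneg.2 p.2.2.1

theorem TimeInterval.length_le {T : ℝ} (p : TimeInterval T) : p.length ≤ T := by
  have := p.2
  unfold TimeInterval.length
  linarith

theorem IsSized.reindex {ι κ E G : Type*} [NormedAddCommGroup E] [NormedSpace ℝ E]
    [NormedAddCommGroup G] [NormedSpace ℝ G] {τ : ι → ℝ} {F : ι → E → G} (h : IsSized τ F)
    (e : κ → ι) : IsSized (fun k => τ (e k)) fun k => F (e k) where
  smooth k := h.smooth (e k)
  bound n R := (h.bound n R).imp fun _ hC k => hC (e k)

theorem isSized_const {ι : Type*} {E G : Type} [NormedAddCommGroup E] [NormedSpace ℝ E]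
    [FiniteDimensional ℝ E] [NormedAddCommGroup G] [NormedSpace ℝ G] {c : ι → G} {C : ℝ}
    (hc : ∀ i, ‖c i‖ ≤ C) : IsSized (fun _ : ι => (1 : ℝ)) fun i (_ : E) => c i where
  smooth _ := contDiff_const
  bound n R := by
    refine ⟨|C|, fun i x _ => ?_⟩
    rw [mul_one]
    rcases n with _ | n
    · rw [norm_iteratedFDeriv_zero]; exact (hc i).trans (le_abs_self C)
    · rw [iteratedFDeriv_succ_const]; simp

theorem isSized_single {ι : Type*} {E G : Type} [NormedAddCommGroup E] [NormedSpace ℝ E]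
    [FiniteDimensional ℝ E] [NormedAddCommGroup G] [NormedSpace ℝ G] {w : E → G}
    (hw : ContDiff ℝ ∞ w) : IsSized (fun _ : ι => (1 : ℝ)) fun _ => w :=
  IsSized.of_clm (fun n => hw.of_le (by exact_mod_cast le_top))
    (fun _ => ContinuousLinearMap.id ℝ G) fun _ => ContinuousLinearMap.norm_id_le

namespace IsRegularFlow

variable {d : ℕ} {T γ : ℝ} {f : ℝ → Vec d → Vec d} {X : ℝ → Vec d} {Φ : ℝ → ℝ → Vec d → Vec d}

/-- The integral is a linear operator on path space, of norm at most the length of the interval,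
applied to one smooth map of `x` that does not depend on the interval. Hence all derivatives scale
with the length. -/
theorem isSized_integral (h : IsRegularFlow T γ f X Φ) {F : Type} [NormedAddCommGroup F]
    [NormedSpace ℝ F] {g : ℝ → Vec d → F} (hg : IsBddFamily g) :
    IsSized (TimeInterval.length (T := T)) fun p x => ∫ r in p.1.1..p.1.2, g r (Φ p.1.1 r x) := by
  obtain ⟨Z, hZ, hZd⟩ := h.exists_path
  have hq : ∀ p : TimeInterval T, p.1.1 ∈ Icc 0 T := fun p => ⟨p.2.1, p.2.2.1.trans p.2.2.2⟩
  let P : TimeInterval T → TimePair T := fun p => ⟨⟨p.1.1, hq p⟩, p.1.2⟩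
  have hP : ∀ p, (P p).clamp = p.1.2 := fun p => TimePair.clamp_of_mem p.2.2.1 p.2.2.2
  have := IsSized.of_clm (τ := TimeInterval.length (T := T))
    (w := fun x => nemytskii hg (Z x)) (fun n => (contDiff_nemytskii n hg).comp (hZd n))
    (fun p => (evalPath (P p)).comp integralPath) (fun p => ?_)
  · convert this using 3 with p x
    simp only [ContinuousLinearMap.comp_apply, evalPath_apply, integralPath_apply, hP]
    refine intervalIntegral.integral_congr fun r hr => ?_
    rw [uIcc_of_le p.2.2.1] at hr
    simp only [nemytskii_apply, hZ, P, TimePair.clamp_of_mem (q := ⟨p.1.1, hq p⟩) hr.1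
      (hr.2.trans p.2.2.2)]
  · refine ContinuousLinearMap.opNorm_le_bound _ p.length_nonneg fun v => ?_
    have := norm_integral_path_le v (P p)
    refine this.trans (le_of_eq ?_)
    rw [hP, mul_comm]
    rfl

theorem isSized_displacement (h : IsRegularFlow T γ f X Φ) :
    IsSized (TimeInterval.length (T := T))
      fun p x => Φ p.1.1 p.1.2 x - (x + (X p.1.2 - X p.1.1)) := by
  convert h.isSized_integral h.drift using 3 with p x
  rw [(h.flow p.1.1 ⟨p.2.1, p.2.2.1.trans p.2.2.2⟩ x).2 p.1.2 ⟨p.2.2.1, p.2.2.2⟩]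
  abel

theorem isSized_backG (h : IsRegularFlow T γ f X Φ) :
    IsSized (TimeInterval.length (T := T)) fun p x => backG f Φ p.1.2 p.1.1 x :=
  h.isSized_integral h.drift.divergence

theorem isSized_flow (h : IsRegularFlow T γ f X Φ) :
    IsSized (fun _ : TimeInterval T => (1 : ℝ)) fun p x => Φ p.1.1 p.1.2 x := by
  have h1 := h.isSized_displacement.mono_size_const (c := T) (fun p => p.length_le)
    (fun p => p.length_nonneg)
  have h2 : IsSized (fun _ : TimeInterval T => (1 : ℝ)) fun p (x : Vec d) => X p.1.2 - X p.1.1 :=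
    isSized_const fun p => h.norm_path_sub_le (s := p.1.1) (t := p.1.2)
      ⟨p.2.1, p.2.2.1.trans p.2.2.2⟩ ⟨p.2.1.trans p.2.2.1, p.2.2.2⟩
  have h3 := h1.add ((isSized_single contDiff_id).add h2)
  convert h3 using 3 with p x
  simp

theorem isSized_backSol (h : IsRegularFlow T γ f X Φ) {φ₀ : Vec d → ℝ} (hφ : ContDiff ℝ ∞ φ₀)
    {t₀ : ℝ} (ht₀ : t₀ ∈ Icc 0 T) :
    IsSized (fun _ : Icc 0 t₀ => (1 : ℝ)) fun q => backSol f Φ φ₀ t₀ q := by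
  let e : Icc 0 t₀ → TimeInterval T := fun q => ⟨(q.1, t₀), q.2.1, q.2.2, ht₀.2⟩
  have h1 := h.isSized_flow.reindex e
  have h2 := (h.isSized_backG.mono_size_const (c := T) (fun p => p.length_le)
    (fun p => p.length_nonneg)).reindex e
  have h3 := (h1.clm_comp (ContinuousLinearMap.inl ℝ (Vec d) ℝ)).add
    (h2.clm_comp (ContinuousLinearMap.inr ℝ (Vec d) ℝ))
  have h4 : IsSized (fun _ : Icc 0 t₀ => (1 : ℝ))
      fun _ (z : Vec d × ℝ) => φ₀ z.1 * Real.exp z.2 :=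
    isSized_single ((hφ.comp contDiff_fst).mul (Real.contDiff_exp.comp contDiff_snd))
  convert h4.comp h3 using 3 with q x
  simp [backSol, e]

/-- By `backSol_comp`, `ψ_s(x)` is `z ↦ ψ_t(z.1) exp(z.2)` evaluated at `(x + X_t - X_s, 0)` shifted
by the pair (drift displacement, `backG`). That shift has size `t - s`, and the unshifted value is
the translate of `ψ_t`. -/
theorem isSized_increment (h : IsRegularFlow T γ f X Φ) {φ₀ : Vec d → ℝ} (hφ : ContDiff ℝ ∞ φ₀)
    {t₀ : ℝ} (ht₀ : t₀ ∈ Icc 0 T) :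
    IsSized (TimeInterval.length (T := t₀)) fun p x => backSol f Φ φ₀ t₀ p.1.1 x -
      backSol f Φ φ₀ t₀ p.1.2 (x + (X p.1.2 - X p.1.1)) := by
  let e : TimeInterval t₀ → TimeInterval T := fun p => ⟨p.1, p.2.1, p.2.2.1, p.2.2.2.trans ht₀.2⟩
  let e' : TimeInterval t₀ → Icc 0 t₀ := fun p => ⟨p.1.2, p.2.1.trans p.2.2.1, p.2.2.2⟩
  have hA := ((h.isSized_displacement.reindex e).clm_comp (ContinuousLinearMap.inl ℝ (Vec d) ℝ)).add
    ((h.isSized_backG.reindex e).clm_comp (ContinuousLinearMap.inr ℝ (Vec d) ℝ))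
  have h2 : IsSized (fun _ : TimeInterval t₀ => (1 : ℝ)) fun p (x : Vec d) => X p.1.2 - X p.1.1 :=
    isSized_const fun p => h.norm_path_sub_le (s := p.1.1) (t := p.1.2)
      ⟨p.2.1, p.2.2.1.trans (p.2.2.2.trans ht₀.2)⟩
      ⟨p.2.1.trans p.2.2.1, p.2.2.2.trans ht₀.2⟩
  have hB := ((isSized_single (ι := TimeInterval t₀) (contDiff_id (𝕜 := ℝ) (E := Vec d))).add
    h2).clm_comp (ContinuousLinearMap.inl ℝ (Vec d) ℝ)
  have m1 : ∀ i : TimeInterval t₀, (0 : ℝ) ≤ (fun _ : TimeInterval t₀ => (1 : ℝ)) i :=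
    fun _ => zero_le_one
  have hH1 := ((h.isSized_backSol hφ ht₀).reindex e').comp
    (isSized_single (ι := TimeInterval t₀) (contDiff_fst (𝕜 := ℝ) (E := Vec d) (F := ℝ)))
  have hH2 : IsSized (fun _ : TimeInterval t₀ => (1 : ℝ)) fun _ (z : Vec d × ℝ) => Real.exp z.2 :=
    isSized_single (Real.contDiff_exp.comp contDiff_snd)
  have hH := (IsSized.bilinear (ContinuousLinearMap.mul ℝ ℝ) m1 m1 hH1 hH2).congr_size
    (σ := fun _ => 1) fun _ => one_mul _
  have : IsSized (TimeInterval.length (T := t₀)) _ :=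
    IsSized.comp_add_sub_comp hB hA (fun p => p.length_nonneg) (c := t₀)
    (fun p => p.length_le) hH
  convert this using 3 with p x
  rw [h.backSol_comp φ₀ p.2.1 p.2.2.1 p.2.2.2 ht₀.2]
  simp [e, e']

theorem norm_le_of_backSol_ne_zero (h : IsRegularFlow T γ f X Φ) {N : ℝ} (hN : ∀ t x, ‖f t x‖ ≤ N)
    {φ₀ : Vec d → ℝ} {Rφ : ℝ} (hR : tsupport φ₀ ⊆ Metric.closedBall 0 Rφ) {t₀ q : ℝ}
    (hq : 0 ≤ q) (hqt : q ≤ t₀) (ht₀ : t₀ ≤ T) {x : Vec d}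
    (hx : Φ q t₀ x ∈ tsupport φ₀) : ‖x‖ ≤ Rφ + (T * N + T ^ γ * holderSeminorm T γ X) := by
  have h1 := mem_closedBall_zero_iff.1 (hR hx)
  have h2 := h.norm_flow_sub_le hN ⟨hq, hqt.trans ht₀⟩ ⟨hqt, ht₀⟩ x
  linarith [norm_le_norm_add_norm_sub (Φ q t₀ x) x]

/-- The locally uniform bounds become global because everything is supported in a fixed ball. For
increments the ball is enlarged by `ρ`, the largest displacement of the path, to contain the
translated support. -/
theorem isTransported_backSol (h : IsRegularFlow T γ f X Φ) {φ₀ : Vec d → ℝ} (hφ : IsTest φ₀)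
    {N : ℝ} (hN : ∀ t x, ‖f t x‖ ≤ N) {Rφ : ℝ} (hR : tsupport φ₀ ⊆ Metric.closedBall 0 Rφ)
    {t₀ : ℝ} (ht₀ : t₀ ∈ Icc 0 T) :
    IsTransported t₀ (Rφ + (T * N + T ^ γ * holderSeminorm T γ X)) X (backSol f Φ φ₀ t₀) := by
  set ρ := T ^ γ * holderSeminorm T γ X
  set R := Rφ + (T * N + ρ) with hRd
  have hsupp : ∀ q ∈ Icc 0 t₀, ∀ x, backSol f Φ φ₀ t₀ q x ≠ 0 → ‖x‖ ≤ R := by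
    intro q hq x hx
    exact h.norm_le_of_backSol_ne_zero hN hR hq.1 hq.2 ht₀.2
      (subset_tsupport _ fun h0 => hx (by simp [backSol, h0]))
  have hout : ∀ {w : Vec d → ℝ} {r : ℝ} (n : ℕ), (∀ x, w x ≠ 0 → ‖x‖ ≤ r) → ∀ x, r < ‖x‖ →
      iteratedFDeriv ℝ n w x = 0 := by
    intro w r n hw x hx
    by_contra h0
    have h1 := support_iteratedFDeriv_subset (𝕜 := ℝ) n h0
    have h2 : tsupport w ⊆ Metric.closedBall 0 r :=
      closure_minimal (fun x hx => mem_closedBall_zero_iff.2 (hw x hx)) Metric.isClosed_closedBall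
    exact absurd (mem_closedBall_zero_iff.1 (h2 h1)) (not_le.2 hx)
  have hs := h.isSized_backSol hφ.1 ht₀
  refine ⟨fun q hq => hs.smooth ⟨q, hq⟩, fun n => ?_, hsupp, fun n => ?_⟩
  · obtain ⟨C, hC⟩ := hs.bound n R
    refine ⟨|C|, abs_nonneg _, fun q hq x => ?_⟩
    rcases le_or_gt ‖x‖ R with hx | hx
    · exact (hC ⟨q, hq⟩ x hx).trans (by rw [mul_one]; exact le_abs_self C)
    · rw [hout n (hsupp q hq) x hx, norm_zero]; exact abs_nonneg _
  · obtain ⟨C, hC⟩ := (h.isSized_increment hφ.1 ht₀).bound n (R + ρ)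
    refine ⟨|C|, abs_nonneg _, fun s t hs hst ht x => ?_⟩
    have hτ : 0 ≤ t - s := by linarith
    rcases le_or_gt ‖x‖ (R + ρ) with hx | hx
    · exact (hC ⟨(s, t), hs, hst, ht⟩ x hx).trans
        (mul_le_mul_of_nonneg_right (le_abs_self C) hτ)
    · rw [hout n (r := R + ρ) _ x hx, norm_zero]
      · positivity
      · intro y hy
        have hX := h.norm_path_sub_le (s := s) (t := t) ⟨hs, (hst.trans ht).trans ht₀.2⟩
          ⟨hs.trans hst, ht.trans ht₀.2⟩
        have hρ : 0 ≤ ρ := (norm_nonneg _).trans hX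
        by_cases h1 : backSol f Φ φ₀ t₀ s y = 0
        · have h2 : backSol f Φ φ₀ t₀ t (y + (X t - X s)) ≠ 0 := by
            intro h2
            rw [h1, h2, sub_zero] at hy
            exact hy rfl
          have h3 := hsupp t ⟨hs.trans hst, ht⟩ _ h2
          have h4 := norm_sub_le (y + (X t - X s)) (X t - X s)
          rw [add_sub_cancel_right] at h4
          linarith
        · linarith [hsupp s ⟨hs, hst.trans ht⟩ y h1]

end IsRegularFlow

/-! ### Coordinates and Taylor expansions -/

theorem clm_apply_eq_sum {d : ℕ} {F : Type*} [NormedAddCommGroup F] [NormedSpace ℝ F]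
    (A : Vec d →L[ℝ] F) (v : Vec d) : A v = ∑ i, v i • A (EuclideanSpace.single i 1) := by
  conv_lhs => rw [← (EuclideanSpace.basisFun (Fin d) ℝ).sum_repr v, map_sum]
  simp

theorem fderiv_apply_eq_sum_pd {d : ℕ} (f : Vec d → ℝ) (x v : Vec d) :
    fderiv ℝ f x v = ∑ i, pd i f x * v i := by
  rw [clm_apply_eq_sum]
  exact Finset.sum_congr rfl fun i _ => mul_comm _ _

theorem pd_pd_eq {d : ℕ} {f : Vec d → ℝ} (hf : ContDiff ℝ 2 f) (i j : Fin d) (x : Vec d) :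
    pd j (pd i f) x = fderiv ℝ (fderiv ℝ f) x (EuclideanSpace.single j 1)
      (EuclideanSpace.single i 1) := by
  have h := (((hf.fderiv_right (m := 1) (by norm_num)).differentiable one_ne_zero) x).hasFDerivAt
  have h2 := (h.clm_apply (hasFDerivAt_const (EuclideanSpace.single i (1 : ℝ)) x)).fderiv
  unfold pd
  rw [h2]
  simp

theorem snd_fderiv_symm {d : ℕ} {f : Vec d → ℝ} (hf : ContDiff ℝ 2 f) (x v w : Vec d) :
    fderiv ℝ (fderiv ℝ f) x v w = fderiv ℝ (fderiv ℝ f) x w v :=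
  (hf.contDiffAt.isSymmSndFDerivAt (by simp)).eq v w

theorem abs_clm_single_le {d : ℕ} (A : Vec d →L[ℝ] ℝ) (i : Fin d) :
    |A (EuclideanSpace.single i 1)| ≤ ‖A‖ := by
  simpa using A.le_opNorm (EuclideanSpace.single i 1)

theorem abs_clm_single_single_le {d : ℕ} (A : Vec d →L[ℝ] Vec d →L[ℝ] ℝ) (i j : Fin d) :
    |A (EuclideanSpace.single j 1) (EuclideanSpace.single i 1)| ≤ ‖A‖ := by
  refine (abs_clm_single_le _ i).trans ?_
  simpa using A.le_opNorm (EuclideanSpace.single j 1)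

/-- Third order Taylor estimate. -/
theorem abs_taylor_three_le {d : ℕ} {f : Vec d → ℝ} {C : ℝ} (hf : ContDiff ℝ 3 f)
    (h : ∀ x, ‖iteratedFDeriv ℝ 3 f x‖ ≤ C) (a v : Vec d) :
    |f (a + v) - f a - fderiv ℝ f a v - 1 / 2 * fderiv ℝ (fderiv ℝ f) a v v| ≤ C * ‖v‖ ^ 3 := by
  have hC : 0 ≤ C := (norm_nonneg _).trans (h a)
  have hf2 : ContDiff ℝ 2 (fderiv ℝ f) := hf.fderiv_right (by norm_num)
  set B := fderiv ℝ (fderiv ℝ f) a with hB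
  have hsymm : ∀ v w, B v w = B w v := snd_fderiv_symm (hf.of_le (by norm_num)) a
  set g : Vec d → ℝ := fun w => f (a + w) - f a - fderiv ℝ f a w - 1 / 2 * B w w with hg
  have hgd : ∀ w, HasFDerivAt g (fderiv ℝ f (a + w) - fderiv ℝ f a - B w) w := by
    intro w
    have d1 : HasFDerivAt (fun w => f (a + w)) (fderiv ℝ f (a + w)) w := by
      exact ((hf.differentiable (by norm_num) (a + w)).hasFDerivAt.comp w
        ((hasFDerivAt_id w).const_add a)).congr_fderiv (ContinuousLinearMap.comp_id _)
    have d2 := (fderiv ℝ f a).hasFDerivAt (x := w)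
    have d3 := ((B.hasFDerivAt (x := w)).clm_apply (hasFDerivAt_id w)).const_mul (1 / 2 : ℝ)
    refine (((d1.sub_const (f a)).sub d2).sub d3).congr_fderiv ?_
    ext u
    have := hsymm u w
    simp [this]
    ring
  have := (convex_segment (0 : Vec d) v).norm_image_sub_le_of_norm_hasFDerivWithin_le
    (f := g) (C := C * ‖v‖ ^ 2) (fun w _ => (hgd w).hasFDerivWithinAt) ?_
    (left_mem_segment ℝ _ _) (right_mem_segment ℝ _ _)
  · have g0 : g 0 = 0 := by simp [hg]
    rw [g0, sub_zero, sub_zero] at this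
    calc _ = ‖g v‖ := rfl
      _ ≤ _ := this
      _ = _ := by ring
  · intro w hw
    have hw' : ‖w‖ ≤ ‖v‖ := by simpa using norm_sub_le_of_mem_segment hw
    refine (norm_sub_sub_fderiv_le hf2 (C := C) (fun x => ?_) a w).trans ?_
    · rw [norm_iteratedFDeriv_fderiv]; exact h x
    · gcongr

/-- Contraction of a symmetric form with the second level of a geometric rough path. -/
theorem IsGeometricRoughPath.contraction {d : ℕ} {T γ : ℝ} {X : ℝ → Vec d}
    {XX : ℝ → ℝ → Matrix (Fin d) (Fin d) ℝ} (h : IsGeometricRoughPath T γ X XX)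
    {s t : ℝ} (hs : s ∈ Icc 0 T) (ht : t ∈ Icc 0 T) {f : Vec d → ℝ} (hf : ContDiff ℝ 2 f)
    (x : Vec d) : ∑ i, ∑ j, pd j (pd i f) x * XX s t j i =
      1 / 2 * fderiv ℝ (fderiv ℝ f) x (X t - X s) (X t - X s) := by
  have e1 : ∑ i, ∑ j, pd j (pd i f) x * XX s t j i = ∑ i, ∑ j, pd j (pd i f) x * XX s t i j := by
    rw [Finset.sum_comm]
    refine Finset.sum_congr rfl fun i _ => Finset.sum_congr rfl fun j _ => ?_
    rw [pd_pd_eq hf, pd_pd_eq hf, snd_fderiv_symm hf]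
  have e2 : fderiv ℝ (fderiv ℝ f) x (X t - X s) (X t - X s) =
      ∑ i, ∑ j, pd j (pd i f) x * (XX s t j i + XX s t i j) := by
    rw [clm_apply_eq_sum (fderiv ℝ (fderiv ℝ f) x (X t - X s))]
    refine Finset.sum_congr rfl fun i _ => ?_
    rw [clm_apply_eq_sum (fderiv ℝ (fderiv ℝ f) x), _root_.sum_apply, Finset.smul_sum]
    refine Finset.sum_congr rfl fun j _ => ?_
    rw [pd_pd_eq hf, h.add_swap hs ht j i]
    simp
    ring
  rw [e2]
  simp only [mul_add, Finset.sum_add_distrib]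
  rw [← e1]
  ring

/-! ### The first order expansion of the backward solution -/

/-- The spatial part `div (f ψ)` of the continuity equation. -/
def source {d : ℕ} (f : ℝ → Vec d → Vec d) (ψ : ℝ → Vec d → ℝ) (r : ℝ) (x : Vec d) : ℝ :=
  fderiv ℝ (ψ r) x (f r x) + divergence (f r) x * ψ r x

theorem IsTransported.intervalIntegrable_source {d : ℕ} {T R γ : ℝ} {X : ℝ → Vec d}
    {ψ : ℝ → Vec d → ℝ} (h : IsTransported T R X ψ) (hX : IsHolder T γ X) (hγ : 0 < γ)
    (hγ1 : γ ≤ 1) {f : ℝ → Vec d → Vec d} (hf : IsBddFamily f) (x : Vec d) {s t : ℝ}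
    (hs : s ∈ Icc 0 T) (ht : t ∈ Icc 0 T) :
    IntervalIntegrable (fun r => source f ψ r x) volume s t := by
  obtain ⟨C₀, hC₀0, hC₀⟩ := h.exists_abs_le
  obtain ⟨C₁, hC₁0, hC₁⟩ := h.exists_fderiv_le
  obtain ⟨N, hN⟩ := hf.exists_bound
  obtain ⟨M, hM⟩ := hf.divergence.exists_bound
  have hsub : uIcc s t ⊆ Icc 0 T := uIcc_subset_Icc hs ht
  rw [intervalIntegrable_iff']
  have m1 : AEStronglyMeasurable (fun r => fderiv ℝ (ψ r) x) (volume.restrict (uIcc s t)) :=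
    ((h.continuousOn_fderiv hX hγ hγ1 x).mono hsub).aestronglyMeasurable measurableSet_uIcc
  have m2 : AEStronglyMeasurable (fun r => ψ r x) (volume.restrict (uIcc s t)) :=
    ((h.continuousOn_apply hX hγ hγ1 x).mono hsub).aestronglyMeasurable measurableSet_uIcc
  have m3 : AEStronglyMeasurable (fun r => fderiv ℝ (ψ r) x (f r x))
      (volume.restrict (uIcc s t)) :=
    isBoundedBilinearMap_apply.continuous.comp_aestronglyMeasurable
      (m1.prodMk (hf.meas x).aestronglyMeasurable)
  have m4 : AEStronglyMeasurable (fun r => divergence (f r) x * ψ r x)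
      (volume.restrict (uIcc s t)) := (hf.divergence.meas x).aestronglyMeasurable.mul m2
  have : IsFiniteMeasure (volume.restrict (uIcc s t)) := ⟨by simp⟩
  refine Integrable.of_bound (m3.add m4) (C₁ * N + M * C₀) ?_
  filter_upwards [ae_restrict_mem measurableSet_uIcc] with r hr
  refine (norm_add_le _ _).trans (add_le_add ?_ ?_)
  · exact ((fderiv ℝ (ψ r) x).le_opNorm _).trans
      (mul_le_mul (hC₁ r (hsub hr) x) (hN r x) (norm_nonneg _) hC₁0)
  · rw [norm_mul]
    exact mul_le_mul (hM r x) (hC₀ r (hsub hr) x) (norm_nonneg _) ((norm_nonneg _).trans (hM r x))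

/-- For `|g| ≤ 1` this is the usual quadratic bound; otherwise `g ^ 2 ≥ 1` and a crude bound of the
left side is enough. -/
theorem abs_exp_sub_one_sub_le {c g : ℝ} (hg : |g| ≤ c) :
    |Real.exp g - 1 - g| ≤ (Real.exp c + 1 + c) * g ^ 2 := by
  have hc : 0 ≤ c := (abs_nonneg g).trans hg
  rcases le_or_gt |g| 1 with h | h
  · refine (Real.abs_exp_sub_one_sub_id_le h).trans ?_
    nlinarith [Real.exp_pos c, sq_nonneg g, mul_nonneg hc (sq_nonneg g),
      mul_nonneg (Real.exp_pos c).le (sq_nonneg g)]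
  · have h1 : 1 ≤ g ^ 2 := by
      rw [← sq_abs]; nlinarith
    have h2 : |Real.exp g - 1 - g| ≤ Real.exp c + 1 + c := by
      have e1 : Real.exp g ≤ Real.exp c := Real.exp_le_exp.2 ((le_abs_self g).trans hg)
      have e2 := Real.exp_pos g
      rw [abs_le] at hg ⊢
      constructor <;> linarith
    have h3 : 0 ≤ Real.exp c + 1 + c := by positivity
    nlinarith

/-- The error of the first order expansion of `ψ s` along the path is `O((t - s)^{1+γ})`. -/
theorem IsRegularFlow.exists_expansion {d : ℕ} {T γ R : ℝ} {f : ℝ → Vec d → Vec d} {X : ℝ → Vec d}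
    {Φ : ℝ → ℝ → Vec d → Vec d} (h : IsRegularFlow T γ f X Φ) (hγ1 : γ ≤ 1) {φ₀ : Vec d → ℝ}
    {t₀ : ℝ} (ht₀ : t₀ ∈ Icc 0 T) (hψ : IsTransported t₀ R X (backSol f Φ φ₀ t₀)) :
    ∃ C, 0 ≤ C ∧ ∀ s t, 0 ≤ s → s ≤ t → t ≤ t₀ → ∀ x,
      |backSol f Φ φ₀ t₀ s x - backSol f Φ φ₀ t₀ t (x + (X t - X s)) -
        ∫ r in s..t, source f (backSol f Φ φ₀ t₀) r x| ≤ C * ((t - s) ^ γ * (t - s)) := by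
  set ψ := backSol f Φ φ₀ t₀ with hψd
  have hX : IsHolder t₀ γ X := by
    obtain ⟨C, hC⟩ := h.path
    exact ⟨C, fun s hs t ht => hC s ⟨hs.1, hs.2.trans ht₀.2⟩ t ⟨ht.1, ht.2.trans ht₀.2⟩⟩
  obtain ⟨C₀, hC₀0, hC₀⟩ := hψ.exists_abs_le
  obtain ⟨C₁, hC₁0, hC₁⟩ := hψ.exists_fderiv_le
  obtain ⟨C₂, hC₂0, hC₂⟩ := hψ.bound 2
  obtain ⟨h₀, hh₀0, hh₀⟩ := hψ.abs_sub_le hX h.pos hγ1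
  obtain ⟨h₁, hh₁0, hh₁⟩ := hψ.norm_fderiv_sub_le hX h.pos hγ1
  obtain ⟨H, hH0, hH⟩ := hX.exists_nonneg
  obtain ⟨N, hN⟩ := h.drift.exists_bound
  obtain ⟨L, hL⟩ := h.drift.exists_bound_fderiv
  obtain ⟨M, hM⟩ := h.drift.divergence.exists_bound
  obtain ⟨L', hL'⟩ := h.drift.divergence.exists_bound_fderiv
  have hN0 : 0 ≤ N := (norm_nonneg _).trans (hN 0 0)
  have hL0 : 0 ≤ L := (norm_nonneg _).trans (hL 0 0)
  have hM0 : 0 ≤ M := (norm_nonneg _).trans (hM 0 0)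
  have hL'0 : 0 ≤ L' := (norm_nonneg _).trans (hL' 0 0)
  have hT0 : 0 ≤ t₀ := ht₀.1
  set κ := t₀ ^ (1 - γ) with hκ
  have hκ0 : 0 ≤ κ := Real.rpow_nonneg hT0 _
  set c := Real.exp (M * t₀) + 1 + M * t₀ with hc
  have hc0 : 0 ≤ c := by positivity
  set Δ := N * κ + H with hΔ
  have hΔ0 : 0 ≤ Δ := by positivity
  -- `A` collects the quadratic remainders (Taylor, exponential, product). `A'` collects the Hölder
  -- moduli paid when integrands frozen at time `t` and evaluated at `y` and along the flow are
  -- moved to time `r` and the point `x`.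
  set A := C₂ * N ^ 2 + C₀ * c * M ^ 2 + C₁ * N * M with hA
  set A' := (C₂ * H + h₁) * N + C₁ * (L * Δ) + (M * (C₁ * H + h₀) + L' * Δ * C₀) with hA'
  have hA0 : 0 ≤ A := by positivity
  have hA'0 : 0 ≤ A' := by positivity
  refine ⟨A * κ + A', by positivity, fun s t hs hst ht x => ?_⟩
  set τ := t - s with hτ
  have hτ0 : 0 ≤ τ := by linarith
  have hτT : τ ≤ t₀ := by linarith
  have hτκ : τ ≤ κ * τ ^ γ := le_rpow_mul_rpow hτ0 hτT h.pos hγ1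
  have hg0 : 0 ≤ τ ^ γ := Real.rpow_nonneg hτ0 _
  have ms : s ∈ Icc 0 t₀ := ⟨hs, hst.trans ht⟩
  have mt : t ∈ Icc 0 t₀ := ⟨hs.trans hst, ht⟩
  have mS : s ∈ Icc 0 T := ⟨hs, (hst.trans ht).trans ht₀.2⟩
  have mst : t ∈ Icc s T := ⟨hst, ht.trans ht₀.2⟩
  have mss : s ∈ Icc s T := ⟨le_rfl, mS.2⟩
  set y := x + (X t - X s) with hy
  set D := ∫ r in s..t, f r (Φ s r x) with hD
  set G := ∫ r in s..t, divergence (f r) (Φ s r x) with hG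
  have hΦ : Φ s t x = y + D := by
    rw [(h.flow s mS x).2 t mst, hy, hD]; abel
  have hD1 : ‖D‖ ≤ N * τ := by
    have := intervalIntegral.norm_integral_le_of_norm_le_const (a := s) (b := t)
      (f := fun r => f r (Φ s r x)) (C := N) fun r _ => hN r _
    rwa [abs_of_nonneg hτ0] at this
  have hG1 : |G| ≤ M * τ := by
    have := intervalIntegral.norm_integral_le_of_norm_le_const (a := s) (b := t)
      (f := fun r => divergence (f r) (Φ s r x)) (C := M) fun r _ => hM r _
    rwa [abs_of_nonneg hτ0] at this
  have hψs : ψ s x = ψ t (y + D) * Real.exp G := by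
    rw [hψd, h.backSol_comp φ₀ hs hst ht ht₀.2, hΦ]; rfl
  -- the second order remainder
  have hr1 : |ψ t (y + D) * Real.exp G - ψ t y - fderiv ℝ (ψ t) y D - ψ t y * G| ≤ A * τ ^ 2 := by
    have e : ψ t (y + D) * Real.exp G - ψ t y - fderiv ℝ (ψ t) y D - ψ t y * G =
        (ψ t (y + D) - ψ t y - fderiv ℝ (ψ t) y D) + ψ t (y + D) * (Real.exp G - 1 - G) +
        (ψ t (y + D) - ψ t y) * G := by ring
    have b1 : |ψ t (y + D) - ψ t y - fderiv ℝ (ψ t) y D| ≤ C₂ * N ^ 2 * τ ^ 2 := by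
      refine (norm_sub_sub_fderiv_le (hψ.contDiff mt 2) (hC₂ t mt) y D).trans ?_
      rw [mul_assoc, ← mul_pow]
      gcongr
    have b2 : |ψ t (y + D) * (Real.exp G - 1 - G)| ≤ C₀ * c * M ^ 2 * τ ^ 2 := by
      rw [abs_mul]
      have := abs_exp_sub_one_sub_le (hG1.trans (mul_le_mul_of_nonneg_left hτT hM0))
      have g2 : G ^ 2 ≤ (M * τ) ^ 2 := by rw [← sq_abs]; gcongr
      calc _ ≤ C₀ * (c * (M * τ) ^ 2) := by
            refine mul_le_mul (hC₀ t mt _) (this.trans ?_) (abs_nonneg _) hC₀0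
            exact mul_le_mul_of_nonneg_left g2 hc0
        _ = _ := by ring
    have b3 : |(ψ t (y + D) - ψ t y) * G| ≤ C₁ * N * M * τ ^ 2 := by
      rw [abs_mul]
      have := norm_sub_le_of_norm_fderiv_le (hψ.contDiff mt 1) (hC₁ t mt) y (y + D)
      rw [add_sub_cancel_left] at this
      calc _ ≤ (C₁ * (N * τ)) * (M * τ) := by
            refine mul_le_mul (this.trans ?_) hG1 (abs_nonneg _) (by positivity)
            gcongr
        _ = _ := by ring
    rw [e]
    refine (abs_add_three _ _ _).trans ?_
    rw [hA, add_mul, add_mul]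
    exact add_le_add (add_le_add b1 b2) b3
  -- comparison of the integrands
  have hyx : ‖y - x‖ ≤ H * τ ^ γ := by
    have := hH s ms t mt
    rw [abs_of_nonneg hτ0] at this
    rwa [hy, add_sub_cancel_left]
  have hr2 : ∀ r ∈ Icc s t, |fderiv ℝ (ψ t) y (f r (Φ s r x)) + ψ t y * divergence (f r) (Φ s r x) -
      source f ψ r x| ≤ A' * τ ^ γ := by
    intro r hr
    have mr : r ∈ Icc 0 t₀ := ⟨hs.trans hr.1, hr.2.trans ht⟩
    have mr' : r ∈ Icc s T := ⟨hr.1, hr.2.trans mst.2⟩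
    set z := Φ s r x with hz
    have hrτ : r - s ≤ τ := by linarith [hr.2]
    have hrs : 0 ≤ r - s := by linarith [hr.1]
    have hzx : ‖z - x‖ ≤ Δ * τ ^ γ := by
      have e : z - x = (∫ q in s..r, f q (Φ s q x)) + (X r - X s) := by
        rw [hz, (h.flow s mS x).2 r mr']; abel
      have i1 := intervalIntegral.norm_integral_le_of_norm_le_const (a := s) (b := r)
        (f := fun q => f q (Φ s q x)) (C := N) fun q _ => hN q _
      have i2 := hH s ms r mr
      rw [abs_of_nonneg hrs] at i1 i2
      rw [e, hΔ, add_mul, mul_assoc]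
      refine (norm_add_le _ _).trans (add_le_add (i1.trans ?_) (i2.trans ?_))
      · gcongr; exact hrτ.trans hτκ
      · gcongr
        exact h.pos.le
    have ht_r : |t - r| ^ γ ≤ τ ^ γ := by
      rw [abs_of_nonneg (by linarith [hr.2])]
      exact Real.rpow_le_rpow (by linarith [hr.2]) (by linarith [hr.1]) h.pos.le
    have c1 : ‖fderiv ℝ (ψ t) y - fderiv ℝ (ψ r) x‖ ≤ (C₂ * H + h₁) * τ ^ γ := by
      have a1 := RoughTransport.norm_fderiv_sub_le (hψ.contDiff mt 2) (hC₂ t mt) x y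
      have a2 := hh₁ r mr t mt x
      calc _ = ‖(fderiv ℝ (ψ t) y - fderiv ℝ (ψ t) x) + (fderiv ℝ (ψ t) x - fderiv ℝ (ψ r) x)‖ := by
            congr 1; abel
        _ ≤ C₂ * (H * τ ^ γ) + h₁ * τ ^ γ := (norm_add_le _ _).trans
            (add_le_add (a1.trans (by gcongr)) (a2.trans (by gcongr)))
        _ = _ := by ring
    have c0 : |ψ t y - ψ r x| ≤ (C₁ * H + h₀) * τ ^ γ := by
      have a1 := norm_sub_le_of_norm_fderiv_le (hψ.contDiff mt 1) (hC₁ t mt) x y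
      have a2 := hh₀ r mr t mt x
      calc _ = |(ψ t y - ψ t x) + (ψ t x - ψ r x)| := by congr 1; ring
        _ ≤ C₁ * (H * τ ^ γ) + h₀ * τ ^ γ := (abs_add_le _ _).trans
            (add_le_add (a1.trans (by gcongr)) (a2.trans (by gcongr)))
        _ = _ := by ring
    have cf : ‖f r z - f r x‖ ≤ L * Δ * τ ^ γ := by
      have := norm_sub_le_of_norm_fderiv_le (h.drift.contDiff 1 r) (hL r) x z
      rw [mul_assoc]
      exact this.trans (by gcongr)
    have cd : |divergence (f r) z - divergence (f r) x| ≤ L' * Δ * τ ^ γ := by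
      have := norm_sub_le_of_norm_fderiv_le (h.drift.divergence.contDiff 1 r) (hL' r) x z
      rw [mul_assoc]
      exact this.trans (by gcongr)
    have e : fderiv ℝ (ψ t) y (f r z) + ψ t y * divergence (f r) z - source f ψ r x =
        (fderiv ℝ (ψ t) y - fderiv ℝ (ψ r) x) (f r z) + fderiv ℝ (ψ r) x (f r z - f r x) +
        (divergence (f r) z * (ψ t y - ψ r x) +
          (divergence (f r) z - divergence (f r) x) * ψ r x) := by
      rw [source, _root_.sub_apply, map_sub]; ring
    rw [e, hA', add_mul, add_mul, add_mul (M * _)]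
    refine (abs_add_le _ _).trans (add_le_add ((abs_add_le _ _).trans (add_le_add ?_ ?_))
      ((abs_add_le _ _).trans (add_le_add ?_ ?_)))
    · refine (((fderiv ℝ (ψ t) y - fderiv ℝ (ψ r) x)).le_opNorm _).trans ?_
      rw [mul_right_comm]
      exact mul_le_mul c1 (hN r z) (norm_nonneg _) (by positivity)
    · refine ((fderiv ℝ (ψ r) x).le_opNorm _).trans ?_
      rw [mul_assoc]
      exact mul_le_mul (hC₁ r mr x) cf (norm_nonneg _) hC₁0
    · rw [abs_mul, mul_assoc]
      exact mul_le_mul (hM r z) c0 (abs_nonneg _) hM0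
    · rw [abs_mul, mul_right_comm]
      exact mul_le_mul cd (hC₀ r mr x) (abs_nonneg _) (by positivity)
  have i1 : IntervalIntegrable (fun r => fderiv ℝ (ψ t) y (f r (Φ s r x))) volume s t :=
    h.continuousOn_drift (h.drift.clm_comp (fderiv ℝ (ψ t) y)) mS x mss mst
  have i0 := h.continuousOn_drift h.drift mS x mss mst
  have i2 := (h.continuousOn_drift h.drift.divergence mS x mss mst).const_mul (ψ t y)
  have i3 := hψ.intervalIntegrable_source hX h.pos hγ1 h.drift x ms mt
  have e : ψ s x - ψ t y - ∫ r in s..t, source f ψ r x =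
      (ψ t (y + D) * Real.exp G - ψ t y - fderiv ℝ (ψ t) y D - ψ t y * G) +
      ∫ r in s..t, (fderiv ℝ (ψ t) y (f r (Φ s r x)) + ψ t y * divergence (f r) (Φ s r x) -
        source f ψ r x) := by
    rw [intervalIntegral.integral_sub (i1.add i2) i3, intervalIntegral.integral_add i1 i2,
      intervalIntegral.integral_const_mul, hψs,
      ContinuousLinearMap.intervalIntegral_comp_comm _ i0]
    ring
  rw [e]
  refine (abs_add_le _ _).trans ?_
  have b2 := intervalIntegral.norm_integral_le_of_norm_le_const (a := s) (b := t) (C := A' * τ ^ γ)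
    (f := fun r => fderiv ℝ (ψ t) y (f r (Φ s r x)) + ψ t y * divergence (f r) (Φ s r x) -
        source f ψ r x) fun r hr => by
      rw [uIoc_of_le hst] at hr
      exact hr2 r ⟨hr.1.le, hr.2⟩
  rw [abs_of_nonneg hτ0] at b2
  calc _ ≤ A * τ ^ 2 + A' * τ ^ γ * τ := add_le_add hr1 b2
    _ = A * (τ * τ) + A' * τ ^ γ * τ := by ring
    _ ≤ A * (κ * τ ^ γ * τ) + A' * τ ^ γ * τ := by gcongr
    _ = _ := by ring

/-! ### The backward solution is a strong controlled solution -/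

theorem IsRoughPath.mono {d : ℕ} {T T' γ : ℝ} {X : ℝ → Vec d}
    {XX : ℝ → ℝ → Matrix (Fin d) (Fin d) ℝ} (h : IsRoughPath T γ X XX) (hT : T' ≤ T) :
    IsRoughPath T' γ X XX where
  holder := h.holder.imp fun _ hC s hs t ht =>
    hC s ⟨hs.1, hs.2.trans hT⟩ t ⟨ht.1, ht.2.trans hT⟩
  area_cont i j := (h.area_cont i j).mono
    (prod_mono (Icc_subset_Icc_right hT) (Icc_subset_Icc_right hT))
  area_holder := h.area_holder.imp fun _ hC s hs t ht =>
    hC s ⟨hs.1, hs.2.trans hT⟩ t ⟨ht.1, ht.2.trans hT⟩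
  chen s u t hs hsu hut ht := h.chen s u t hs hsu hut (ht.trans hT)

theorem IsGeometricRoughPath.mono {d : ℕ} {T T' γ : ℝ} {X : ℝ → Vec d}
    {XX : ℝ → ℝ → Matrix (Fin d) (Fin d) ℝ} (h : IsGeometricRoughPath T γ X XX) (hT : T' ≤ T) :
    IsGeometricRoughPath T' γ X XX where
  toIsRoughPath := h.toIsRoughPath.mono hT
  approx := by
    obtain ⟨Y, hY, H⟩ := h.approx
    refine ⟨Y, hY, fun ε hε => ?_⟩
    obtain ⟨N, hN⟩ := H ε hε
    exact ⟨N, fun n hn => ⟨(hN n hn).1, fun s hs t ht =>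
      (hN n hn).2 s ⟨hs.1, hs.2.trans hT⟩ t ⟨ht.1, ht.2.trans hT⟩⟩⟩

/-- Transported functions which solve the continuity equation with drift `b`. -/
structure IsBackwardTransport {d : ℕ} (T γ R : ℝ) (X : ℝ → Vec d) (b : ℝ → Vec d → Vec d)
    (ψ : ℝ → Vec d → ℝ) : Prop extends IsTransported T R X ψ where
  integrable : ∀ x, ∀ s ∈ Icc 0 T, ∀ t ∈ Icc 0 T,
    IntervalIntegrable (fun r => source b ψ r x) volume s t
  expansion : ∃ C, 0 ≤ C ∧ ∀ s t, 0 ≤ s → s ≤ t → t ≤ T → ∀ x,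
    |ψ s x - ψ t (x + (X t - X s)) - ∫ r in s..t, source b ψ r x| ≤ C * ((t - s) ^ γ * (t - s))

theorem IsTransported.congr {d : ℕ} {T R : ℝ} {X : ℝ → Vec d} {ψ ψ' : ℝ → Vec d → ℝ}
    (h : IsTransported T R X ψ) (he : ∀ q ∈ Icc 0 T, ψ' q = ψ q) : IsTransported T R X ψ' where
  smooth q hq := he q hq ▸ h.smooth q hq
  bound n := by
    obtain ⟨C, hC, H⟩ := h.bound n
    exact ⟨C, hC, fun q hq => he q hq ▸ H q hq⟩
  support q hq := he q hq ▸ h.support q hq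
  increment n := by
    obtain ⟨C, hC, H⟩ := h.increment n
    refine ⟨C, hC, fun s t hs hst ht => ?_⟩
    rw [he s ⟨hs, hst.trans ht⟩, he t ⟨hs.trans hst, ht⟩]
    exact H s t hs hst ht

theorem IsHolder.mono {F : Type*} [NormedAddCommGroup F] {T T' γ : ℝ} {y : ℝ → F}
    (h : IsHolder T γ y) (hT : T' ≤ T) : IsHolder T' γ y :=
  h.imp fun _ hC s hs t ht => hC s ⟨hs.1, hs.2.trans hT⟩ t ⟨ht.1, ht.2.trans hT⟩

/-- A drift enters `backG` and the source integral only through time integrals, so changing it on a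
null set of times changes nothing at any `q`. All estimates can thus be made for the regular version
`f`. -/
theorem IsRegularFlow.isBackwardTransport {d : ℕ} {T γ : ℝ} {f b : ℝ → Vec d → Vec d}
    {X : ℝ → Vec d} {Φ : ℝ → ℝ → Vec d → Vec d} (h : IsRegularFlow T γ f X Φ) (hγ1 : γ ≤ 1)
    (hfb : ∀ᵐ t ∂(volume.restrict (Icc 0 T)), f t = b t)
    {φ₀ : Vec d → ℝ} (hφ : IsTest φ₀) {N : ℝ} (hN : ∀ t x, ‖f t x‖ ≤ N) {Rφ : ℝ}
    (hR : tsupport φ₀ ⊆ Metric.closedBall 0 Rφ) {t₀ : ℝ} (ht₀ : t₀ ∈ Icc 0 T) :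
    IsBackwardTransport t₀ γ (Rφ + (T * N + T ^ γ * holderSeminorm T γ X)) X b
      (backSol b Φ φ₀ t₀) := by
  have hψ := h.isTransported_backSol hφ hN hR ht₀
  have he : ∀ q ∈ Icc 0 t₀, backSol b Φ φ₀ t₀ q = backSol f Φ φ₀ t₀ q := by
    intro q hq
    funext x
    rw [backSol, backG_congr hfb hq.1 hq.2 ht₀.2, backSol]
  have hae : ∀ x, ∀ᵐ r, r ∈ Icc 0 t₀ →
      source b (backSol b Φ φ₀ t₀) r x = source f (backSol f Φ φ₀ t₀) r x := by
    intro x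
    filter_upwards [(ae_restrict_iff' measurableSet_Icc).1 hfb] with r hr hrm
    rw [source, source, he r hrm, hr ⟨hrm.1, hrm.2.trans ht₀.2⟩]
  refine ⟨hψ.congr he, fun x s hs t ht => ?_, ?_⟩
  · refine (hψ.intervalIntegrable_source (h.path.mono ht₀.2) h.pos hγ1 h.drift x hs ht).congr_ae ?_
    rw [EventuallyEq, ae_restrict_iff' measurableSet_uIoc]
    filter_upwards [hae x] with r hr hrm
    exact (hr (uIcc_subset_Icc hs ht (uIoc_subset_uIcc hrm))).symm
  · obtain ⟨C, hC0, hC⟩ := h.exists_expansion hγ1 ht₀ hψ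
    refine ⟨C, hC0, fun s t hs hst ht x => ?_⟩
    rw [he s ⟨hs, hst.trans ht⟩, he t ⟨hs.trans hst, ht⟩]
    have : ∫ r in s..t, source b (backSol b Φ φ₀ t₀) r x =
        ∫ r in s..t, source f (backSol f Φ φ₀ t₀) r x := by
      refine intervalIntegral.integral_congr_ae ?_
      filter_upwards [hae x] with r hr hrm
      rw [uIoc_of_le hst] at hrm
      exact hr ⟨hs.trans hrm.1.le, hrm.2.trans ht⟩
    rw [this]
    exact hC s t hs hst ht x

namespace IsTransported

variable {d : ℕ} {T R γ : ℝ} {X : ℝ → Vec d} {ψ : ℝ → Vec d → ℝ}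

/-- First order expansion of the gradient in time. -/
theorem exists_fderiv_expansion (h : IsTransported T R X ψ) (hX : IsHolder T γ X) (hγ : 0 < γ)
    (hγ2 : 2 * γ ≤ 1) : ∃ C, 0 ≤ C ∧ ∀ s t, 0 ≤ s → s ≤ t → t ≤ T → ∀ x,
      ‖fderiv ℝ (ψ t) x - fderiv ℝ (ψ s) x + fderiv ℝ (fderiv ℝ (ψ t)) x (X t - X s)‖ ≤
        C * (t - s) ^ (2 * γ) := by
  obtain ⟨C₁, h1, hC₁⟩ := h.increment 1
  obtain ⟨C₃, h3, hC₃⟩ := h.bound 3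
  obtain ⟨H, hH0, hH⟩ := hX.exists_nonneg
  rcases lt_or_ge T 0 with hT | hT
  · exact ⟨0, le_rfl, fun s t hs hst ht => by linarith⟩
  refine ⟨C₃ * H ^ 2 + C₁ * T ^ (1 - 2 * γ), by positivity, fun s t hs hst ht x => ?_⟩
  have ms : s ∈ Icc 0 T := ⟨hs, hst.trans ht⟩
  have mt : t ∈ Icc 0 T := ⟨hs.trans hst, ht⟩
  set δ := X t - X s with hδ
  have hτ : 0 ≤ t - s := sub_nonneg.2 hst
  have b1 : ‖fderiv ℝ (ψ t) (x + δ) - fderiv ℝ (ψ t) x - fderiv ℝ (fderiv ℝ (ψ t)) x δ‖ ≤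
      C₃ * H ^ 2 * (t - s) ^ (2 * γ) := by
    refine (norm_sub_sub_fderiv_le (f := fderiv ℝ (ψ t)) ((h.contDiff mt 3).fderiv_right
      (m := 2) (by norm_num)) (C := C₃) (fun y => ?_) x δ).trans ?_
    · rw [norm_iteratedFDeriv_fderiv]; exact hC₃ t mt y
    · have := hH s ms t mt
      rw [abs_of_nonneg hτ] at this
      have e : (t - s) ^ (2 * γ) = ((t - s) ^ γ) ^ 2 := by
        rw [mul_comm, ← Real.rpow_mul_natCast hτ]; norm_num
      rw [e, mul_assoc, ← mul_pow]
      gcongr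
  have b2 : ‖fderiv ℝ (ψ s) x - fderiv ℝ (ψ t) (x + δ)‖ ≤ C₁ * T ^ (1 - 2 * γ) * (t - s) ^ (2 * γ) := by
    have := hC₁ s t hs hst ht x
    have d2 : HasFDerivAt (fun x => ψ t (x + δ)) (fderiv ℝ (ψ t) (x + δ)) x :=
      (hasFDerivAt_comp_add_right δ).2
        ((h.contDiff mt 1).differentiable one_ne_zero (x + δ)).hasFDerivAt
    have d1 := ((h.contDiff ms 1).differentiable one_ne_zero x).hasFDerivAt.sub d2
    rw [← norm_fderiv_eq] at this
    erw [d1.fderiv] at this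
    refine this.trans ?_
    rw [mul_assoc]
    gcongr
    -- The linear error of the transported increment is admissible as a controlled remainder
    -- precisely because `2γ ≤ 1`.
    exact le_rpow_mul_rpow hτ (by linarith) (by linarith) hγ2
  calc _ = ‖(fderiv ℝ (ψ t) (x + δ) - fderiv ℝ (ψ t) x - fderiv ℝ (fderiv ℝ (ψ t)) x δ) +
        (fderiv ℝ (ψ s) x - fderiv ℝ (ψ t) (x + δ))‖ := by
        rw [← norm_neg]; congr 1; abel
    _ ≤ _ := norm_add_le _ _
    _ ≤ _ := add_le_add b1 b2
    _ = _ := by ring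

/-- `exists_fderiv_expansion` has the Hessian at the later of the two times. If the base point `s`
is the later one this is already the required form; otherwise moving the Hessian costs a Hölder
factor `γ`, which together with the path increment gives `2γ`. -/
theorem isControlled_pd (h : IsTransported T R X ψ) (hX : IsHolder T γ X) (hγ : 0 < γ)
    (hγ2 : 2 * γ ≤ 1) (x : Vec d) (i : Fin d) :
    IsControlled T γ X (fun t => pd i (ψ t) x) (fun t j => -pd j (pd i (ψ t)) x) := by
  obtain ⟨C₁, h1, hC₁⟩ := h.norm_fderiv_sub_le hX hγ (by linarith)
  obtain ⟨C₂, h2, hC₂⟩ := h.norm_fderiv_fderiv_sub_le hX hγ (by linarith)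
  obtain ⟨B, hB0, hB⟩ := h.exists_fderiv_expansion hX hγ hγ2
  obtain ⟨H, hH0, hH⟩ := hX.exists_nonneg
  refine ⟨⟨C₁, fun s hs t ht => ?_⟩, fun j => ⟨C₂, fun s hs t ht => ?_⟩,
    ⟨B + C₂ * H, fun s hs t ht => ?_⟩⟩
  · refine le_trans ?_ (hC₁ s hs t ht x)
    exact abs_clm_single_le (fderiv ℝ (ψ t) x - fderiv ℝ (ψ s) x) i
  · refine le_trans ?_ (hC₂ s hs t ht x)
    dsimp only
    rw [neg_sub_neg, norm_sub_rev, pd_pd_eq (h.contDiff ht 2), pd_pd_eq (h.contDiff hs 2)]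
    exact abs_clm_single_single_le
      (fderiv ℝ (fderiv ℝ (ψ t)) x - fderiv ℝ (fderiv ℝ (ψ s)) x) i j
  · set δ := X t - X s with hδ
    have e2 : ∑ j, -pd j (pd i (ψ s)) x * (X t j - X s j) =
        -(fderiv ℝ (fderiv ℝ (ψ s)) x δ (EuclideanSpace.single i 1)) := by
      rw [clm_apply_eq_sum (fderiv ℝ (fderiv ℝ (ψ s)) x) δ, _root_.sum_apply,
        ← Finset.sum_neg_distrib]
      refine Finset.sum_congr rfl fun j _ => ?_
      rw [pd_pd_eq (h.contDiff hs 2)]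
      simp [hδ]
      ring
    have key : ‖fderiv ℝ (ψ t) x - fderiv ℝ (ψ s) x + fderiv ℝ (fderiv ℝ (ψ s)) x δ‖ ≤
        (B + C₂ * H) * |t - s| ^ (2 * γ) := by
      rcases le_total s t with hst | hst
      · have b1 := hB s t hs.1 hst ht.2 x
        have b2 : ‖(fderiv ℝ (fderiv ℝ (ψ s)) x - fderiv ℝ (fderiv ℝ (ψ t)) x) δ‖ ≤
            C₂ * H * |t - s| ^ (2 * γ) := by
          refine (ContinuousLinearMap.le_opNorm _ _).trans ?_
          rw [norm_sub_rev]
          calc _ ≤ (C₂ * |t - s| ^ γ) * (H * |t - s| ^ γ) :=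
                mul_le_mul (hC₂ s hs t ht x) (hH s hs t ht) (norm_nonneg _) (by positivity)
            _ = C₂ * H * (|t - s| ^ γ * |t - s| ^ γ) := by ring
            _ = _ := by rw [two_mul, Real.rpow_add_of_nonneg (abs_nonneg _) hγ.le hγ.le]
        rw [← abs_of_nonneg (sub_nonneg.2 hst)] at b1
        calc _ = ‖(fderiv ℝ (ψ t) x - fderiv ℝ (ψ s) x + fderiv ℝ (fderiv ℝ (ψ t)) x δ) +
              (fderiv ℝ (fderiv ℝ (ψ s)) x - fderiv ℝ (fderiv ℝ (ψ t)) x) δ‖ := by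
              rw [_root_.sub_apply]; congr 1; abel
          _ ≤ _ := norm_add_le _ _
          _ ≤ _ := add_le_add b1 b2
          _ = _ := by ring
      · have b1 := hB t s ht.1 hst hs.2 x
        rw [← abs_of_nonneg (sub_nonneg.2 hst), abs_sub_comm] at b1
        calc _ = ‖fderiv ℝ (ψ s) x - fderiv ℝ (ψ t) x +
              fderiv ℝ (fderiv ℝ (ψ s)) x (X s - X t)‖ := by
              rw [← norm_neg, hδ, map_sub, map_sub]; congr 1; abel
          _ ≤ _ := b1
          _ ≤ _ := by gcongr; linarith [mul_nonneg h2 hH0]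
    refine le_trans (le_of_eq ?_) ((abs_clm_single_le _ i).trans key)
    dsimp only
    rw [e2]
    simp [pd]

end IsTransported

/-- With `δ = X_t - X_s`, the expansion turns `ψ_s - ψ_t - ∫ source` into `ψ_t(x + δ) - ψ_t(x)`,
whose Taylor coefficients live at time `t`. Moving the gradient to time `s` produces `-∇²ψ_t δ δ`,
which changes the second order coefficient from `1/2` to `-1/2`. For a geometric rough path this is
the second level contracted with the Gubinelli derivative `-∇²ψ_s`; all errors have order `3γ > 1`.
-/
theorem IsBackwardTransport.isStrongControlledSolution {d : ℕ} {T R γ : ℝ} {X : ℝ → Vec d}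
    {XX : ℝ → ℝ → Matrix (Fin d) (Fin d) ℝ} {ψ : ℝ → Vec d → ℝ} {b : ℝ → Vec d → Vec d}
    (h : IsBackwardTransport T γ R X b ψ) (hX : IsGeometricRoughPath T γ X XX) (hγ : 1 / 3 < γ)
    (hγ2 : γ ≤ 1 / 2) : IsStrongControlledSolution T γ X XX b (fun t => divergence (b t)) ψ
      (fun t x i j => -pd j (pd i (ψ t)) x) := by
  have hγ0 : 0 < γ := by linarith
  have hγ1 : γ ≤ 1 := by linarith
  have hψ := h.toIsTransported
  obtain ⟨c₀, hc₀0, hc₀⟩ := hψ.abs_sub_le hX.holder hγ0 hγ1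
  obtain ⟨c₁, hc₁0, hc₁⟩ := hψ.norm_fderiv_sub_le hX.holder hγ0 hγ1
  obtain ⟨C₀, -, hC₀⟩ := hψ.exists_abs_le
  refine ⟨fun t ht => hψ.contDiff ht 1, ⟨C₀, hC₀⟩, ⟨c₀ + c₁, fun s hs t ht x => ?_⟩,
    fun x i => hψ.isControlled_pd hX.holder hγ0 (by linarith) x i, fun x s t hs hst ht => ?_⟩
  · have : 0 ≤ |t - s| ^ γ := Real.rpow_nonneg (abs_nonneg _) _
    constructor
    · refine (hc₀ s hs t ht x).trans ?_
      gcongr; linarith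
    · refine (hc₁ s hs t ht x).trans ?_
      gcongr; linarith
  obtain ⟨c₂, hc₂0, hc₂⟩ := hψ.norm_fderiv_fderiv_sub_le hX.holder hγ0 hγ1
  obtain ⟨C₃, hC₃0, hC₃⟩ := hψ.bound 3
  obtain ⟨B, hB0, hB⟩ := hψ.exists_fderiv_expansion hX.holder hγ0 (by linarith)
  obtain ⟨H, hH0, hH⟩ := hX.holder.exists_nonneg
  obtain ⟨A, hA0, hA⟩ := h.expansion
  have hT : 0 ≤ T := hs.trans (hst.trans ht)
  rw [hasRoughIntegral_iff]
  set J : ℝ → ℝ := fun r => -ψ r x - ∫ q in (0 : ℝ)..r, source b ψ q x with hJ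
  have m0 : (0 : ℝ) ∈ Icc 0 T := ⟨le_rfl, hT⟩
  have hJd : ∀ s t, s ∈ Icc 0 T → t ∈ Icc 0 T →
      J t - J s = ψ s x - ψ t x - ∫ q in s..t, source b ψ q x := by
    intro s t hs ht
    have := intervalIntegral.integral_add_adjacent_intervals (h.integrable x 0 m0 s hs)
      (h.integrable x s hs t ht)
    rw [hJ]
    simp only
    linarith
  have e : -(ψ t x - ψ s x) - ∫ q in s..t, (fderiv ℝ (ψ q) x (b q x) + divergence (b q) x * ψ q x) =
      J t - J s := by
    rw [hJd s t ⟨hs, hst.trans ht⟩ ⟨hs.trans hst, ht⟩]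
    simp only [source]
    ring
  rw [e]
  refine hasIncrementIntegral_of_local (C := A * T ^ (1 - 2 * γ) + C₃ * H ^ 3 + B * H + c₂ * H ^ 2)
    (θ := 3 * γ) (by positivity) (by linarith) fun s' t' hs' hst' ht' => ?_
  clear e
  have ms : s' ∈ Icc 0 T := ⟨hs.trans hs', hst'.trans (ht'.trans ht)⟩
  have mt : t' ∈ Icc 0 T := ⟨ms.1.trans hst', ht'.trans ht⟩
  have ec := hX.contraction ms mt (hψ.contDiff ms 2) x
  have e2 : ∑ i, ∑ j, -pd j (pd i (ψ s')) x * XX s' t' j i =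
      -(1 / 2 * fderiv ℝ (fderiv ℝ (ψ s')) x (X t' - X s') (X t' - X s')) := by
    rw [← ec]; simp
  have e1 : ∑ i, pd i (ψ s') x * (X t' i - X s' i) = fderiv ℝ (ψ s') x (X t' - X s') := by
    rw [fderiv_apply_eq_sum_pd]; simp
  rw [e1, e2, hJd _ _ ms mt]
  set δ := X t' - X s' with hδ
  set τ := t' - s' with hτ
  have hτ0 : 0 ≤ τ := sub_nonneg.2 hst'
  have hτT : τ ≤ T := by linarith [ms.1, mt.2]
  have p2 : τ ^ (2 * γ) = (τ ^ γ) ^ 2 := by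
    rw [mul_comm, ← Real.rpow_mul_natCast hτ0]; norm_num
  have p3 : τ ^ (3 * γ) = (τ ^ γ) ^ 3 := by
    rw [mul_comm, ← Real.rpow_mul_natCast hτ0]; norm_num
  have hg0 : 0 ≤ τ ^ γ := Real.rpow_nonneg hτ0 _
  have hδ1 : ‖δ‖ ≤ H * τ ^ γ := by
    have := hH _ ms _ mt
    rwa [abs_of_nonneg hτ0] at this
  have b1 := hA s' t' ms.1 hst' mt.2 x
  have b2 := abs_taylor_three_le (hψ.contDiff mt 3) (hC₃ t' mt) x δ
  have b3 : |(fderiv ℝ (ψ t') x - fderiv ℝ (ψ s') x + fderiv ℝ (fderiv ℝ (ψ t')) x δ) δ| ≤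
      B * H * (τ ^ γ) ^ 3 := by
    refine (ContinuousLinearMap.le_opNorm
      (fderiv ℝ (ψ t') x - fderiv ℝ (ψ s') x + fderiv ℝ (fderiv ℝ (ψ t')) x δ) δ).trans ?_
    have := hB s' t' ms.1 hst' mt.2 x
    rw [p2] at this
    calc _ ≤ (B * (τ ^ γ) ^ 2) * (H * τ ^ γ) :=
          mul_le_mul this hδ1 (norm_nonneg _) (by positivity)
      _ = _ := by ring
  have b4 : |(fderiv ℝ (fderiv ℝ (ψ t')) x - fderiv ℝ (fderiv ℝ (ψ s')) x) δ δ| ≤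
      c₂ * H ^ 2 * (τ ^ γ) ^ 3 := by
    refine (ContinuousLinearMap.le_opNorm₂
      (fderiv ℝ (fderiv ℝ (ψ t')) x - fderiv ℝ (fderiv ℝ (ψ s')) x) δ δ).trans ?_
    have := hc₂ s' ms t' mt x
    rw [abs_of_nonneg hτ0] at this
    calc _ ≤ (c₂ * τ ^ γ) * (H * τ ^ γ) * (H * τ ^ γ) := by gcongr
      _ = _ := by ring
  have b5 : A * (τ ^ γ * τ) ≤ A * T ^ (1 - 2 * γ) * (τ ^ γ) ^ 3 := by
    have := le_rpow_mul_rpow hτ0 hτT (γ := 2 * γ) (by linarith) (by linarith)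
    rw [p2] at this
    calc _ ≤ A * (τ ^ γ * (T ^ (1 - 2 * γ) * (τ ^ γ) ^ 2)) := by gcongr
      _ = _ := by ring
  have b6 : C₃ * ‖δ‖ ^ 3 ≤ C₃ * H ^ 3 * (τ ^ γ) ^ 3 := by
    rw [mul_assoc, ← mul_pow]
    gcongr
  rw [p3]
  simp only [_root_.add_apply, _root_.sub_apply] at b3 b4
  have b7 : 0 ≤ c₂ * H ^ 2 * (τ ^ γ) ^ 3 := by positivity
  rw [add_mul, add_mul, add_mul]
  rw [abs_le] at b1 b2 b3 b4 ⊢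
  constructor <;> linarith [b1.1, b1.2, b2.1, b2.2, b3.1, b3.2, b4.1, b4.2]

theorem backSol_self {d : ℕ} {T : ℝ} {b : ℝ → Vec d → Vec d} {X : ℝ → Vec d}
    {Φ : ℝ → ℝ → Vec d → Vec d} (h : IsFlow T b X Φ) (φ₀ : Vec d → ℝ) {t₀ : ℝ}
    (ht₀ : t₀ ∈ Icc 0 T) (x : Vec d) : backSol b Φ φ₀ t₀ t₀ x = φ₀ x := by
  have : Φ t₀ t₀ x = x := by
    rw [(h t₀ ht₀ x).2 t₀ ⟨le_rfl, ht₀.2⟩]; simp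
  simp [backSol, backG, this]

/-! ### The determinant of the flow -/

/-- A local version is needed because the determinant, to which this is applied, need not have
bounded second derivatives. -/
theorem exists_abs_sub_sub_fderiv_le {E : Type*} [NormedAddCommGroup E] [NormedSpace ℝ E]
    [FiniteDimensional ℝ E] {g : E → ℝ} (hg : ContDiff ℝ 2 g) (a : E) (ρ : ℝ) :
    ∃ C, 0 ≤ C ∧ ∀ v, ‖v‖ ≤ ρ → |g (a + v) - g a - fderiv ℝ g a v| ≤ C * ‖v‖ ^ 2 := by
  have hg1 : ContDiff ℝ 1 (fderiv ℝ g) := hg.fderiv_right (by norm_num)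
  have := FiniteDimensional.proper_real E
  obtain ⟨C, hC⟩ := (isCompact_closedBall a ρ).exists_bound_of_continuousOn
    (hg1.continuous_fderiv one_ne_zero).continuousOn
  refine ⟨max C 0, le_max_right _ _, fun v hv => ?_⟩
  have hsub : Metric.closedBall a ‖v‖ ⊆ Metric.closedBall a ρ := Metric.closedBall_subset_closedBall hv
  have ha : a ∈ Metric.closedBall a ‖v‖ := Metric.mem_closedBall_self (norm_nonneg _)
  have hb : a + v ∈ Metric.closedBall a ‖v‖ := by simp
  have := (convex_closedBall a ‖v‖).norm_image_sub_le_of_norm_fderiv_le' (𝕜 := ℝ) (f := g)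
    (φ := fderiv ℝ g a) (C := max C 0 * ‖v‖)
    (fun x _ => hg.differentiable two_ne_zero x) (fun x hx => ?_) ha hb
  · rw [add_sub_cancel_left] at this
    rw [pow_two, ← mul_assoc]
    exact this
  · refine ((convex_closedBall a ‖v‖).norm_image_sub_le_of_norm_fderiv_le (𝕜 := ℝ)
      (fun y _ => hg1.differentiable one_ne_zero y) (fun y hy => hC y (hsub hy)) ha hx).trans ?_
    have h1 : ‖x - a‖ ≤ ‖v‖ := mem_closedBall_iff_norm.1 hx
    gcongr
    exact le_max_left _ _

theorem det_eq_det_matrix {d : ℕ} (A : Vec d →L[ℝ] Vec d) :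
    A.det = (Matrix.of fun i j => (A (EuclideanSpace.single j 1)) i).det := by
  rw [ContinuousLinearMap.det,
    ← LinearMap.det_toMatrix (EuclideanSpace.basisFun (Fin d) ℝ).toBasis]
  congr 1

theorem contDiff_det {d : ℕ} (n : WithTop ℕ∞) :
    ContDiff ℝ n fun A : Vec d →L[ℝ] Vec d => A.det := by
  simp only [det_eq_det_matrix, Matrix.det_apply', Matrix.of_apply]
  refine ContDiff.sum fun σ _ => contDiff_const.mul (contDiff_prod fun i _ => ?_)
  exact ((EuclideanSpace.proj (σ i) : Vec d →L[ℝ] ℝ).comp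
    (ContinuousLinearMap.apply ℝ (Vec d) (EuclideanSpace.single i (1 : ℝ)))).contDiff

/-- The derivative at `r = 0` of the polynomial `det(1 + r B)`, whose linear coefficient is the
trace. -/
theorem fderiv_det_one {d : ℕ} (B : Vec d →L[ℝ] Vec d) :
    fderiv ℝ (fun A : Vec d →L[ℝ] Vec d => A.det) 1 B = traceCLM d B := by
  set M : Matrix (Fin d) (Fin d) ℝ := Matrix.of fun i j => (B (EuclideanSpace.single j 1)) i with hM
  have h1 : HasDerivAt (fun r : ℝ => (1 + r • B).det)
      (fderiv ℝ (fun A : Vec d →L[ℝ] Vec d => A.det) 1 B) 0 := by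
    have hd : HasDerivAt (fun r : ℝ => (1 : Vec d →L[ℝ] Vec d) + r • B) B 0 := by
      simpa using ((hasDerivAt_id (0 : ℝ)).smul_const B).const_add (1 : Vec d →L[ℝ] Vec d)
    have hf : HasFDerivAt (fun A : Vec d →L[ℝ] Vec d => A.det)
        (fderiv ℝ (fun A : Vec d →L[ℝ] Vec d => A.det) 1) (1 + (0 : ℝ) • B) := by
      have e : (1 : Vec d →L[ℝ] Vec d) + (0 : ℝ) • B = 1 := by
        ext v; simp
      rw [e]
      exact ((contDiff_det 1).differentiable one_ne_zero 1).hasFDerivAt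
    exact hf.comp_hasDerivAt (0 : ℝ) hd
  have h2 : (fun r : ℝ => ((1 : Vec d →L[ℝ] Vec d) + r • B).det) = fun r => 1 + M.trace * r +
      ((1 + (Polynomial.X : Polynomial ℝ) • M.map Polynomial.C).det).divX.divX.eval r * r ^ 2 := by
    funext r
    rw [← Matrix.det_one_add_smul, det_eq_det_matrix]
    congr 1
    ext i j
    simp [hM, Matrix.one_apply]
  have h3 : HasDerivAt (fun r : ℝ => 1 + M.trace * r +
      ((1 + (Polynomial.X : Polynomial ℝ) • M.map Polynomial.C).det).divX.divX.eval r * r ^ 2)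
      M.trace 0 := by
    have a := ((hasDerivAt_id (0 : ℝ)).const_mul M.trace).const_add 1
    have b := ((1 + (Polynomial.X : Polynomial ℝ) •
      M.map Polynomial.C).det.divX.divX.hasDerivAt 0).mul ((hasDerivAt_id (0 : ℝ)).pow 2)
    refine (a.add b).congr_deriv ?_
    simp
  rw [h2] at h1
  rw [h1.unique h3, traceCLM_apply]
  rfl

theorem exists_abs_det_one_add_le (d : ℕ) (ρ : ℝ) :
    ∃ C, 0 ≤ C ∧ ∀ B : Vec d →L[ℝ] Vec d, ‖B‖ ≤ ρ →
      |(1 + B).det - 1 - traceCLM d B| ≤ C * ‖B‖ ^ 2 := by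
  obtain ⟨C, hC0, hC⟩ := exists_abs_sub_sub_fderiv_le (contDiff_det (d := d) 2) 1 ρ
  refine ⟨C, hC0, fun B hB => ?_⟩
  have := hC B hB
  rw [fderiv_det_one] at this
  convert this using 4
  exact (LinearMap.det_id (A := ℝ) (M := Vec d)).symm

/-- The image of the unit ball has volume `|det A|` times that of the ball, and it lies in the ball
of radius `‖A‖`. -/
theorem abs_det_le_norm_pow {d : ℕ} (A : Vec d →L[ℝ] Vec d) : |A.det| ≤ ‖A‖ ^ d := by
  have h1 := Measure.addHaar_image_continuousLinearMap (volume : Measure (Vec d)) A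
    (Metric.closedBall 0 1)
  have h2 : A '' Metric.closedBall 0 1 ⊆ Metric.closedBall 0 ‖A‖ := by
    rintro _ ⟨x, hx, rfl⟩
    rw [mem_closedBall_zero_iff] at hx ⊢
    exact A.le_of_opNorm_le_of_le le_rfl hx |>.trans (mul_one _).le
  have h3 := measure_mono (μ := volume) h2
  rw [h1, Measure.addHaar_closedBall' _ _ (norm_nonneg _), finrank_euclideanSpace_fin] at h3
  have hp : (volume (Metric.closedBall (0 : Vec d) 1)) ≠ 0 :=
    (Metric.measure_closedBall_pos volume _ one_pos).ne'
  have ht : (volume (Metric.closedBall (0 : Vec d) 1)) ≠ ⊤ := measure_closedBall_lt_top.ne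
  exact (ENNReal.ofReal_le_ofReal_iff (by positivity)).1
    ((ENNReal.mul_le_mul_iff_left hp ht).1 h3)

namespace IsRegularFlow

variable {d : ℕ} {T γ : ℝ} {f : ℝ → Vec d → Vec d} {X : ℝ → Vec d} {Φ : ℝ → ℝ → Vec d → Vec d}

theorem contDiff_flow (h : IsRegularFlow T γ f X Φ) {s t : ℝ} (hs : 0 ≤ s) (hst : s ≤ t)
    (ht : t ≤ T) : ContDiff ℝ 1 (Φ s t) :=
  h.isSized_flow.contDiff 1 ⟨(s, t), hs, hst, ht⟩

/-- First order expansion of the derivative of the flow. -/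
theorem exists_fderiv_flow_sub_le (h : IsRegularFlow T γ f X Φ) (R : ℝ) :
    ∃ C, 0 ≤ C ∧ ∀ s t, 0 ≤ s → s ≤ t → t ≤ T → ∀ y, ‖y‖ ≤ R →
      ‖fderiv ℝ (Φ s t) y - 1 - ∫ r in s..t, fderiv ℝ (f r) (Φ s r y)‖ ≤ C * (t - s) ^ 2 := by
  obtain ⟨C₁', hC₁'⟩ := h.isSized_displacement.bound 1 (R + 1)
  obtain ⟨L, hL⟩ := h.drift.exists_bound_fderiv
  obtain ⟨L₂, hL₂⟩ := h.drift.bound 2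
  set C₁ := |C₁'| with hC₁d
  have hC₁ : ∀ p : TimeInterval T, ∀ x, ‖x‖ ≤ R + 1 →
      ‖fderiv ℝ (fun x => Φ p.1.1 p.1.2 x - (x + (X p.1.2 - X p.1.1))) x‖ ≤ C₁ * p.length := by
    intro p x hx
    rw [norm_fderiv_eq]
    exact (hC₁' p x hx).trans (mul_le_mul_of_nonneg_right (le_abs_self _) p.length_nonneg)
  have hC₁0 : 0 ≤ C₁ := abs_nonneg _
  have hL0 : 0 ≤ L := (norm_nonneg _).trans (hL 0 0)
  have hL₂0 : 0 ≤ L₂ := (norm_nonneg _).trans (hL₂ 0 0)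
  refine ⟨L * C₁, by positivity, fun s t hs hst ht y hy => ?_⟩
  have hT : 0 ≤ T := hs.trans (hst.trans ht)
  have mS : s ∈ Icc 0 T := ⟨hs, hst.trans ht⟩
  have mss : s ∈ Icc s T := ⟨le_rfl, mS.2⟩
  have mst : t ∈ Icc s T := ⟨hst, ht⟩
  have hτ : 0 ≤ t - s := sub_nonneg.2 hst
  -- Two nearby trajectories share the same noise, so their difference changes only through the
  -- drift, by `O(t - s)` relative to the initial distance.
  have hlip : ∀ r ∈ Icc s t, ∀ z, ‖z - y‖ ≤ 1 →
      ‖(Φ s r z - Φ s r y) - (z - y)‖ ≤ C₁ * (t - s) * ‖z - y‖ := by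
    intro r hr z hz
    let p : TimeInterval T := ⟨(s, r), hs, hr.1, hr.2.trans ht⟩
    have hball : ∀ w ∈ Metric.closedBall y 1, ‖w‖ ≤ R + 1 := by
      intro w hw
      have := mem_closedBall_iff_norm.1 hw
      linarith [norm_le_norm_add_norm_sub' w y]
    have := (convex_closedBall y 1).norm_image_sub_le_of_norm_fderiv_le (𝕜 := ℝ)
      (f := fun x => Φ s r x - (x + (X r - X s)))
      (fun w _ => (h.isSized_displacement.contDiff 1 p).differentiable one_ne_zero w)
      (fun w hw => hC₁ p w (hball w hw)) (Metric.mem_closedBall_self zero_le_one)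
      (mem_closedBall_iff_norm.2 hz)
    refine le_trans (le_of_eq ?_) (this.trans ?_)
    · congr 1; abel
    · have : p.length ≤ t - s := by
        change r - s ≤ t - s
        linarith [hr.2]
      gcongr
  set I := ∫ r in s..t, fderiv ℝ (f r) (Φ s r y) with hI
  have iI := h.continuousOn_drift h.drift.fderiv mS y mss mst
  have hdiff : HasFDerivAt (fun z => Φ s t z - z - I z) (fderiv ℝ (Φ s t) y - 1 - I) y :=
    ((((h.contDiff_flow hs hst ht).differentiable one_ne_zero y).hasFDerivAt).sub
      (hasFDerivAt_id y)).sub I.hasFDerivAt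
  set c := L₂ * (1 + C₁ * T) ^ 2 with hc
  have hc0 : 0 ≤ c := by positivity
  have key : ∀ z, ‖z - y‖ ≤ 1 → ‖(Φ s t z - z - I z) - (Φ s t y - y - I y)‖ ≤
      (L * C₁ * (t - s) + c * ‖z - y‖) * ‖z - y‖ * (t - s) := by
    intro z hz
    have e : (Φ s t z - z - I z) - (Φ s t y - y - I y) =
        ∫ r in s..t, (f r (Φ s r z) - f r (Φ s r y) - fderiv ℝ (f r) (Φ s r y) (z - y)) := by
      have i1 := h.continuousOn_drift h.drift mS z mss mst
      have i2 := h.continuousOn_drift h.drift mS y mss mst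
      have i3 : IntervalIntegrable (fun r => fderiv ℝ (f r) (Φ s r y) (z - y)) volume s t :=
        h.continuousOn_drift (h.drift.fderiv.clm_comp (ContinuousLinearMap.apply ℝ (Vec d) (z - y)))
          mS y mss mst
      rw [intervalIntegral.integral_sub (i1.sub i2) i3,
        intervalIntegral.integral_sub i1 i2]
      have : ∫ r in s..t, fderiv ℝ (f r) (Φ s r y) (z - y) = I (z - y) :=
        (ContinuousLinearMap.apply ℝ (Vec d) (z - y)).intervalIntegral_comp_comm iI
      rw [this, (h.flow s mS z).2 t mst, (h.flow s mS y).2 t mst, map_sub]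
      abel
    rw [e]
    have := intervalIntegral.norm_integral_le_of_norm_le_const (a := s) (b := t)
      (f := fun r => f r (Φ s r z) - f r (Φ s r y) - fderiv ℝ (f r) (Φ s r y) (z - y))
      (C := (L * C₁ * (t - s) + c * ‖z - y‖) * ‖z - y‖) fun r hr => by
        rw [uIoc_of_le hst] at hr
        have hl := hlip r ⟨hr.1.le, hr.2⟩ z hz
        set w := Φ s r z - Φ s r y with hw
        have hwn : ‖w‖ ≤ (1 + C₁ * T) * ‖z - y‖ := by
          have h1 := norm_le_norm_add_norm_sub' w (z - y)
          have h2 : C₁ * (t - s) * ‖z - y‖ ≤ C₁ * T * ‖z - y‖ := by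
            gcongr; linarith
          linarith
        have t1 := norm_sub_sub_fderiv_le (h.drift.contDiff 2 r) (hL₂ r) (Φ s r y) w
        rw [show Φ s r y + w = Φ s r z by rw [hw]; abel] at t1
        have t2 : ‖fderiv ℝ (f r) (Φ s r y) (w - (z - y))‖ ≤ L * (C₁ * (t - s) * ‖z - y‖) :=
          ((fderiv ℝ (f r) (Φ s r y)).le_opNorm _).trans
            (mul_le_mul (hL r _) hl (norm_nonneg _) hL0)
        calc _ = ‖(f r (Φ s r z) - f r (Φ s r y) - fderiv ℝ (f r) (Φ s r y) w) +
              fderiv ℝ (f r) (Φ s r y) (w - (z - y))‖ := by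
              rw [map_sub _ w]; congr 1; abel
          _ ≤ L₂ * ((1 + C₁ * T) * ‖z - y‖) ^ 2 + L * (C₁ * (t - s) * ‖z - y‖) :=
              (norm_add_le _ _).trans (add_le_add (t1.trans (by gcongr)) t2)
          _ = _ := by rw [hc]; ring
    rwa [abs_of_nonneg hτ] at this
  -- A derivative is bounded by any local Lipschitz constant. The Taylor term quadratic in `‖z - y‖`
  -- becomes arbitrarily small as `z → y` and is absorbed in `η`.
  refine le_of_forall_pos_le_add fun η hη => ?_
  refine hdiff.le_of_lip' (by positivity) ?_
  have hpos : 0 < min 1 (η / (c * (t - s) + 1)) := lt_min one_pos (by positivity)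
  filter_upwards [Metric.closedBall_mem_nhds y hpos] with z hz
  rw [mem_closedBall_iff_norm, le_min_iff] at hz
  refine (key z hz.1).trans ?_
  have h2 : c * (t - s) * ‖z - y‖ ≤ η := by
    have := (le_div_iff₀ (by positivity)).1 hz.2
    nlinarith [norm_nonneg (z - y)]
  calc _ = (L * C₁ * (t - s) ^ 2 + c * (t - s) * ‖z - y‖) * ‖z - y‖ := by ring
    _ ≤ _ := by gcongr

/-- The Liouville formula. -/
theorem det_fderiv_flow (h : IsRegularFlow T γ f X Φ) {q t₀ : ℝ} (hq : 0 ≤ q) (hqt : q ≤ t₀)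
    (ht₀ : t₀ ≤ T) (x : Vec d) :
    (fderiv ℝ (Φ q t₀) x).det = Real.exp (backG f Φ t₀ q x) := by
  obtain ⟨N, hN⟩ := h.drift.exists_bound
  obtain ⟨L, hL⟩ := h.drift.exists_bound_fderiv
  obtain ⟨M, hM⟩ := h.drift.divergence.exists_bound
  have hL0 : 0 ≤ L := (norm_nonneg _).trans (hL 0 0)
  have hM0 : 0 ≤ M := (norm_nonneg _).trans (hM 0 0)
  have hT : 0 ≤ T := hq.trans (hqt.trans ht₀)
  have hqT : q ∈ Icc 0 T := ⟨hq, hqt.trans ht₀⟩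
  set ρ := T * N + T ^ γ * holderSeminorm T γ X
  obtain ⟨C, hC0, hC⟩ := h.exists_fderiv_flow_sub_le (‖x‖ + ρ)
  obtain ⟨D', hD'⟩ := h.isSized_flow.bound 1 ‖x‖
  set Q := (L + C * T) with hQ
  have hQ0 : 0 ≤ Q := by positivity
  obtain ⟨A, hA0, hA⟩ := exists_abs_det_one_add_le d (Q * T)
  set c := Real.exp (M * T) + 1 + M * T with hc
  set trn := ‖traceCLM d‖ with htrn
  have htrn0 : 0 ≤ trn := (traceCLM d).opNorm_nonneg
  set G : ℝ → ℝ := fun t => backG f Φ t q x with hG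
  -- `P` should be constantly `1`. The drift is merely measurable in time, so instead of
  -- differentiating `P`, its increments are shown to be quadratic in the step, and
  -- `abs_sub_le_of_local` forces it to be constant.
  set P : ℝ → ℝ := fun t => (fderiv ℝ (Φ q t) x).det * Real.exp (-G t) with hP
  have hGb : ∀ s t, 0 ≤ s → s ≤ t → t ≤ T → ∀ y, |backG f Φ t s y| ≤ M * (t - s) := by
    intro s t hs hst ht y
    have := intervalIntegral.norm_integral_le_of_norm_le_const (a := s) (b := t)
      (f := fun r => divergence (f r) (Φ s r y)) (C := M) fun r _ => hM r _
    rwa [abs_of_nonneg (sub_nonneg.2 hst)] at this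
  have hexpb : ∀ g : ℝ, |g| ≤ M * T → Real.exp (-g) ≤ Real.exp (M * T) := fun g hg =>
    Real.exp_le_exp.2 ((neg_le_abs g).trans hg)
  have hPb : ∀ s, q ≤ s → s ≤ t₀ → |P s| ≤ |D'| ^ d * Real.exp (M * T) := by
    intro s hqs hst
    have h1 := hD' ⟨(q, s), hq, hqs, hst.trans ht₀⟩ x le_rfl
    rw [← norm_fderiv_eq, mul_one] at h1
    rw [hP]
    simp only
    rw [abs_mul, Real.abs_exp]
    refine mul_le_mul ((abs_det_le_norm_pow _).trans ?_) (hexpb _ ?_) (Real.exp_pos _).le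
      (by positivity)
    · exact pow_le_pow_left₀ (norm_nonneg _) (h1.trans (le_abs_self _)) _
    · refine (hGb q s hq hqs (hst.trans ht₀) x).trans ?_
      gcongr; linarith
  set E := (A * Q ^ 2) * Real.exp (M * T) + (1 + trn * (Q * T)) * (c * M ^ 2) + trn * C +
    trn * Q * M with hE
  have hE0 : 0 ≤ E := by positivity
  have key : ∀ s t, q ≤ s → s ≤ t → t ≤ t₀ →
      |P t - P s| ≤ (|D'| ^ d * Real.exp (M * T) * E) * (t - s) ^ (2 : ℝ) + 0 * (t - s) := by
    intro s t hqs hst ht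
    have hs0 : 0 ≤ s := hq.trans hqs
    have htT : t ≤ T := ht.trans ht₀
    have hτ : 0 ≤ t - s := sub_nonneg.2 hst
    have hτT : t - s ≤ T := by linarith
    set y := Φ q s x with hy
    have hyn : ‖y‖ ≤ ‖x‖ + ρ := by
      have := h.norm_flow_sub_le hN hqT (t := s) ⟨hqs, hst.trans htT⟩ x
      linarith [norm_le_norm_add_norm_sub' y x]
    set B := fderiv ℝ (Φ s t) y - 1 with hB
    set I := ∫ r in s..t, fderiv ℝ (f r) (Φ s r y) with hI
    have hBI : ‖B - I‖ ≤ C * (t - s) ^ 2 := hC s t hs0 hst htT y hyn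
    have hIn : ‖I‖ ≤ L * (t - s) := by
      have := intervalIntegral.norm_integral_le_of_norm_le_const (a := s) (b := t)
        (f := fun r => fderiv ℝ (f r) (Φ s r y)) (C := L) fun r _ => hL r _
      rwa [abs_of_nonneg hτ] at this
    have hBn : ‖B‖ ≤ Q * (t - s) := by
      have h1 := norm_le_norm_add_norm_sub' B I
      have h2 : C * (t - s) ^ 2 ≤ C * T * (t - s) := by
        rw [pow_two, mul_assoc]; gcongr
      rw [hQ, add_mul]
      linarith
    set g := backG f Φ t s y with hg
    have hgb : |g| ≤ M * (t - s) := hGb s t hs0 hst htT y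
    have hgT : |g| ≤ M * T := hgb.trans (by gcongr)
    have htr : traceCLM d I = g := by
      have mS : s ∈ Icc 0 T := ⟨hs0, hst.trans htT⟩
      rw [hI, ← (traceCLM d).intervalIntegral_comp_comm
        (h.continuousOn_drift h.drift.fderiv mS y ⟨le_rfl, mS.2⟩ ⟨hst, htT⟩)]
      simp only [← divergence_eq_trace]
      rfl
    have hchain : fderiv ℝ (Φ q t) x = (1 + B) * fderiv ℝ (Φ q s) x := by
      have e : Φ q t = Φ s t ∘ Φ q s := funext fun z => h.comp hq hqs hst htT z
      rw [e, fderiv_comp x ((h.contDiff_flow hs0 hst htT).differentiable one_ne_zero _)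
        ((h.contDiff_flow hq hqs (hst.trans htT)).differentiable one_ne_zero _), hB,
        add_sub_cancel]
      rfl
    have hdet : (fderiv ℝ (Φ q t) x).det = (1 + B).det * (fderiv ℝ (Φ q s) x).det := by
      rw [hchain]
      exact LinearMap.det_comp _ _
    have hGs : G t = G s + g := h.backG_add hq hqs hst htT x
    have hPt : P t - P s = P s * ((1 + B).det * Real.exp (-g) - 1) := by
      simp only [hP]
      rw [hdet, hGs, neg_add, Real.exp_add]
      ring
    have b1 : |((1 + B).det - 1 - traceCLM d B) * Real.exp (-g)| ≤
        (A * Q ^ 2) * Real.exp (M * T) * (t - s) ^ 2 := by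
      rw [abs_mul, Real.abs_exp]
      calc _ ≤ (A * (Q * (t - s)) ^ 2) * Real.exp (M * T) := by
            refine mul_le_mul ((hA B (hBn.trans (by gcongr))).trans (by gcongr)) (hexpb g hgT)
              (Real.exp_pos _).le (by positivity)
        _ = _ := by ring
    have htB : |traceCLM d B| ≤ trn * (Q * (t - s)) :=
      ((traceCLM d).le_opNorm B).trans (by gcongr)
    have b2 : |(1 + traceCLM d B) * (Real.exp (-g) - 1 - (-g))| ≤
        (1 + trn * (Q * T)) * (c * M ^ 2) * (t - s) ^ 2 := by
      rw [abs_mul]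
      have h1 : |1 + traceCLM d B| ≤ 1 + trn * (Q * T) := by
        refine (abs_add_le _ _).trans ?_
        rw [abs_one]
        have : trn * (Q * (t - s)) ≤ trn * (Q * T) := by gcongr
        linarith
      have h2 := abs_exp_sub_one_sub_le (c := M * T) (g := -g) ((abs_neg g).trans_le hgT)
      have h3 : (-g) ^ 2 ≤ (M * (t - s)) ^ 2 := by
        rw [neg_sq, ← sq_abs]; gcongr
      calc _ ≤ (1 + trn * (Q * T)) * (c * (M * (t - s)) ^ 2) := by
            refine mul_le_mul h1 (h2.trans ?_) (abs_nonneg _) (by positivity)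
            gcongr
        _ = _ := by ring
    have b3 : |traceCLM d (B - I)| ≤ trn * C * (t - s) ^ 2 := by
      rw [mul_assoc]
      exact ((traceCLM d).le_opNorm _).trans (by gcongr)
    have b4 : |traceCLM d B * g| ≤ trn * Q * M * (t - s) ^ 2 := by
      rw [abs_mul]
      calc _ ≤ (trn * (Q * (t - s))) * (M * (t - s)) :=
            mul_le_mul htB hgb (abs_nonneg _) (by positivity)
        _ = _ := by ring
    -- The first order parts, the trace of `I` from the determinant and `-g` from the exponential,
    -- cancel by `htr`; each remaining term is quadratic in the step.
    have e : (1 + B).det * Real.exp (-g) - 1 =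
        ((1 + B).det - 1 - traceCLM d B) * Real.exp (-g) +
        (1 + traceCLM d B) * (Real.exp (-g) - 1 - (-g)) + traceCLM d (B - I) -
        traceCLM d B * g := by
      rw [(traceCLM d).map_sub B, htr]; ring
    have b5 : |(1 + B).det * Real.exp (-g) - 1| ≤ E * (t - s) ^ 2 := by
      rw [e, hE, add_mul, add_mul, add_mul]
      rw [abs_le] at b1 b2 b3 b4 ⊢
      constructor <;> linarith [b1.1, b1.2, b2.1, b2.2, b3.1, b3.2, b4.1, b4.2]
    rw [hPt, abs_mul, zero_mul, add_zero, Real.rpow_two, mul_assoc]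
    exact mul_le_mul (hPb s hqs (hst.trans ht)) b5 (abs_nonneg _) (by positivity)
  have hfin := abs_sub_le_of_local (J := P) hqt (by positivity) (by norm_num) key
  rw [zero_mul, abs_nonpos_iff, sub_eq_zero] at hfin
  have hq0 : P q = 1 := by
    have e : Φ q q = id := by
      funext z
      rw [(h.flow q hqT z).2 q ⟨le_rfl, hqT.2⟩]; simp
    have e2 : G q = 0 := by simp [hG, backG]
    simp only [hP]
    rw [e2, e, fderiv_id]
    simp [ContinuousLinearMap.det]
  rw [hq0] at hfin
  simp only [hP] at hfin
  rw [Real.exp_neg, ← div_eq_mul_inv, div_eq_one_iff_eq (Real.exp_ne_zero _)] at hfin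
  exact hfin

/-- The derivative of the flow is bounded below. -/
theorem exp_le_norm_fderiv_flow (h : IsRegularFlow T γ f X Φ) (hd : 1 ≤ d) {M : ℝ}
    (hM : ∀ t x, |divergence (f t) x| ≤ M) {q t₀ : ℝ} (hq : 0 ≤ q) (hqt : q ≤ t₀)
    (ht₀ : t₀ ≤ T) (x : Vec d) : Real.exp (-(M * T)) ≤ ‖fderiv ℝ (Φ q t₀) x‖ := by
  have hM0 : 0 ≤ M := (abs_nonneg _).trans (hM 0 0)
  have hT : 0 ≤ T := hq.trans (hqt.trans ht₀)
  by_contra! hlt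
  have h1 := intervalIntegral.norm_integral_le_of_norm_le_const (a := q) (b := t₀)
    (f := fun r => divergence (f r) (Φ q r x)) (C := M) fun r _ => hM r _
  rw [abs_of_nonneg (sub_nonneg.2 hqt)] at h1
  have h2 : |backG f Φ t₀ q x| ≤ M * T := h1.trans (by gcongr; linarith)
  have h3 : Real.exp (-(M * T)) ≤ Real.exp (backG f Φ t₀ q x) :=
    Real.exp_le_exp.2 (neg_le_of_abs_le h2)
  rw [← h.det_fderiv_flow hq hqt ht₀] at h3
  have h4 := h3.trans ((le_abs_self _).trans (abs_det_le_norm_pow _))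
  -- If the norm were below the claimed bound it would be at most `1`, hence its `d`-th power at
  -- most itself (here `d ≥ 1` matters), contradicting the lower bound on the determinant.
  have h5 : ‖fderiv ℝ (Φ q t₀) x‖ ≤ 1 := hlt.le.trans (Real.exp_le_one_iff.2 (by
    have := mul_nonneg hM0 hT; linarith))
  have h6 := pow_le_of_le_one (norm_nonneg _) h5 (n := d) (by omega)
  linarith

end IsRegularFlow

/-! ### Bounded slices and pairings -/

/-- `w` is measurable and bounded by `U` almost everywhere. -/
structure IsBddSlice {d : ℕ} (U : ℝ) (w : Vec d → ℝ) : Prop where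
  meas : AEStronglyMeasurable w volume
  bound : ∀ᵐ x, |w x| ≤ U

/-- The volume of a ball of radius `R`. -/
def ballVolume (d : ℕ) (R : ℝ) : ℝ := volume.real (Metric.closedBall (0 : Vec d) R)

theorem ballVolume_nonneg (d : ℕ) (R : ℝ) : 0 ≤ ballVolume d R := measureReal_nonneg

/-- Bounded measurable functions supported in a ball. -/
structure IsBddSupported {d : ℕ} (c R : ℝ) (φ : Vec d → ℝ) : Prop where
  meas : AEStronglyMeasurable φ volume
  bound : ∀ᵐ x, |φ x| ≤ c
  support : ∀ x, R < ‖x‖ → φ x = 0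

namespace IsBddSupported

variable {d : ℕ} {c R : ℝ} {φ : Vec d → ℝ}

theorem of_continuous (hφ : Continuous φ) (hc : ∀ x, |φ x| ≤ c) (hs : ∀ x, R < ‖x‖ → φ x = 0) :
    IsBddSupported c R φ := ⟨hφ.aestronglyMeasurable, .of_forall hc, hs⟩

theorem integrable (h : IsBddSupported c R φ) : Integrable φ := by
  rw [← integrableOn_iff_integrable_of_support_subset (s := Metric.closedBall 0 R)]
  · exact Measure.integrableOn_of_bounded measure_closedBall_lt_top.ne h.meas
      (ae_restrict_of_ae h.bound)
  · intro x hx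
    by_contra hn
    exact hx (h.support x (by simpa using hn))

theorem integral_abs_le (h : IsBddSupported c R φ) :
    ∫ x, |φ x| ≤ c * ballVolume d R := by
  have e : ∫ x, |φ x| = ∫ x in Metric.closedBall 0 R, |φ x| := by
    rw [setIntegral_eq_integral_of_forall_compl_eq_zero]
    intro x hx
    rw [h.support x (by simpa using hx), abs_zero]
  rw [e]
  have h2 : ∫ x in Metric.closedBall 0 R, |φ x| ≤ ∫ x in Metric.closedBall (0 : Vec d) R, c :=
    integral_mono_ae h.integrable.abs.integrableOn
      (integrableOn_const measure_closedBall_lt_top.ne) (ae_restrict_of_ae h.bound)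
  refine h2.trans (le_of_eq ?_)
  rw [setIntegral_const, smul_eq_mul, mul_comm]
  rfl

end IsBddSupported

namespace IsBddSlice

variable {d : ℕ} {U c R : ℝ} {w φ φ' : Vec d → ℝ}

theorem integrable_mul (h : IsBddSlice U w) (hφ : Integrable φ) :
    Integrable fun x => w x * φ x := hφ.bdd_mul h.meas h.bound

theorem nonneg (h : IsBddSlice U w) : 0 ≤ U := by
  obtain ⟨x, hx⟩ := h.bound.exists
  exact (abs_nonneg _).trans hx

theorem pair_add (h : IsBddSlice U w) (hφ : Integrable φ) (hφ' : Integrable φ') :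
    pair w (fun x => φ x + φ' x) = pair w φ + pair w φ' := by
  unfold pair
  rw [← integral_add (h.integrable_mul hφ) (h.integrable_mul hφ')]
  exact integral_congr_ae (.of_forall fun x => mul_add _ _ _)

theorem pair_sub (h : IsBddSlice U w) (hφ : Integrable φ) (hφ' : Integrable φ') :
    pair w (fun x => φ x - φ' x) = pair w φ - pair w φ' := by
  unfold pair
  rw [← integral_sub (h.integrable_mul hφ) (h.integrable_mul hφ')]
  exact integral_congr_ae (.of_forall fun x => mul_sub _ _ _)

theorem abs_pair_le_integral (h : IsBddSlice U w) (hφ : Integrable φ) :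
    |pair w φ| ≤ U * ∫ x, |φ x| := by
  unfold pair
  rw [← integral_const_mul]
  refine (abs_integral_le_integral_abs).trans (integral_mono_ae (h.integrable_mul hφ).abs
    (hφ.abs.const_mul U) ?_)
  filter_upwards [h.bound] with x hx
  simp only [abs_mul]
  gcongr

theorem abs_pair_le (h : IsBddSlice U w) (hφ : IsBddSupported c R φ) :
    |pair w φ| ≤ U * (c * ballVolume d R) :=
  (h.abs_pair_le_integral hφ.integrable).trans
    (mul_le_mul_of_nonneg_left hφ.integral_abs_le h.nonneg)

end IsBddSlice

theorem pair_const_mul {d : ℕ} (w φ : Vec d → ℝ) (a : ℝ) :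
    pair w (fun x => a * φ x) = a * pair w φ := by
  unfold pair
  rw [← integral_const_mul]
  exact integral_congr_ae (.of_forall fun x => mul_left_comm _ _ _)

/-! ### Integrability on the slab -/

theorem ae_mem_slab (d : ℕ) (T : ℝ) : ∀ᵐ p ∂(slab d T), p.1 ∈ Icc 0 T :=
  Measure.quasiMeasurePreserving_fst.ae (ae_restrict_mem measurableSet_Icc)

theorem integrable_slab {d : ℕ} {T c R : ℝ} {H : ℝ × Vec d → ℝ}
    (hm : AEStronglyMeasurable H (slab d T)) (hb : ∀ᵐ p ∂(slab d T), |H p| ≤ c)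
    (hs : ∀ᵐ p ∂(slab d T), R < ‖p.2‖ → H p = 0) : Integrable H (slab d T) := by
  have hS : MeasurableSet ((univ : Set ℝ) ×ˢ Metric.closedBall (0 : Vec d) R) :=
    MeasurableSet.univ.prod Metric.isClosed_closedBall.measurableSet
  have hi : Integrable (((univ : Set ℝ) ×ˢ Metric.closedBall (0 : Vec d) R).indicator
      fun _ => c) (slab d T) := by
    rw [integrable_indicator_iff hS]
    refine integrableOn_const ?_
    rw [slab, Measure.prod_prod]
    exact ENNReal.mul_ne_top (by simp) measure_closedBall_lt_top.ne
  refine hi.mono' hm ?_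
  filter_upwards [hb, hs] with p h1 h2
  by_cases hp : ‖p.2‖ ≤ R
  · rwa [indicator_of_mem (by simpa using hp)]
  · rw [indicator_of_notMem (by simpa using hp), h2 (not_le.1 hp), norm_zero]

theorem intervalIntegrable_integral_slab {d : ℕ} {T : ℝ} {H : ℝ × Vec d → ℝ}
    (h : Integrable H (slab d T)) {s t : ℝ} (hs : s ∈ Icc 0 T) (ht : t ∈ Icc 0 T) :
    IntervalIntegrable (fun r => ∫ x, H (r, x)) volume s t := by
  have := h.integral_prod_left
  rw [intervalIntegrable_iff']
  exact IntegrableOn.mono_set (t := Icc 0 T) this (uIcc_subset_Icc hs ht)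

theorem slab_mono (d : ℕ) {T T' : ℝ} (h : T' ≤ T) : slab d T' ≤ slab d T :=
  Measure.prod_mono (Measure.restrict_mono (Icc_subset_Icc_right h) le_rfl) le_rfl

/-! ### Boundedness of all time slices of a solution -/

section Slices

variable {d : ℕ} {T γ : ℝ} {X : ℝ → Vec d} {XX : ℝ → ℝ → Matrix (Fin d) (Fin d) ℝ}
  {b : ℝ → Vec d → Vec d} {divb : ℝ → Vec d → ℝ} {u0 : Vec d → ℝ} {u : ℝ → Vec d → ℝ}

/-- The `L^∞` norm on the slab as a real number. -/
def supNorm (d : ℕ) (T : ℝ) (u : ℝ → Vec d → ℝ) : ℝ :=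
  (eLpNorm (Function.uncurry u) ∞ (slab d T)).toReal

theorem ae_abs_le_supNorm (h : MemLp (Function.uncurry u) ∞ (slab d T)) :
    ∀ᵐ p ∂(slab d T), |u p.1 p.2| ≤ supNorm d T u := by
  have h1 : ∀ᵐ p ∂(slab d T), ‖Function.uncurry u p‖ₑ ≤ eLpNorm (Function.uncurry u) ∞ (slab d T) := by
    rw [eLpNorm_exponent_top]
    exact ae_le_eLpNormEssSup
  filter_upwards [h1] with p hp
  have := ENNReal.toReal_mono h.eLpNorm_ne_top hp
  simpa [Function.uncurry, supNorm] using this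

theorem IsWeakControlledSolution.ae_isBddSlice
    (h : IsWeakControlledSolution T γ X XX b divb u0 u) :
    ∀ᵐ t ∂(volume.restrict (Icc 0 T)), ∀ᵐ x, |u t x| ≤ supNorm d T u :=
  Measure.ae_ae_of_ae_prod (ae_abs_le_supNorm h.mem)

/-- The bound holds for almost every time and extends by continuity of `t ↦ u_t(φ)`. Taking the
maximum with `c` rewrites the inequality as an equality of continuous functions. -/
theorem IsWeakControlledSolution.abs_pair_le (h : IsWeakControlledSolution T γ X XX b divb u0 u)
    (hT : 0 < T) (hγ : 0 < γ) {φ : Vec d → ℝ} (hφ : IsTest φ) {t : ℝ} (ht : t ∈ Icc 0 T) :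
    |pair (u t) φ| ≤ supNorm d T u * ∫ x, |φ x| := by
  set c := supNorm d T u * ∫ x, |φ x|
  have hi : Integrable φ := hφ.1.continuous.integrable_of_hasCompactSupport hφ.2
  have hcont : ContinuousOn (fun t => pair (u t) φ) (Icc 0 T) :=
    (h.controlled φ hφ).holder.continuousOn hγ
  have key : EqOn (fun t => max |pair (u t) φ| c) (fun _ => c) (Icc 0 T) := by
    refine Measure.eqOn_Icc_of_ae_eq volume hT.ne ?_
      (hcont.abs.sup continuousOn_const) continuousOn_const
    filter_upwards [h.ae_isBddSlice, ae_restrict_mem measurableSet_Icc] with r hr hrm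
    exact max_eq_right (IsBddSlice.abs_pair_le_integral
      ⟨(h.slice r hrm).aestronglyMeasurable, hr⟩ hi)
  exact max_eq_right_iff.1 (key ht)

/-- Testing with normalised bumps of mass one shrinking to a Lebesgue point of `u t` bounds its
value there. So the essential bound holds at every time, not only at almost every time. -/
theorem IsWeakControlledSolution.isBddSlice (h : IsWeakControlledSolution T γ X XX b divb u0 u)
    (hT : 0 < T) (hγ : 0 < γ) {t : ℝ} (ht : t ∈ Icc 0 T) : IsBddSlice (supNorm d T u) (u t) := by
  refine ⟨(h.slice t ht).aestronglyMeasurable, ?_⟩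
  let φ : ℕ → ContDiffBump (0 : Vec d) := fun n =>
    ⟨1 / ((n : ℝ) + 1), 2 * (1 / ((n : ℝ) + 1)), by positivity, by
      have : 0 < 1 / ((n : ℝ) + 1) := by positivity
      linarith⟩
  have hφ : Tendsto (fun n => (φ n).rOut) atTop (𝓝 0) := by
    have := tendsto_one_div_add_atTop_nhds_zero_nat.const_mul (2 : ℝ)
    simpa [φ] using this
  have := ContDiffBump.ae_convolution_tendsto_right_of_locallyIntegrable (μ := volume) (K := 2) hφ
    (.of_forall fun n => le_rfl) (h.slice t ht)
  filter_upwards [this] with x hx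
  refine le_of_tendsto hx.abs (.of_forall fun n => ?_)
  rw [convolution_eq_swap]
  have htest : IsTest fun y => (φ n).normed volume (x - y) :=
    ⟨(φ n).contDiff_normed.comp (contDiff_const.sub contDiff_id),
      (φ n).hasCompactSupport_normed.comp_homeomorph (Homeomorph.subLeft x)⟩
  have h1 := h.abs_pair_le hT hγ htest ht
  have h2 : ∫ y, |(φ n).normed volume (x - y)| = 1 := by
    rw [← (φ n).integral_normed (μ := volume),
      ← integral_sub_left_eq_self (fun y => (φ n).normed volume y) volume x]
    exact integral_congr_ae (.of_forall fun y => abs_of_nonneg ((φ n).nonneg_normed _))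
  rw [h2, mul_one] at h1
  refine le_trans (le_of_eq ?_) h1
  congr 1
  exact integral_congr_ae (.of_forall fun y => mul_comm _ _)

end Slices

/-! ### Mollification -/

/-- Convolution with `k` of the restriction of `g` to a ball. -/
def mollify {d : ℕ} (B : ℝ) (k g : Vec d → ℝ) (x : Vec d) : ℝ :=
  ∫ y in Metric.closedBall (0 : Vec d) B, g y * k (x - y)

section Mollify

variable {d : ℕ} {B B' c c' κ R ε : ℝ} {k k' g g' : Vec d → ℝ}

theorem IsBddSlice.integrableOn (hg : IsBddSlice c g) (B : ℝ) :
    IntegrableOn g (Metric.closedBall 0 B) :=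
  Measure.integrableOn_of_bounded measure_closedBall_lt_top.ne hg.meas (ae_restrict_of_ae hg.bound)

theorem IsBddSlice.integrableOn_mul (hg : IsBddSlice c g) (hk : Continuous k) (B : ℝ) (x : Vec d) :
    IntegrableOn (fun y => g y * k (x - y)) (Metric.closedBall 0 B) := by
  obtain ⟨C, hC⟩ := (isCompact_closedBall (0 : Vec d) B).exists_bound_of_continuousOn
    (f := fun y => k (x - y)) (hk.comp (continuous_const.sub continuous_id)).continuousOn
  refine Integrable.mul_bdd (c := C) (hg.integrableOn B)
    (hk.comp (continuous_const.sub continuous_id)).aestronglyMeasurable ?_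
  filter_upwards [ae_restrict_mem Metric.isClosed_closedBall.measurableSet] with y hy using hC y hy

theorem mollify_eq_convolution (B : ℝ) (k g : Vec d → ℝ) :
    mollify B k g = MeasureTheory.convolution ((Metric.closedBall (0 : Vec d) B).indicator g) k
      (ContinuousLinearMap.mul ℝ ℝ) volume := by
  funext x
  rw [mollify, ← integral_indicator Metric.isClosed_closedBall.measurableSet, convolution_def]
  refine integral_congr_ae (.of_forall fun y => ?_)
  by_cases hy : y ∈ Metric.closedBall (0 : Vec d) B <;> simp [hy]

theorem IsBddSlice.locallyIntegrable_indicator (hg : IsBddSlice c g) (B : ℝ) :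
    LocallyIntegrable ((Metric.closedBall (0 : Vec d) B).indicator g) :=
  ((integrable_indicator_iff Metric.isClosed_closedBall.measurableSet).2
    (hg.integrableOn B)).locallyIntegrable

theorem mollify_eq_zero (hk : ∀ z, ε < ‖z‖ → k z = 0) {x : Vec d} (hx : B + ε < ‖x‖) :
    mollify B k g x = 0 := by
  rw [mollify]
  refine setIntegral_eq_zero_of_forall_eq_zero fun y hy => ?_
  rw [hk, mul_zero]
  have h1 := mem_closedBall_zero_iff.1 hy
  have h2 := norm_sub_norm_le x y
  linarith

theorem isTest_of_support (hk : ContDiff ℝ ∞ k) (h : ∀ z, ε < ‖z‖ → k z = 0) : IsTest k :=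
  ⟨hk, HasCompactSupport.intro (isCompact_closedBall 0 ε) fun x hx => h x (by simpa using hx)⟩

theorem mollify_isTest (hk : IsTest k) (hε : ∀ z, ε < ‖z‖ → k z = 0) (hg : IsBddSlice c g) :
    IsTest (mollify B k g) := by
  refine isTest_of_support (ε := B + ε) ?_ fun z hz => mollify_eq_zero hε hz
  rw [mollify_eq_convolution]
  exact hk.2.contDiff_convolution_right (n := ⊤) _ (hg.locallyIntegrable_indicator B) hk.1

theorem fderiv_mollify (hk : IsTest k) (hg : IsBddSlice c g) (x v : Vec d) :
    fderiv ℝ (mollify B k g) x v = mollify B (fun z => fderiv ℝ k z v) g x := by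
  have h1 : ContDiff ℝ 1 k := hk.1.of_le (by exact_mod_cast le_top)
  rw [mollify_eq_convolution, mollify_eq_convolution, (hk.2.hasFDerivAt_convolution_right _
    (hg.locallyIntegrable_indicator B) h1 x).fderiv]
  exact convolution_precompR_apply _ (hg.locallyIntegrable_indicator B) (hk.2.fderiv ℝ)
    (h1.continuous_fderiv one_ne_zero) x v

theorem pd_mollify (hk : IsTest k) (hg : IsBddSlice c g) (i : Fin d) :
    pd i (mollify B k g) = mollify B (pd i k) g :=
  funext fun x => fderiv_mollify hk hg x _

theorem IsTest.pd (hk : IsTest k) (i : Fin d) : IsTest (RoughTransport.pd i k) :=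
  ⟨(hk.1.fderiv_right (m := ∞) (by simp)).clm_apply contDiff_const,
    (hk.2.fderiv ℝ).comp_left (g := fun A : Vec d →L[ℝ] ℝ => A (EuclideanSpace.single i 1)) (by simp)⟩

theorem fderiv_eq_zero_of_norm_lt (h : ∀ z, ε < ‖z‖ → k z = 0) {z : Vec d} (hz : ε < ‖z‖) :
    fderiv ℝ k z = 0 := by
  have : k =ᶠ[𝓝 z] fun _ => 0 := by
    filter_upwards [(isOpen_lt continuous_const continuous_norm).mem_nhds hz] with y hy using h y hy
  rw [this.fderiv_eq]
  simp

theorem pd_eq_zero_of_norm_lt (h : ∀ z, ε < ‖z‖ → k z = 0) (i : Fin d) :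
    ∀ z, ε < ‖z‖ → RoughTransport.pd i k z = 0 := fun z hz => by
  rw [RoughTransport.pd, fderiv_eq_zero_of_norm_lt h hz]; rfl

theorem IsTest.exists_bound (hk : IsTest k) : ∃ κ, 0 ≤ κ ∧ ∀ z, |k z| ≤ κ := by
  obtain ⟨C, hC⟩ := hk.2.exists_bound_of_continuous hk.1.continuous
  exact ⟨C, (norm_nonneg _).trans (hC 0), hC⟩

theorem abs_mollify_le (hκ : ∀ z, |k z| ≤ κ) (hg : IsBddSlice c g) (x : Vec d) :
    |mollify B k g x| ≤ c * κ * ballVolume d B := by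
  have hκ0 : 0 ≤ κ := (abs_nonneg _).trans (hκ 0)
  have h : ∀ᵐ y, y ∈ Metric.closedBall (0 : Vec d) B → ‖g y * k (x - y)‖ ≤ c * κ := by
    filter_upwards [hg.bound] with y hy _
    rw [norm_mul]
    exact mul_le_mul hy (hκ _) (norm_nonneg _) hg.nonneg
  exact norm_setIntegral_le_of_norm_le_const_ae' measure_closedBall_lt_top h

theorem IsBddSlice.sub (hg : IsBddSlice c g) (hg' : IsBddSlice c' g') :
    IsBddSlice (c + c') fun x => g x - g' x := by
  refine ⟨hg.meas.sub hg'.meas, ?_⟩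
  filter_upwards [hg.bound, hg'.bound] with x h1 h2 using (abs_sub _ _).trans (add_le_add h1 h2)

theorem IsBddSlice.of_continuous (hg : Continuous g) (h : ∀ x, |g x| ≤ c) : IsBddSlice c g :=
  ⟨hg.aestronglyMeasurable, .of_forall h⟩

theorem mollify_add (hk : Continuous k) (hg : IsBddSlice c g) (hg' : IsBddSlice c' g') :
    mollify B k (fun x => g x + g' x) = fun x => mollify B k g x + mollify B k g' x := by
  funext x
  unfold mollify
  rw [← integral_add (hg.integrableOn_mul hk B x) (hg'.integrableOn_mul hk B x)]
  exact integral_congr_ae (.of_forall fun y => add_mul _ _ _)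

theorem mollify_sub (hk : Continuous k) (hg : IsBddSlice c g) (hg' : IsBddSlice c' g') :
    mollify B k (fun x => g x - g' x) = fun x => mollify B k g x - mollify B k g' x := by
  funext x
  unfold mollify
  rw [← integral_sub (hg.integrableOn_mul hk B x) (hg'.integrableOn_mul hk B x)]
  exact integral_congr_ae (.of_forall fun y => sub_mul _ _ _)

theorem mollify_const_mul (a : ℝ) :
    mollify B k (fun x => a * g x) = fun x => a * mollify B k g x := by
  funext x
  unfold mollify
  rw [← integral_const_mul]
  exact integral_congr_ae (.of_forall fun y => mul_assoc _ _ _)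

theorem mollify_kernel_sub (hk : Continuous k) (hk' : Continuous k') (hg : IsBddSlice c g)
    (x : Vec d) : mollify B (fun z => k z - k' z) g x = mollify B k g x - mollify B k' g x := by
  unfold mollify
  rw [← integral_sub (hg.integrableOn_mul hk B x) (hg.integrableOn_mul hk' B x)]
  exact integral_congr_ae (.of_forall fun y => mul_sub _ _ _)

theorem mollify_kernel_const_mul (a : ℝ) (x : Vec d) :
    mollify B (fun z => a * k z) g x = a * mollify B k g x := by
  unfold mollify
  rw [← integral_const_mul]
  exact integral_congr_ae (.of_forall fun y => mul_left_comm _ _ _)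

theorem mollify_eq_integral (hg : ∀ y, B < ‖y‖ → g y = 0) (x : Vec d) :
    mollify B k g x = ∫ y, g y * k (x - y) := by
  rw [mollify, setIntegral_eq_integral_of_forall_compl_eq_zero]
  intro y hy
  rw [hg y (by simpa using hy), zero_mul]

theorem mollify_comm (hg : ∀ y, B < ‖y‖ → g y = 0) (hk : ∀ y, B' < ‖y‖ → k y = 0) :
    mollify B k g = mollify B' g k := by
  funext x
  rw [mollify_eq_integral hg, mollify_eq_integral hk, ← integral_sub_left_eq_self _ volume x]
  refine integral_congr_ae (.of_forall fun y => ?_)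
  simp only [sub_sub_cancel]
  exact mul_comm _ _

/-- The cut-off at radius `B` is invisible as long as the translated support still fits in the ball;
this dictates the choice of `B` in the duality argument. -/
theorem mollify_translate (hg : ∀ y, R < ‖y‖ → g y = 0) {v : Vec d} (hR : R + ‖v‖ ≤ B) (x : Vec d) :
    mollify B k g (x + v) = mollify B k (fun y => g (y + v)) x := by
  have hR' : R ≤ B := by linarith [norm_nonneg v]
  rw [mollify_eq_integral fun y hy => hg y (hR'.trans_lt hy), mollify_eq_integral,
    ← integral_add_right_eq_self _ v]
  · simp only [add_sub_add_right_eq_sub]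
  · intro y hy
    refine hg _ ?_
    have := norm_sub_le (y + v) v
    rw [add_sub_cancel_right] at this
    linarith

end Mollify

/-- A nonnegative smooth kernel of mass one supported in a ball of radius `ε`. -/
structure IsMollifier {d : ℕ} (ε : ℝ) (ρ : Vec d → ℝ) : Prop where
  test : IsTest ρ
  nonneg : ∀ z, 0 ≤ ρ z
  mass : ∫ z, ρ z = 1
  support : ∀ z, ε < ‖z‖ → ρ z = 0

theorem exists_isMollifier (d : ℕ) {ε : ℝ} (hε : 0 < ε) : ∃ ρ : Vec d → ℝ, IsMollifier ε ρ := by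
  let φ : ContDiffBump (0 : Vec d) := ⟨ε / 2, ε, by positivity, by linarith⟩
  refine ⟨φ.normed volume, ⟨φ.contDiff_normed, φ.hasCompactSupport_normed⟩, φ.nonneg_normed,
    φ.integral_normed, fun z hz => ?_⟩
  by_contra h
  have : z ∈ Function.support (φ.normed volume) := h
  rw [φ.support_normed_eq] at this
  exact absurd (mem_ball_zero_iff.1 this) (not_lt.2 hz.le)

section Approx

variable {d : ℕ} {B R ε ℓ : ℝ} {ρ g : Vec d → ℝ}

theorem IsMollifier.abs_mollify_sub_le (hρ : IsMollifier ε ρ) (hg : Continuous g)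
    (hs : ∀ y, B < ‖y‖ → g y = 0) (hl : ∀ x y, |g x - g y| ≤ ℓ * ‖x - y‖) (hℓ : 0 ≤ ℓ)
    (x : Vec d) : |mollify B ρ g x - g x| ≤ ℓ * ε := by
  have hi : Integrable ρ := hρ.test.1.continuous.integrable_of_hasCompactSupport hρ.test.2
  have hi2 : Integrable fun z => ρ z * g (x - z) :=
    (hρ.test.1.continuous.mul (hg.comp (continuous_const.sub continuous_id))).integrable_of_hasCompactSupport
      hρ.test.2.mul_right
  have e : mollify B ρ g x - g x = ∫ z, ρ z * (g (x - z) - g x) := by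
    simp only [mul_sub]
    rw [mollify_comm hs hρ.support, mollify_eq_integral hρ.support, integral_sub hi2
      (hi.mul_const _), integral_mul_const, hρ.mass, one_mul]
  have h2 : ∫ z, ρ z * (ℓ * ε) = ℓ * ε := by rw [integral_mul_const, hρ.mass, one_mul]
  rw [e, ← h2, ← Real.norm_eq_abs]
  refine norm_integral_le_of_norm_le (hi.mul_const _) (.of_forall fun z => ?_)
  rw [norm_mul, Real.norm_of_nonneg (hρ.nonneg z)]
  rcases le_or_gt ‖z‖ ε with hz | hz
  · refine mul_le_mul_of_nonneg_left ((hl _ _).trans ?_) (hρ.nonneg z)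
    rw [sub_sub_cancel_left, norm_neg]
    gcongr
  · rw [hρ.support z hz]; simp

/-- Exchanging the roles of kernel and function moves the derivative onto `g`, which keeps the
bounds independent of the kernel. -/
theorem IsMollifier.fderiv_mollify_apply (hρ : IsMollifier ε ρ) (hg : IsTest g)
    (hs : ∀ y, B < ‖y‖ → g y = 0) (x v : Vec d) :
    fderiv ℝ (mollify B ρ g) x v = mollify B ρ (fun z => fderiv ℝ g z v) x := by
  obtain ⟨κ, -, hκ⟩ := hρ.test.exists_bound
  rw [mollify_comm hs hρ.support, fderiv_mollify hg
    (IsBddSlice.of_continuous hρ.test.1.continuous hκ), mollify_comm hρ.support]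
  intro y hy
  rw [fderiv_eq_zero_of_norm_lt hs hy]
  rfl

end Approx

/-! ### Transport terms -/

/-- Measurable vector fields with a zeroth order coefficient, bounded by `Λ` on a ball. -/
structure IsLocBddField {d : ℕ} (T R Λ : ℝ) (b : ℝ → Vec d → Vec d) (c : ℝ → Vec d → ℝ) : Prop where
  meas : AEStronglyMeasurable (Function.uncurry b) (slab d T)
  meas_coeff : AEStronglyMeasurable (Function.uncurry c) (slab d T)
  nonneg : 0 ≤ Λ
  bound : ∀ᵐ p ∂(slab d T), ‖p.2‖ ≤ R → ‖b p.1 p.2‖ ≤ Λ ∧ |c p.1 p.2| ≤ Λ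

/-- Time slices of `IsLocBddField`. -/
structure IsLocBddSlice {d : ℕ} (R Λ : ℝ) (v : Vec d → Vec d) (c : Vec d → ℝ) : Prop where
  meas : AEStronglyMeasurable v volume
  meas_coeff : AEStronglyMeasurable c volume
  nonneg : 0 ≤ Λ
  bound : ∀ᵐ x, ‖x‖ ≤ R → ‖v x‖ ≤ Λ ∧ |c x| ≤ Λ

/-- `C^1` functions bounded with their derivative by `a` and supported in a ball. -/
structure IsC1Supported {d : ℕ} (a R : ℝ) (φ : Vec d → ℝ) : Prop where
  contDiff : ContDiff ℝ 1 φ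
  bound : ∀ x, |φ x| ≤ a
  fderiv_bound : ∀ x, ‖fderiv ℝ φ x‖ ≤ a
  support : ∀ x, R < ‖x‖ → φ x = 0

/-- The first order operator `v · ∇φ + c φ`. -/
def transport {d : ℕ} (v : Vec d → Vec d) (c : Vec d → ℝ) (φ : Vec d → ℝ) (x : Vec d) : ℝ :=
  fderiv ℝ φ x (v x) + c x * φ x

section Transport

variable {d : ℕ} {T R Λ a a' U : ℝ} {b : ℝ → Vec d → Vec d} {c : ℝ → Vec d → ℝ}
  {v : Vec d → Vec d} {e : Vec d → ℝ} {φ φ' : Vec d → ℝ}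

theorem IsLocBddField.ae_slice (h : IsLocBddField T R Λ b c) :
    ∀ᵐ r ∂(volume.restrict (Icc 0 T)), IsLocBddSlice R Λ (b r) (c r) := by
  filter_upwards [h.meas.prodMk_left, h.meas_coeff.prodMk_left, Measure.ae_ae_of_ae_prod h.bound]
    with r h1 h2 h3 using ⟨h1, h2, h.nonneg, h3⟩

theorem IsC1Supported.nonneg (h : IsC1Supported a R φ) : 0 ≤ a := (abs_nonneg _).trans (h.bound 0)

theorem transport_eq_zero (hφ : IsC1Supported a R φ) {x : Vec d} (hx : R < ‖x‖) :
    transport v e φ x = 0 := by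
  simp [transport, fderiv_eq_zero_of_norm_lt hφ.support hx, hφ.support x hx]

theorem abs_transport_le (hΛ : 0 ≤ Λ) (hφ : IsC1Supported a R φ) {x : Vec d}
    (hx : ‖x‖ ≤ R → ‖v x‖ ≤ Λ ∧ |e x| ≤ Λ) : |transport v e φ x| ≤ 2 * Λ * a := by
  have ha := hφ.nonneg
  rcases le_or_gt ‖x‖ R with hR | hR
  · obtain ⟨h1, h2⟩ := hx hR
    have e1 : |fderiv ℝ φ x (v x)| ≤ a * Λ :=
      ((fderiv ℝ φ x).le_opNorm _).trans (mul_le_mul (hφ.fderiv_bound x) h1 (norm_nonneg _) ha)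
    have e2 : |e x * φ x| ≤ Λ * a := by
      rw [abs_mul]; exact mul_le_mul h2 (hφ.bound x) (abs_nonneg _) hΛ
    refine (abs_add_le _ _).trans ?_
    linarith
  · rw [transport_eq_zero hφ hR, abs_zero]
    positivity

theorem IsLocBddSlice.isBddSupported (h : IsLocBddSlice R Λ v e) (hφ : IsC1Supported a R φ) :
    IsBddSupported (2 * Λ * a) R (transport v e φ) := by
  refine ⟨?_, ?_, fun x hx => transport_eq_zero hφ hx⟩
  · exact (isBoundedBilinearMap_apply.continuous.comp_aestronglyMeasurable
      ((hφ.contDiff.continuous_fderiv one_ne_zero).aestronglyMeasurable.prodMk h.meas)).add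
      (h.meas_coeff.mul hφ.contDiff.continuous.aestronglyMeasurable)
  · filter_upwards [h.bound] with x hx using abs_transport_le h.nonneg hφ hx

theorem transport_sub (hφ : ContDiff ℝ 1 φ) (hφ' : ContDiff ℝ 1 φ') :
    transport v e (fun x => φ x - φ' x) = fun x => transport v e φ x - transport v e φ' x := by
  funext x
  unfold transport
  rw [fderiv_fun_sub (hφ.differentiable one_ne_zero x) (hφ'.differentiable one_ne_zero x)]
  simp
  ring

theorem transport_add (hφ : ContDiff ℝ 1 φ) (hφ' : ContDiff ℝ 1 φ') :
    transport v e (fun x => φ x + φ' x) = fun x => transport v e φ x + transport v e φ' x := by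
  funext x
  unfold transport
  rw [fderiv_fun_add (hφ.differentiable one_ne_zero x) (hφ'.differentiable one_ne_zero x)]
  simp
  ring

theorem transport_const_mul (α : ℝ) (hφ : ContDiff ℝ 1 φ) :
    transport v e (fun x => α * φ x) = fun x => α * transport v e φ x := by
  funext x
  unfold transport
  rw [fderiv_const_mul (hφ.differentiable one_ne_zero x)]
  simp
  ring

theorem integrable_transport {ψ : ℝ → Vec d → ℝ} (h : IsLocBddField T R Λ b c) {u : ℝ → Vec d → ℝ}
    (hu : MemLp (Function.uncurry u) ∞ (slab d T))
    (hψ : ∀ r ∈ Icc 0 T, IsC1Supported a R (ψ r))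
    (hm : AEStronglyMeasurable (Function.uncurry ψ) (slab d T))
    (hm' : AEStronglyMeasurable (fun p : ℝ × Vec d => fderiv ℝ (ψ p.1) p.2) (slab d T)) :
    Integrable (fun p : ℝ × Vec d => u p.1 p.2 * transport (b p.1) (c p.1) (ψ p.1) p.2)
      (slab d T) := by
  refine integrable_slab (c := supNorm d T u * (2 * Λ * a)) (R := R) ?_ ?_ ?_
  · exact hu.1.mul ((isBoundedBilinearMap_apply.continuous.comp_aestronglyMeasurable
      (hm'.prodMk h.meas)).add (h.meas_coeff.mul hm))
  · filter_upwards [ae_abs_le_supNorm hu, h.bound, ae_mem_slab d T] with p h1 h2 h3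
    rw [abs_mul]
    exact mul_le_mul h1 (abs_transport_le h.nonneg (hψ _ h3) h2) (abs_nonneg _)
      ENNReal.toReal_nonneg
  · filter_upwards [ae_mem_slab d T] with p h3 hp
    rw [transport_eq_zero (hψ _ h3) hp, mul_zero]

theorem IsLinDrift.exists_isLocBddField {divb : ℝ → Vec d → ℝ} (h : IsLinDrift T b divb) (R : ℝ) :
    ∃ Λ, IsLocBddField T R Λ b divb := by
  obtain ⟨L, hL⟩ := h.growth
  refine ⟨max (|L| * (1 + |R|)) (supNorm d T divb), h.meas, h.div_mem.1,
    le_max_of_le_left (by positivity), ?_⟩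
  filter_upwards [hL, ae_abs_le_supNorm h.div_mem] with p h1 h2 hp
  refine ⟨h1.trans (le_max_of_le_left ?_), h2.trans (le_max_right _ _)⟩
  have : L * (1 + ‖p.2‖) ≤ |L| * (1 + ‖p.2‖) := by gcongr; exact le_abs_self L
  refine this.trans ?_
  gcongr
  exact hp.trans (le_abs_self R)

theorem IsBddFamily.exists_isLocBddField {f : ℝ → Vec d → Vec d} (h : IsBddFamily f) (T R : ℝ) :
    ∃ Λ, IsLocBddField T R Λ f fun r => RoughTransport.divergence (f r) := by
  obtain ⟨N, hN⟩ := h.exists_bound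
  obtain ⟨M, hM⟩ := h.divergence.exists_bound
  exact ⟨max N M, h.stronglyMeasurable_uncurry.aestronglyMeasurable,
    h.divergence.stronglyMeasurable_uncurry.aestronglyMeasurable,
    le_max_of_le_left ((norm_nonneg _).trans (hN 0 0)), .of_forall fun p _ =>
      ⟨(hN _ _).trans (le_max_left _ _), (hM _ _).trans (le_max_right _ _)⟩⟩

theorem IsLocBddField.mono {T' : ℝ} (h : IsLocBddField T R Λ b c) (hT : T' ≤ T) :
    IsLocBddField T' R Λ b c :=
  ⟨h.meas.mono_measure (slab_mono d hT), h.meas_coeff.mono_measure (slab_mono d hT), h.nonneg,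
    ae_mono (slab_mono d hT) h.bound⟩

theorem IsLocBddField.sub {Λ' : ℝ} {b' : ℝ → Vec d → Vec d} {c' : ℝ → Vec d → ℝ}
    (h : IsLocBddField T R Λ b c) (h' : IsLocBddField T R Λ' b' c') :
    IsLocBddField T R (Λ + Λ') (fun t x => b t x - b' t x) fun t x => c t x - c' t x := by
  refine ⟨h.meas.sub h'.meas, h.meas_coeff.sub h'.meas_coeff, add_nonneg h.nonneg h'.nonneg, ?_⟩
  filter_upwards [h.bound, h'.bound] with p h1 h2 hp
  exact ⟨(norm_sub_le _ _).trans (add_le_add (h1 hp).1 (h2 hp).1),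
    (abs_sub _ _).trans (add_le_add (h1 hp).2 (h2 hp).2)⟩

end Transport

/-! ### Uniform bounds for mollified test functions -/

/-- Weak controlled solutions with zero initial datum for a linear drift. -/
structure IsTransportSolution {d : ℕ} (T γ : ℝ) (X : ℝ → Vec d)
    (XX : ℝ → ℝ → Matrix (Fin d) (Fin d) ℝ) (b : ℝ → Vec d → Vec d) (divb : ℝ → Vec d → ℝ)
    (u : ℝ → Vec d → ℝ) : Prop where
  time_pos : 0 < T
  lt_exponent : 1 / 3 < γ
  exponent_le : γ ≤ 1 / 2
  rough : IsGeometricRoughPath T γ X XX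
  drift : IsLinDrift T b divb
  solution : IsWeakControlledSolution T γ X XX b divb (fun _ => 0) u

theorem IsTest.exists_isC1Supported {d : ℕ} {φ : Vec d → ℝ} (h : IsTest φ) :
    ∃ a R, IsC1Supported a R φ := by
  have h1 : ContDiff ℝ 1 φ := h.1.of_le (by exact_mod_cast le_top)
  obtain ⟨a, ha⟩ := h.2.exists_bound_of_continuous h.1.continuous
  obtain ⟨a', ha'⟩ := (h.2.fderiv ℝ).exists_bound_of_continuous (h1.continuous_fderiv one_ne_zero)
  obtain ⟨R, hR⟩ := h.2.isCompact.isBounded.subset_closedBall 0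
  refine ⟨max a a', R, h1, fun x => (ha x).trans (le_max_left _ _),
    fun x => (ha' x).trans (le_max_right _ _), fun x hx => ?_⟩
  by_contra h0
  exact absurd (mem_closedBall_zero_iff.1 (hR (subset_tsupport _ h0))) (not_le.2 hx)

theorem IsC1Supported.isBddSupported {d : ℕ} {a R : ℝ} {φ : Vec d → ℝ} (h : IsC1Supported a R φ) :
    IsBddSupported a R φ := .of_continuous h.contDiff.continuous h.bound h.support

theorem IsTest.integrable {d : ℕ} {φ : Vec d → ℝ} (h : IsTest φ) : Integrable φ :=
  h.1.continuous.integrable_of_hasCompactSupport h.2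

theorem IsTest.contDiff {d : ℕ} {φ : Vec d → ℝ} (h : IsTest φ) (n : ℕ) : ContDiff ℝ n φ :=
  h.1.of_le (by exact_mod_cast le_top)

theorem pd_add {d : ℕ} {φ φ' : Vec d → ℝ} (h : IsTest φ) (h' : IsTest φ') (i : Fin d) :
    pd i (fun x => φ x + φ' x) = fun x => pd i φ x + pd i φ' x := by
  funext x
  unfold pd
  rw [fderiv_fun_add ((h.contDiff 1).differentiable one_ne_zero x)
    ((h'.contDiff 1).differentiable one_ne_zero x)]
  rfl

theorem pd_const_mul {d : ℕ} {φ : Vec d → ℝ} (h : IsTest φ) (α : ℝ) (i : Fin d) :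
    pd i (fun x => α * φ x) = fun x => α * pd i φ x := by
  funext x
  unfold pd
  rw [fderiv_const_mul ((h.contDiff 1).differentiable one_ne_zero x)]
  rfl

theorem fderiv_fderiv_apply {d : ℕ} {f : Vec d → ℝ} (hf : ContDiff ℝ 2 f) (x v w : Vec d) :
    fderiv ℝ (fun y => fderiv ℝ f y w) x v = fderiv ℝ (fderiv ℝ f) x v w := by
  have h := (((hf.fderiv_right (m := 1) (by norm_num)).differentiable one_ne_zero) x).hasFDerivAt
  rw [(h.clm_apply (hasFDerivAt_const w x)).fderiv]
  simp

theorem IsTest.fderiv_apply {d : ℕ} {φ : Vec d → ℝ} (h : IsTest φ) (w : Vec d) :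
    IsTest fun x => fderiv ℝ φ x w :=
  ⟨(h.1.fderiv_right (m := ∞) (by simp)).clm_apply contDiff_const,
    (h.2.fderiv ℝ).comp_left (g := fun A : Vec d →L[ℝ] ℝ => A w) (by simp)⟩

/-- The integrated transport term. -/
def driftIntegral {d : ℕ} (b : ℝ → Vec d → Vec d) (divb : ℝ → Vec d → ℝ) (u : ℝ → Vec d → ℝ)
    (s t : ℝ) (φ : Vec d → ℝ) : ℝ :=
  ∫ r in s..t, pair (u r) (transport (b r) (divb r) φ)

/-- The second order increment of the controlled rough integral. -/
def roughIncrement {d : ℕ} (X : ℝ → Vec d) (XX : ℝ → ℝ → Matrix (Fin d) (Fin d) ℝ)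
    (u : ℝ → Vec d → ℝ) (s t : ℝ) (φ : Vec d → ℝ) : ℝ :=
  (∑ i, pair (u s) (pd i φ) * (X t i - X s i)) +
    ∑ i, ∑ j, pair (u s) (pd j (pd i φ)) * XX s t j i

/-- The remainder of the equation on `[s,t]`. -/
def remainder {d : ℕ} (X : ℝ → Vec d) (XX : ℝ → ℝ → Matrix (Fin d) (Fin d) ℝ)
    (b : ℝ → Vec d → Vec d) (divb : ℝ → Vec d → ℝ) (u : ℝ → Vec d → ℝ) (s t : ℝ)
    (φ : Vec d → ℝ) : ℝ :=
  pair (u t) φ - pair (u s) φ - driftIntegral b divb u s t φ - roughIncrement X XX u s t φ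

namespace IsTransportSolution

variable {d : ℕ} {T γ : ℝ} {X : ℝ → Vec d} {XX : ℝ → ℝ → Matrix (Fin d) (Fin d) ℝ}
  {b : ℝ → Vec d → Vec d} {divb : ℝ → Vec d → ℝ} {u : ℝ → Vec d → ℝ}

theorem exponent_pos (h : IsTransportSolution T γ X XX b divb u) : 0 < γ := by
  linarith [h.lt_exponent]

theorem slice (h : IsTransportSolution T γ X XX b divb u) {t : ℝ} (ht : t ∈ Icc 0 T) :
    IsBddSlice (supNorm d T u) (u t) := h.solution.isBddSlice h.time_pos h.exponent_pos ht

theorem ae_slices (h : IsTransportSolution T γ X XX b divb u) {R Λ : ℝ}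
    (hΛ : IsLocBddField T R Λ b divb) {s t : ℝ} (hs : s ∈ Icc 0 T) (ht : t ∈ Icc 0 T) :
    ∀ᵐ r, r ∈ uIoc s t → IsBddSlice (supNorm d T u) (u r) ∧ IsLocBddSlice R Λ (b r) (divb r) := by
  filter_upwards [(ae_restrict_iff' measurableSet_Icc).1 hΛ.ae_slice] with r hr hrm
  have := uIcc_subset_Icc hs ht (uIoc_subset_uIcc hrm)
  exact ⟨h.slice this, hr this⟩

theorem intervalIntegrable_drift (h : IsTransportSolution T γ X XX b divb u) {φ : Vec d → ℝ}
    {a R : ℝ} (hφ : IsC1Supported a R φ) {s t : ℝ} (hs : s ∈ Icc 0 T) (ht : t ∈ Icc 0 T) :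
    IntervalIntegrable (fun r => pair (u r) (transport (b r) (divb r) φ)) volume s t := by
  obtain ⟨Λ, hΛ⟩ := h.drift.exists_isLocBddField R
  have := integrable_transport hΛ h.solution.mem (ψ := fun _ => φ) (fun _ _ => hφ)
    (hφ.contDiff.continuous.comp continuous_snd).aestronglyMeasurable
    ((hφ.contDiff.continuous_fderiv one_ne_zero).comp continuous_snd).aestronglyMeasurable
  exact intervalIntegrable_integral_slab this hs ht

theorem abs_driftIntegral_le (h : IsTransportSolution T γ X XX b divb u) {φ : Vec d → ℝ}
    {a R Λ : ℝ} (hφ : IsC1Supported a R φ) (hΛ : IsLocBddField T R Λ b divb) {s t : ℝ}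
    (hs : s ∈ Icc 0 T) (ht : t ∈ Icc 0 T) :
    |driftIntegral b divb u s t φ| ≤
      supNorm d T u * (2 * Λ * a * ballVolume d R) * |t - s| := by
  have hb : ∀ᵐ r, r ∈ uIoc s t → ‖pair (u r) (transport (b r) (divb r) φ)‖ ≤
      supNorm d T u * (2 * Λ * a * ballVolume d R) := by
    filter_upwards [h.ae_slices hΛ hs ht] with r hr hrm
    exact (hr hrm).1.abs_pair_le ((hr hrm).2.isBddSupported hφ)
  exact intervalIntegral.norm_integral_le_of_norm_le_const_ae hb

theorem driftIntegral_add (h : IsTransportSolution T γ X XX b divb u) {φ φ' : Vec d → ℝ}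
    {a a' R : ℝ} (hφ : IsC1Supported a R φ) (hφ' : IsC1Supported a' R φ') {s t : ℝ}
    (hs : s ∈ Icc 0 T) (ht : t ∈ Icc 0 T) :
    driftIntegral b divb u s t (fun x => φ x + φ' x) =
      driftIntegral b divb u s t φ + driftIntegral b divb u s t φ' := by
  obtain ⟨Λ, hΛ⟩ := h.drift.exists_isLocBddField R
  unfold driftIntegral
  rw [← intervalIntegral.integral_add (h.intervalIntegrable_drift hφ hs ht)
    (h.intervalIntegrable_drift hφ' hs ht)]
  refine intervalIntegral.integral_congr_ae ?_
  filter_upwards [h.ae_slices hΛ hs ht] with r hr hrm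
  obtain ⟨h1, h2⟩ := hr hrm
  rw [transport_add hφ.contDiff hφ'.contDiff,
    h1.pair_add (h2.isBddSupported hφ).integrable (h2.isBddSupported hφ').integrable]

theorem driftIntegral_const_mul {φ : Vec d → ℝ} (hφ : IsTest φ) (α s t : ℝ) :
    driftIntegral b divb u s t (fun x => α * φ x) = α * driftIntegral b divb u s t φ := by
  unfold driftIntegral
  rw [← intervalIntegral.integral_const_mul]
  refine intervalIntegral.integral_congr fun r _ => ?_
  rw [transport_const_mul α (hφ.contDiff 1), pair_const_mul]

/-- The sewing bound for a single test function. -/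
theorem exists_abs_remainder_le (h : IsTransportSolution T γ X XX b divb u) {φ : Vec d → ℝ}
    (hφ : IsTest φ) : ∃ K, ∀ s t, 0 ≤ s → s ≤ t → t ≤ T →
      |remainder X XX b divb u s t φ| ≤ K * (t - s) ^ (3 * γ) := by
  obtain ⟨K, hK⟩ := IsControlled.sewing_bound h.lt_exponent h.rough.toIsRoughPath
    (fun i => h.solution.controlled (pd i φ) (hφ.pd i)) (h.solution.equation φ hφ)
  refine ⟨K, fun s t hs hst ht => ?_⟩
  have hs' : s ∈ Icc 0 T := ⟨hs, hst.trans ht⟩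
  have ht' : t ∈ Icc 0 T := ⟨hs.trans hst, ht⟩
  have h0 : (0 : ℝ) ∈ Icc 0 T := ⟨le_rfl, h.time_pos.le⟩
  obtain ⟨a, R, hφ1⟩ := hφ.exists_isC1Supported
  have := intervalIntegral.integral_add_adjacent_intervals
    (h.intervalIntegrable_drift hφ1 h0 hs') (h.intervalIntegrable_drift hφ1 hs' ht')
  have h2 := hK s t hs hst ht
  refine le_trans (le_of_eq ?_) h2
  congr 1
  unfold remainder driftIntegral roughIncrement
  unfold transport at *
  linarith

theorem remainder_add (h : IsTransportSolution T γ X XX b divb u) {φ φ' : Vec d → ℝ}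
    {a a' R : ℝ} (hφ : IsTest φ) (hφ' : IsTest φ') (hφ1 : IsC1Supported a R φ)
    (hφ1' : IsC1Supported a' R φ') {s t : ℝ} (hs : s ∈ Icc 0 T) (ht : t ∈ Icc 0 T) :
    remainder X XX b divb u s t (fun x => φ x + φ' x) =
      remainder X XX b divb u s t φ + remainder X XX b divb u s t φ' := by
  unfold remainder roughIncrement
  rw [h.driftIntegral_add hφ1 hφ1' hs ht, (h.slice ht).pair_add hφ.integrable hφ'.integrable,
    (h.slice hs).pair_add hφ.integrable hφ'.integrable]
  have e1 : ∀ i, pair (u s) (pd i fun x => φ x + φ' x) = pair (u s) (pd i φ) + pair (u s) (pd i φ') :=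
    fun i => by
      rw [pd_add hφ hφ', (h.slice hs).pair_add (hφ.pd i).integrable (hφ'.pd i).integrable]
  have e2 : ∀ i j, pair (u s) (pd j (pd i fun x => φ x + φ' x)) =
      pair (u s) (pd j (pd i φ)) + pair (u s) (pd j (pd i φ')) := fun i j => by
    rw [pd_add hφ hφ', pd_add (hφ.pd i) (hφ'.pd i),
      (h.slice hs).pair_add ((hφ.pd i).pd j).integrable ((hφ'.pd i).pd j).integrable]
  simp only [e1, e2, add_mul, Finset.sum_add_distrib]
  ring

theorem remainder_const_mul {φ : Vec d → ℝ} (hφ : IsTest φ) (α s t : ℝ) :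
    remainder X XX b divb u s t (fun x => α * φ x) = α * remainder X XX b divb u s t φ := by
  unfold remainder roughIncrement
  rw [driftIntegral_const_mul hφ]
  simp only [pd_const_mul hφ, pd_const_mul (hφ.pd _), pair_const_mul]
  simp only [mul_sub, mul_add, Finset.mul_sum]
  ring_nf

end IsTransportSolution

section Kernel

variable {d : ℕ} {B c κ ε : ℝ} {k g : Vec d → ℝ}

theorem mollify_isC1Supported (hk : IsTest k) (hε : ∀ z, ε < ‖z‖ → k z = 0)
    (hκ : ∀ z, |k z| ≤ κ) (hκ' : ∀ z, ‖fderiv ℝ k z‖ ≤ κ) (hg : IsBddSlice c g) :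
    IsC1Supported (c * κ * ballVolume d B) (B + ε) (mollify B k g) where
  contDiff := (mollify_isTest hk hε hg).contDiff 1
  bound x := abs_mollify_le hκ hg x
  fderiv_bound x := by
    have hκ0 : 0 ≤ κ := (abs_nonneg _).trans (hκ 0)
    have hc0 := hg.nonneg
    have hv := ballVolume_nonneg d B
    refine ContinuousLinearMap.opNorm_le_bound _ (by positivity) fun v => ?_
    rw [fderiv_mollify hk hg]
    refine (abs_mollify_le (κ := κ * ‖v‖) (fun z => ?_) hg x).trans (le_of_eq (by ring))
    exact ((fderiv ℝ k z).le_opNorm v).trans (by gcongr; exact hκ' z)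
  support x hx := mollify_eq_zero hε hx

theorem fderiv_fderiv_mollify (hk : IsTest k) (hε : ∀ z, ε < ‖z‖ → k z = 0)
    (hg : IsBddSlice c g) (x v w : Vec d) :
    fderiv ℝ (fderiv ℝ (mollify B k g)) x v w =
      mollify B (fun z => fderiv ℝ (fderiv ℝ k) z v w) g x := by
  rw [← fderiv_fderiv_apply ((mollify_isTest hk hε hg).contDiff 2)]
  simp only [fderiv_mollify hk hg]
  rw [show (fun y => mollify B (fun z => fderiv ℝ k z w) g y) =
    mollify B (fun z => fderiv ℝ k z w) g from rfl, fderiv_mollify (hk.fderiv_apply w) hg]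
  simp only [fderiv_fderiv_apply (hk.contDiff 2)]

/-- The Taylor remainder of a mollified function is the mollification of the Taylor remainder. -/
theorem taylor_mollify (hk : IsTest k) (hε : ∀ z, ε < ‖z‖ → k z = 0) (hg : IsBddSlice c g)
    (x v : Vec d) :
    mollify B k g (x + v) - mollify B k g x - fderiv ℝ (mollify B k g) x v -
        1 / 2 * fderiv ℝ (fderiv ℝ (mollify B k g)) x v v =
      mollify B (fun z => k (z + v) - k z - fderiv ℝ k z v -
        1 / 2 * fderiv ℝ (fderiv ℝ k) z v v) g x := by
  have c1 : Continuous k := hk.1.continuous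
  have c2 : Continuous fun z => k (z + v) := c1.comp (continuous_id.add continuous_const)
  have c3 := (hk.fderiv_apply v).1.continuous
  have c4 : Continuous fun z => fderiv ℝ (fderiv ℝ k) z v v := by
    have := ((hk.fderiv_apply v).fderiv_apply v).1.continuous
    simpa only [fderiv_fderiv_apply (hk.contDiff 2)] using this
  have c5 : Continuous fun z => k (z + v) - k z := c2.sub c1
  have c6 : Continuous fun z => k (z + v) - k z - fderiv ℝ k z v := c5.sub c3
  have c7 : Continuous fun z => 1 / 2 * fderiv ℝ (fderiv ℝ k) z v v := continuous_const.mul c4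
  rw [mollify_kernel_sub c6 c7 hg, mollify_kernel_sub c5 c3 hg, mollify_kernel_sub c2 c1 hg,
    mollify_kernel_const_mul, fderiv_mollify hk hg, fderiv_fderiv_mollify hk hε hg]
  congr 3
  unfold mollify
  simp only [sub_add_eq_add_sub]

end Kernel

namespace IsTransportSolution

variable {d : ℕ} {T γ : ℝ} {X : ℝ → Vec d} {XX : ℝ → ℝ → Matrix (Fin d) (Fin d) ℝ}
  {b : ℝ → Vec d → Vec d} {divb : ℝ → Vec d → ℝ} {u : ℝ → Vec d → ℝ}

open BoundedContinuousFunction in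
/-- The sewing bound, uniformly over mollified test functions. -/
theorem exists_abs_remainder_mollify_le (h : IsTransportSolution T γ X XX b divb u) (B : ℝ)
    {ε : ℝ} {k : Vec d → ℝ} (hk : IsTest k) (hε : ∀ z, ε < ‖z‖ → k z = 0) :
    ∃ K, 0 ≤ K ∧ ∀ s t, 0 ≤ s → s ≤ t → t ≤ T → ∀ (c : ℝ) (g : Vec d → ℝ), Continuous g →
      (∀ x, |g x| ≤ c) →
      |remainder X XX b divb u s t (mollify B k g)| ≤ K * c * (t - s) ^ (3 * γ) := by
  obtain ⟨κ₀, R₀, hκ⟩ := hk.exists_isC1Supported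
  have hκ0 := hκ.nonneg
  set V := ballVolume d B with hV
  have hV0 : 0 ≤ V := ballVolume_nonneg d B
  set U := supNorm d T u with hU
  have hU0 : 0 ≤ U := ENNReal.toReal_nonneg
  obtain ⟨Λ, hΛ⟩ := h.drift.exists_isLocBddField (B + ε)
  have hΛ0 := hΛ.nonneg
  set W := ballVolume d (B + ε) with hW
  have hW0 : 0 ≤ W := ballVolume_nonneg d _
  have hgb : ∀ g : Vec d →ᵇ ℝ, IsBddSlice ‖g‖ g := fun g =>
    .of_continuous g.continuous g.norm_coe_le_norm
  have htest : ∀ g : Vec d →ᵇ ℝ, IsTest (mollify B k g) := fun g =>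
    mollify_isTest hk hε (hgb g)
  have hC1 : ∀ g : Vec d →ᵇ ℝ, IsC1Supported (‖g‖ * κ₀ * V) (B + ε) (mollify B k g) := fun g =>
    mollify_isC1Supported hk hε hκ.bound hκ.fderiv_bound (hgb g)
  -- a pairing with a mollified function is bounded
  have hpair : ∀ k' : Vec d → ℝ, IsTest k' → (∀ z, ε < ‖z‖ → k' z = 0) → ∃ C, 0 ≤ C ∧
      ∀ t ∈ Icc 0 T, ∀ g : Vec d →ᵇ ℝ, |pair (u t) (mollify B k' g)| ≤ C * ‖g‖ := by
    intro k' hk' hε'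
    obtain ⟨κ, hκ0, hκ⟩ := hk'.exists_bound
    refine ⟨U * (κ * V * W), by positivity, fun t ht g => ?_⟩
    have := (h.slice ht).abs_pair_le (IsBddSupported.of_continuous
      (mollify_isTest (B := B) hk' hε' (hgb g)).1.continuous (abs_mollify_le hκ (hgb g))
      (fun x hx => mollify_eq_zero (B := B) hε' hx))
    exact this.trans (le_of_eq (by ring))
  obtain ⟨C₀, hC₀0, hC₀⟩ := hpair k hk hε
  choose C₁ hC₁0 hC₁ using fun i => hpair (pd i k) (hk.pd i) (pd_eq_zero_of_norm_lt hε i)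
  choose C₂ hC₂0 hC₂ using fun i j => hpair (pd j (pd i k)) ((hk.pd i).pd j)
    (pd_eq_zero_of_norm_lt (pd_eq_zero_of_norm_lt hε i) j)
  have hmem : ∀ p : TimeInterval T, p.1.1 ∈ Icc 0 T ∧ p.1.2 ∈ Icc 0 T := fun p =>
    ⟨⟨p.2.1, p.2.2.1.trans p.2.2.2⟩, ⟨p.2.1.trans p.2.2.1, p.2.2.2⟩⟩
  -- For a fixed pair of times only continuity of the functional matters; the constant may depend on
  -- `p`.
  have hbound : ∀ p : TimeInterval T, ∃ C, ∀ g : Vec d →ᵇ ℝ,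
      ‖remainder X XX b divb u p.1.1 p.1.2 (mollify B k g)‖ ≤ C * ‖g‖ := by
    intro p
    obtain ⟨hs, ht⟩ := hmem p
    refine ⟨C₀ + C₀ + U * (2 * Λ * (κ₀ * V) * W) * |p.1.2 - p.1.1| +
      ((∑ i, C₁ i * |X p.1.2 i - X p.1.1 i|) + ∑ i, ∑ j, C₂ i j * |XX p.1.1 p.1.2 j i|),
      fun g => ?_⟩
    unfold remainder roughIncrement
    rw [add_mul, add_mul, add_mul, add_mul]
    refine (norm_sub_le _ _).trans (add_le_add ((norm_sub_le _ _).trans (add_le_add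
      ((norm_sub_le _ _).trans (add_le_add (hC₀ _ ht g) (hC₀ _ hs g))) ?_))
      ((norm_add_le _ _).trans (add_le_add ?_ ?_)))
    · exact (h.abs_driftIntegral_le (hC1 g) hΛ hs ht).trans (le_of_eq (by ring))
    · rw [Finset.sum_mul]
      refine (norm_sum_le _ _).trans (Finset.sum_le_sum fun i _ => ?_)
      rw [norm_mul, pd_mollify hk (hgb g), mul_right_comm]
      exact mul_le_mul_of_nonneg_right (hC₁ i _ hs g) (norm_nonneg _)
    · rw [Finset.sum_mul]
      refine (norm_sum_le _ _).trans (Finset.sum_le_sum fun i _ => ?_)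
      rw [Finset.sum_mul]
      refine (norm_sum_le _ _).trans (Finset.sum_le_sum fun j _ => ?_)
      rw [norm_mul, pd_mollify hk (hgb g), pd_mollify (hk.pd i) (hgb g), mul_right_comm]
      exact mul_le_mul_of_nonneg_right (hC₂ i j _ hs g) (norm_nonneg _)
  let L : TimeInterval T → (Vec d →ᵇ ℝ) →L[ℝ] ℝ := fun p =>
    LinearMap.mkContinuousOfExistsBound
      { toFun := fun g => remainder X XX b divb u p.1.1 p.1.2 (mollify B k g)
        map_add' := fun g g' => by
          have e : mollify B k (⇑(g + g')) = fun x => mollify B k g x + mollify B k g' x :=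
            mollify_add hk.1.continuous (hgb g) (hgb g')
          rw [e]
          exact h.remainder_add (htest g) (htest g') (hC1 g) (hC1 g') (hmem p).1 (hmem p).2
        map_smul' := fun α g => by
          have e : mollify B k (⇑(α • g)) = fun x => α * mollify B k g x :=
            mollify_const_mul α
          rw [e]
          exact remainder_const_mul (htest g) α _ _ } (hbound p)
  have hL : ∀ p g, L p g = remainder X XX b divb u p.1.1 p.1.2 (mollify B k g) := fun _ _ => rfl
  -- Pointwise boundedness is the sewing bound of one test function, with its uncontrolled constant.
  -- Uniform boundedness makes the dependence on `g` linear in its sup norm.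
  obtain ⟨K, hK⟩ := banach_steinhaus (g := fun p : TimeInterval T =>
    ((p.1.2 - p.1.1) ^ (3 * γ))⁻¹ • L p) fun g => by
      obtain ⟨K, hK⟩ := h.exists_abs_remainder_le (htest g)
      refine ⟨|K|, fun p => ?_⟩
      have h0 : 0 ≤ (p.1.2 - p.1.1) ^ (3 * γ) := Real.rpow_nonneg p.length_nonneg _
      rw [_root_.smul_apply, norm_smul, norm_inv, Real.norm_of_nonneg h0, hL]
      have := hK p.1.1 p.1.2 p.2.1 p.2.2.1 p.2.2.2
      rcases h0.eq_or_lt with h0 | h0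
      · rw [← h0]; simp
      · rw [inv_mul_le_iff₀ h0, mul_comm]
        exact this.trans (by gcongr; exact le_abs_self K)
  have hK0 : 0 ≤ K := (norm_nonneg _).trans (hK ⟨(0, 0), le_rfl, le_rfl, h.time_pos.le⟩)
  refine ⟨K, hK0, fun s t hs hst ht c g hg hc => ?_⟩
  set p : TimeInterval T := ⟨(s, t), hs, hst, ht⟩
  set G : Vec d →ᵇ ℝ := BoundedContinuousFunction.ofNormedAddCommGroup g hg c hc with hG
  have hGn : ‖G‖ ≤ c := BoundedContinuousFunction.norm_ofNormedAddCommGroup_le hg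
    ((abs_nonneg _).trans (hc 0)) hc
  have h0 : 0 ≤ (t - s) ^ (3 * γ) := Real.rpow_nonneg (sub_nonneg.2 hst) _
  have h1 := (((t - s) ^ (3 * γ))⁻¹ • L p).le_of_opNorm_le (hK p) G
  rw [_root_.smul_apply, norm_smul, norm_inv, Real.norm_of_nonneg h0, hL] at h1
  change _ * |remainder X XX b divb u s t (mollify B k g)| ≤ _ at h1
  -- When the power vanishes the normalised functional is zero and carries no information, so the
  -- bound for the single test function is used instead.
  rcases h0.eq_or_lt with h0 | h0
  · obtain ⟨K', hK'⟩ := h.exists_abs_remainder_le (htest G)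
    have := hK' s t hs hst ht
    rw [← h0, mul_zero] at this ⊢
    exact this
  · rw [inv_mul_le_iff₀ h0] at h1
    refine h1.trans ?_
    rw [mul_comm]
    gcongr

end IsTransportSolution

/-! ### Translation of mollified test functions along the path -/

theorem IsBddSlice.pair_sum_mul {d : ℕ} {ι : Type*} [Fintype ι] {U : ℝ} {w : Vec d → ℝ}
    (h : IsBddSlice U w) {φ : ι → Vec d → ℝ} (hφ : ∀ i, Integrable (φ i)) (α : ι → ℝ) :
    pair w (fun x => ∑ i, φ i x * α i) = ∑ i, pair w (φ i) * α i := by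
  unfold pair
  simp only [Finset.mul_sum]
  rw [integral_finsetSum _ fun i _ => h.integrable_mul ((hφ i).mul_const _)]
  refine Finset.sum_congr rfl fun i _ => ?_
  rw [← integral_mul_const]
  exact integral_congr_ae (.of_forall fun x => (mul_assoc _ _ _).symm)

theorem IsTest.translate {d : ℕ} {φ : Vec d → ℝ} (h : IsTest φ) (v : Vec d) :
    IsTest fun x => φ (x + v) :=
  ⟨h.1.comp (contDiff_id.add contDiff_const), h.2.comp_homeomorph (Homeomorph.addRight v)⟩

theorem IsTest.exists_iteratedFDeriv_le {d : ℕ} {φ : Vec d → ℝ} (h : IsTest φ) (n : ℕ) :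
    ∃ C, 0 ≤ C ∧ ∀ x, ‖iteratedFDeriv ℝ n φ x‖ ≤ C := by
  obtain ⟨C, hC⟩ := (h.2.iteratedFDeriv n).exists_bound_of_continuous
    ((h.contDiff n).continuous_iteratedFDeriv le_rfl)
  exact ⟨C, (norm_nonneg _).trans (hC 0), hC⟩

namespace IsTransportSolution

variable {d : ℕ} {T γ : ℝ} {X : ℝ → Vec d} {XX : ℝ → ℝ → Matrix (Fin d) (Fin d) ℝ}
  {b : ℝ → Vec d → Vec d} {divb : ℝ → Vec d → ℝ} {u : ℝ → Vec d → ℝ}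

/-- The Hessian is symmetric, so only the symmetric part of the second level is seen, and for a
geometric rough path that is half the tensor square of the increment. -/
theorem roughIncrement_eq (h : IsTransportSolution T γ X XX b divb u) {φ : Vec d → ℝ}
    (hφ : IsTest φ) {s t : ℝ} (hs : s ∈ Icc 0 T) (ht : t ∈ Icc 0 T) :
    roughIncrement X XX u s t φ = pair (u s) (fun x => fderiv ℝ φ x (X t - X s) +
      1 / 2 * fderiv ℝ (fderiv ℝ φ) x (X t - X s) (X t - X s)) := by
  have i1 := (hφ.fderiv_apply (X t - X s)).integrable
  have i2 : Integrable fun x => 1 / 2 * fderiv ℝ (fderiv ℝ φ) x (X t - X s) (X t - X s) := by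
    have := ((hφ.fderiv_apply (X t - X s)).fderiv_apply (X t - X s)).integrable.const_mul (1 / 2)
    simpa only [fderiv_fderiv_apply (hφ.contDiff 2)] using this
  rw [(h.slice hs).pair_add i1 i2, roughIncrement,
    ← (h.slice hs).pair_sum_mul fun i => (hφ.pd i).integrable]
  have e2 : ∑ i, ∑ j, pair (u s) (pd j (pd i φ)) * XX s t j i =
      ∑ p : Fin d × Fin d, pair (u s) (pd p.2 (pd p.1 φ)) * XX s t p.2 p.1 :=
    (Fintype.sum_prod_type' fun i j => pair (u s) (pd j (pd i φ)) * XX s t j i).symm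
  rw [e2, ← (h.slice hs).pair_sum_mul (φ := fun p : Fin d × Fin d => pd p.2 (pd p.1 φ))
    fun p => ((hφ.pd p.1).pd p.2).integrable]
  congr 2
  · funext x
    rw [fderiv_apply_eq_sum_pd]; simp
  · funext x
    rw [← h.rough.contraction hs ht (hφ.contDiff 2)]
    exact Fintype.sum_prod_type' fun i j => pd j (pd i φ) x * XX s t j i

theorem exists_path_bound (h : IsTransportSolution T γ X XX b divb u) :
    ∃ H Δ, 0 ≤ H ∧ 0 ≤ Δ ∧ ∀ s t, 0 ≤ s → s ≤ t → t ≤ T →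
      ‖X t - X s‖ ≤ H * (t - s) ^ γ ∧ ‖X t - X s‖ ≤ Δ := by
  obtain ⟨H, hH0, hH⟩ := h.rough.holder.exists_nonneg
  have hT := h.time_pos.le
  refine ⟨H, H * T ^ γ, hH0, by positivity, fun s t hs hst ht => ?_⟩
  have h1 := hH s ⟨hs, hst.trans ht⟩ t ⟨hs.trans hst, ht⟩
  rw [abs_of_nonneg (sub_nonneg.2 hst)] at h1
  refine ⟨h1, h1.trans ?_⟩
  gcongr
  · exact h.exponent_pos.le
  · linarith

/-- By `roughIncrement_eq` the rough increment agrees with a translation up to the third order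
Taylor remainder. That remainder is transferred to the kernel, so `g` enters only through its sup
norm. -/
theorem exists_abs_translate_le (h : IsTransportSolution T γ X XX b divb u) (B : ℝ)
    {ε : ℝ} {k : Vec d → ℝ} (hk : IsTest k) (hε : ∀ z, ε < ‖z‖ → k z = 0) :
    ∃ K, 0 ≤ K ∧ ∀ s t, 0 ≤ s → s ≤ t → t ≤ T → ∀ (c : ℝ) (g : Vec d → ℝ), Continuous g →
      (∀ x, |g x| ≤ c) →
      |pair (u t) (mollify B k g) - pair (u s) (fun x => mollify B k g (x + (X t - X s))) -
        driftIntegral b divb u s t (mollify B k g)| ≤ K * c * (t - s) ^ (3 * γ) := by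
  obtain ⟨K, hK0, hK⟩ := h.exists_abs_remainder_mollify_le B hk hε
  obtain ⟨H, Δ, hH0, hΔ0, hX⟩ := h.exists_path_bound
  obtain ⟨C₃, hC₃0, hC₃⟩ := hk.exists_iteratedFDeriv_le 3
  set U := supNorm d T u
  have hU0 : 0 ≤ U := ENNReal.toReal_nonneg
  set V := ballVolume d B
  have hV0 : 0 ≤ V := ballVolume_nonneg d B
  set W := ballVolume d (B + (ε + Δ))
  have hW0 : 0 ≤ W := ballVolume_nonneg d _
  refine ⟨K + U * (C₃ * H ^ 3 * V * W), by positivity, fun s t hs hst ht c g hg hc => ?_⟩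
  have hs' : s ∈ Icc 0 T := ⟨hs, hst.trans ht⟩
  have ht' : t ∈ Icc 0 T := ⟨hs.trans hst, ht⟩
  have hgb : IsBddSlice c g := .of_continuous hg hc
  have hc0 := hgb.nonneg
  have hφ : IsTest (mollify B k g) := mollify_isTest hk hε hgb
  obtain ⟨hX1, hX2⟩ := hX s t hs hst ht
  set φ := mollify B k g with hφd
  set v := X t - X s with hv
  have hτ : 0 ≤ (t - s) ^ γ := Real.rpow_nonneg (sub_nonneg.2 hst) _
  have p3 : (t - s) ^ (3 * γ) = ((t - s) ^ γ) ^ 3 := by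
    rw [mul_comm, ← Real.rpow_mul_natCast (sub_nonneg.2 hst)]; norm_num
  set k₃ : Vec d → ℝ := fun z => k (z + v) - k z - fderiv ℝ k z v -
    1 / 2 * fderiv ℝ (fderiv ℝ k) z v v with hk₃
  have hk₃b : ∀ z, |k₃ z| ≤ C₃ * (H * (t - s) ^ γ) ^ 3 := fun z =>
    (abs_taylor_three_le (hk.contDiff 3) hC₃ z v).trans (by gcongr)
  have hk₃s : ∀ z, ε + Δ < ‖z‖ → k₃ z = 0 := by
    intro z hz
    have h1 : ε < ‖z‖ := by linarith
    have h2 : ε < ‖z + v‖ := by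
      have := norm_sub_le (z + v) v
      rw [add_sub_cancel_right] at this
      linarith
    have h3 : fderiv ℝ k z = 0 := fderiv_eq_zero_of_norm_lt hε h1
    have h4 := fderiv_eq_zero_of_norm_lt
      (k := fun z => fderiv ℝ k z v) (ε := ε) (fun z hz => by
        rw [fderiv_eq_zero_of_norm_lt hε hz]; rfl) h1
    have h5 : fderiv ℝ (fderiv ℝ k) z v v = 0 := by
      rw [← fderiv_fderiv_apply (hk.contDiff 2), h4]; rfl
    simp [hk₃, hε z h1, hε _ h2, h3, h5]
  have hT3 : ∀ x, φ (x + v) - φ x - (fderiv ℝ φ x v + 1 / 2 * fderiv ℝ (fderiv ℝ φ) x v v) =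
      mollify B k₃ g x := by
    intro x
    rw [← taylor_mollify hk hε hgb]
    ring
  have i1 := (hφ.fderiv_apply v).integrable
  have i2 : Integrable fun x => 1 / 2 * fderiv ℝ (fderiv ℝ φ) x v v := by
    have := ((hφ.fderiv_apply v).fderiv_apply v).integrable.const_mul (1 / 2)
    simpa only [fderiv_fderiv_apply (hφ.contDiff 2)] using this
  have e : pair (u t) φ - pair (u s) (fun x => φ (x + v)) - driftIntegral b divb u s t φ =
      remainder X XX b divb u s t φ - pair (u s) (mollify B k₃ g) := by
    have e1 : mollify B k₃ g = fun x => φ (x + v) - φ x -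
        (fderiv ℝ φ x v + 1 / 2 * fderiv ℝ (fderiv ℝ φ) x v v) := funext fun x => (hT3 x).symm
    have i3 : Integrable fun x => φ (x + v) - φ x := (hφ.translate v).integrable.sub hφ.integrable
    have i4 : Integrable fun x => fderiv ℝ φ x v + 1 / 2 * fderiv ℝ (fderiv ℝ φ) x v v := i1.add i2
    rw [e1, (h.slice hs').pair_sub i3 i4,
      (h.slice hs').pair_sub (hφ.translate v).integrable hφ.integrable, remainder,
      h.roughIncrement_eq hφ hs' ht']
    ring
  have hm : Continuous (mollify B k₃ g) := by
    have e1 : mollify B k₃ g = fun x => φ (x + v) - φ x -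
        (fderiv ℝ φ x v + 1 / 2 * fderiv ℝ (fderiv ℝ φ) x v v) := funext fun x => (hT3 x).symm
    rw [e1]
    have c4 : Continuous fun z => fderiv ℝ (fderiv ℝ φ) z v v := by
      have := ((hφ.fderiv_apply v).fderiv_apply v).1.continuous
      simpa only [fderiv_fderiv_apply (hφ.contDiff 2)] using this
    exact ((hφ.translate v).1.continuous.sub hφ.1.continuous).sub
      ((hφ.fderiv_apply v).1.continuous.add (continuous_const.mul c4))
  have h2 := (h.slice hs').abs_pair_le (IsBddSupported.of_continuous (R := B + (ε + Δ)) hm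
    (abs_mollify_le hk₃b hgb) fun x hx => mollify_eq_zero hk₃s hx)
  rw [e]
  refine (abs_sub _ _).trans ?_
  calc _ ≤ K * c * (t - s) ^ (3 * γ) +
        U * (c * (C₃ * (H * (t - s) ^ γ) ^ 3) * V * W) := add_le_add (hK s t hs hst ht c g hg hc) h2
    _ = _ := by rw [p3]; ring

/-- The Hölder bound of the controlled path, made uniform over mollified functions: it combines the
`3γ` error, the drift and the displacement of the test function, which is the dominant term. -/
theorem exists_abs_pair_mollify_sub_le (h : IsTransportSolution T γ X XX b divb u) (B : ℝ)
    {ε : ℝ} {k : Vec d → ℝ} (hk : IsTest k) (hε : ∀ z, ε < ‖z‖ → k z = 0) :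
    ∃ K, 0 ≤ K ∧ ∀ s t, 0 ≤ s → s ≤ t → t ≤ T → ∀ (c : ℝ) (g : Vec d → ℝ), Continuous g →
      (∀ x, |g x| ≤ c) →
      |pair (u t) (mollify B k g) - pair (u s) (mollify B k g)| ≤ K * c * (t - s) ^ γ := by
  obtain ⟨K, hK0, hK⟩ := h.exists_abs_translate_le B hk hε
  obtain ⟨H, Δ, hH0, hΔ0, hX⟩ := h.exists_path_bound
  obtain ⟨κ, R, hκ⟩ := hk.exists_isC1Supported
  have hκ0 := hκ.nonneg
  obtain ⟨Λ, hΛ⟩ := h.drift.exists_isLocBddField (B + ε)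
  have hΛ0 := hΛ.nonneg
  have hT := h.time_pos.le
  have hγ := h.exponent_pos
  set U := supNorm d T u
  have hU0 : 0 ≤ U := ENNReal.toReal_nonneg
  set V := ballVolume d B
  have hV0 : 0 ≤ V := ballVolume_nonneg d B
  set W := ballVolume d (B + ε)
  have hW0 : 0 ≤ W := ballVolume_nonneg d _
  set W' := ballVolume d (B + ε + Δ)
  have hW0' : 0 ≤ W' := ballVolume_nonneg d _
  refine ⟨K * T ^ (2 * γ) + U * (2 * Λ * (κ * V) * W) * T ^ (1 - γ) + U * (κ * V * H * W'),
    by positivity, fun s t hs hst ht c g hg hc => ?_⟩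
  have hs' : s ∈ Icc 0 T := ⟨hs, hst.trans ht⟩
  have ht' : t ∈ Icc 0 T := ⟨hs.trans hst, ht⟩
  have hgb : IsBddSlice c g := .of_continuous hg hc
  have hc0 := hgb.nonneg
  have hφ : IsTest (mollify B k g) := mollify_isTest hk hε hgb
  have hφ1 : IsC1Supported (c * κ * V) (B + ε) (mollify B k g) :=
    mollify_isC1Supported hk hε hκ.bound hκ.fderiv_bound hgb
  obtain ⟨hX1, hX2⟩ := hX s t hs hst ht
  set φ := mollify B k g with hφd
  set v := X t - X s with hv
  have hτ0 : 0 ≤ t - s := sub_nonneg.2 hst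
  have hτ : 0 ≤ (t - s) ^ γ := Real.rpow_nonneg hτ0 _
  have b1 := hK s t hs hst ht c g hg hc
  have b2 := h.abs_driftIntegral_le hφ1 hΛ hs' ht'
  rw [abs_of_nonneg hτ0] at b2
  have b3 : |pair (u s) (fun x => φ (x + v) - φ x)| ≤
      U * (c * κ * V * (H * (t - s) ^ γ) * W') := by
    refine (h.slice hs').abs_pair_le (IsBddSupported.of_continuous (R := B + ε + Δ)
      ((hφ.translate v).1.continuous.sub hφ.1.continuous) (fun x => ?_) fun x hx => ?_)
    · have := norm_sub_le_of_norm_fderiv_le hφ1.contDiff hφ1.fderiv_bound x (x + v)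
      rw [add_sub_cancel_left] at this
      exact this.trans (by gcongr)
    · have h2 := norm_sub_le (x + v) v
      rw [add_sub_cancel_right] at h2
      rw [hφ1.support x (by linarith), hφ1.support (x + v) (by linarith), sub_zero]
  rw [(h.slice hs').pair_sub (hφ.translate v).integrable hφ.integrable] at b3
  have e : pair (u t) φ - pair (u s) φ =
      (pair (u t) φ - pair (u s) (fun x => φ (x + v)) - driftIntegral b divb u s t φ) +
      driftIntegral b divb u s t φ + (pair (u s) (fun x => φ (x + v)) - pair (u s) φ) := by ring
  rw [e]
  refine (abs_add_three _ _ _).trans ?_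
  have p3 : (t - s) ^ (3 * γ) ≤ T ^ (2 * γ) * (t - s) ^ γ := by
    rw [show 3 * γ = 2 * γ + γ by ring, Real.rpow_add_of_nonneg hτ0 (by positivity) hγ.le]
    gcongr
    linarith
  have p1 := le_rpow_mul_rpow hτ0 (show t - s ≤ T by linarith) hγ (by linarith [h.exponent_le])
  calc _ ≤ K * c * (T ^ (2 * γ) * (t - s) ^ γ) +
        U * (2 * Λ * (c * κ * V) * W) * (T ^ (1 - γ) * (t - s) ^ γ) +
        U * (c * κ * V * (H * (t - s) ^ γ) * W') := by
        refine add_le_add (add_le_add (b1.trans (by gcongr)) (b2.trans (by gcongr))) b3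
    _ = _ := by ring

/-- At time `0` the empty partition is admissible, and its sum is zero. -/
theorem pair_zero_eq_zero (h : IsTransportSolution T γ X XX b divb u) {φ : Vec d → ℝ}
    (hφ : IsTest φ) : pair (u 0) φ = 0 := by
  have h1 := h.solution.equation φ hφ 0 ⟨le_rfl, h.time_pos.le⟩
  have e : pair (fun _ : Vec d => (0 : ℝ)) φ = 0 := by simp [pair]
  rw [e, intervalIntegral.integral_same, sub_zero, sub_zero] at h1
  refine abs_nonpos_iff.1 (le_of_forall_pos_le_add fun ε hε => ?_)
  obtain ⟨δ, -, H⟩ := h1 ε hε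
  have := H 0 (fun _ => 0) rfl rfl (by simp)
  rwa [Finset.range_zero, Finset.sum_empty, zero_sub, abs_neg, ← zero_add ε] at this

end IsTransportSolution

/-! ### Exchanging pairings and integrals -/

section Fubini

variable {d : ℕ} {U U' c B ε : ℝ} {w g k : Vec d → ℝ}

/-- The pairing of `w` with translates of the kernel. -/
def dualMollify (k w : Vec d → ℝ) (y : Vec d) : ℝ := ∫ x, w x * k (x - y)

theorem integrable_prod_mollify (hw : IsBddSlice U w) (hg : IsBddSlice c g) (hk : IsTest k)
    (hε : ∀ z, ε < ‖z‖ → k z = 0) (B : ℝ) :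
    Integrable (fun p : Vec d × Vec d => w p.1 * (g p.2 * k (p.1 - p.2)))
      (volume.prod (volume.restrict (Metric.closedBall 0 B))) := by
  obtain ⟨κ, hκ0, hκ⟩ := hk.exists_bound
  have hi : Integrable (fun p : Vec d × Vec d =>
      (Metric.closedBall (0 : Vec d) (B + ε)).indicator (fun _ => U * (c * κ)) p.1)
      (volume.prod (volume.restrict (Metric.closedBall 0 B))) := by
    have : IsFiniteMeasure (volume.restrict (Metric.closedBall (0 : Vec d) B)) :=
      ⟨by simpa using measure_closedBall_lt_top⟩
    exact Integrable.comp_fst ((integrable_indicator_iff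
      Metric.isClosed_closedBall.measurableSet).2
        (integrableOn_const measure_closedBall_lt_top.ne)) _
  refine hi.mono' (hw.meas.comp_fst.mul ((hg.meas.restrict.comp_snd).mul
    (hk.1.continuous.comp (continuous_fst.sub continuous_snd)).aestronglyMeasurable)) ?_
  have h1 : ∀ᵐ p ∂((volume : Measure (Vec d)).prod
      (volume.restrict (Metric.closedBall (0 : Vec d) B))), |w p.1| ≤ U :=
    Measure.quasiMeasurePreserving_fst.ae hw.bound
  have h2 : ∀ᵐ p ∂((volume : Measure (Vec d)).prod
      (volume.restrict (Metric.closedBall (0 : Vec d) B))), |g p.2| ≤ c :=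
    Measure.quasiMeasurePreserving_snd.ae (ae_restrict_of_ae hg.bound)
  have h3 : ∀ᵐ p ∂((volume : Measure (Vec d)).prod
      (volume.restrict (Metric.closedBall (0 : Vec d) B))), p.2 ∈ Metric.closedBall (0 : Vec d) B :=
    Measure.quasiMeasurePreserving_snd.ae
      (ae_restrict_mem Metric.isClosed_closedBall.measurableSet)
  filter_upwards [h1, h2, h3] with p a1 a2 a3
  by_cases hp : ‖p.1‖ ≤ B + ε
  · rw [indicator_of_mem (by simpa using hp), norm_mul, norm_mul]
    exact mul_le_mul a1 (mul_le_mul a2 (hκ _) (norm_nonneg _) hg.nonneg)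
      (mul_nonneg (norm_nonneg _) (norm_nonneg _)) hw.nonneg
  · rw [indicator_of_notMem (by simpa using hp), hε, mul_zero, mul_zero, norm_zero]
    have := norm_sub_norm_le p.1 p.2
    have := mem_closedBall_zero_iff.1 a3
    linarith [not_le.1 hp]

theorem pair_mollify (hw : IsBddSlice U w) (hg : IsBddSlice c g) (hk : IsTest k)
    (hε : ∀ z, ε < ‖z‖ → k z = 0) (B : ℝ) :
    pair w (mollify B k g) = ∫ y in Metric.closedBall 0 B, g y * dualMollify k w y := by
  have := integral_integral_swap (f := fun x y => w x * (g y * k (x - y)))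
    (integrable_prod_mollify hw hg hk hε B)
  unfold pair mollify dualMollify
  simp only [← integral_const_mul]
  rw [this]
  refine integral_congr_ae (.of_forall fun y => integral_congr_ae (.of_forall fun x => ?_))
  simp only
  ring

theorem integrableOn_dualMollify (hw : IsBddSlice U w) (hk : IsTest k)
    (hε : ∀ z, ε < ‖z‖ → k z = 0) (B : ℝ) :
    IntegrableOn (dualMollify k w) (Metric.closedBall 0 B) := by
  have := (integrable_prod_mollify hw (c := 1) (g := fun _ => 1)
    (.of_continuous continuous_const (by simp)) hk hε B).integral_prod_right
  simp only [one_mul] at this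
  exact this

/-- Pairing with a mollified time integral. -/
theorem pair_mollify_integral (hw : IsBddSlice U w) (hk : IsTest k)
    (hε : ∀ z, ε < ‖z‖ → k z = 0) (B : ℝ) {S : ℝ → Vec d → ℝ} {s t : ℝ} (hst : s ≤ t)
    (hSm : AEStronglyMeasurable (Function.uncurry S) ((volume.restrict (Ioc s t)).prod volume))
    (hS : ∀ r ∈ Ioc s t, IsBddSlice c (S r)) (hSc : ∀ r ∈ Ioc s t, ∀ x, |S r x| ≤ c)
    (hI : IsBddSlice U' fun x => ∫ r in s..t, S r x) :
    IntervalIntegrable (fun r => pair w (mollify B k (S r))) volume s t ∧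
      pair w (mollify B k fun x => ∫ r in s..t, S r x) = ∫ r in s..t, pair w (mollify B k (S r)) := by
  -- With the smoothing moved to the fixed `w`, the pairing is an integral of `S` against `D`, and
  -- the exchange is Fubini's theorem for `S * D`.
  set D := dualMollify k w with hD
  have hDi : Integrable D (volume.restrict (Metric.closedBall 0 B)) :=
    integrableOn_dualMollify hw hk hε B
  have : IsFiniteMeasure (volume.restrict (Ioc s t)) := ⟨by simp⟩
  have hint : Integrable (fun p : ℝ × Vec d => S p.1 p.2 * D p.2)
      ((volume.restrict (Ioc s t)).prod (volume.restrict (Metric.closedBall 0 B))) := by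
    refine (hDi.comp_snd _).bdd_mul (c := c) (hSm.mono_measure
      (Measure.prod_mono le_rfl Measure.restrict_le_self)) ?_
    have : ∀ᵐ p ∂((volume.restrict (Ioc s t)).prod
        (volume.restrict (Metric.closedBall (0 : Vec d) B))), p.1 ∈ Ioc s t :=
      Measure.quasiMeasurePreserving_fst.ae (ae_restrict_mem measurableSet_Ioc)
    filter_upwards [this] with p hp using hSc _ hp _
  have hpr : ∀ r ∈ Ioc s t, pair w (mollify B k (S r)) =
      ∫ y in Metric.closedBall 0 B, S r y * D y := fun r hr => pair_mollify hw (hS r hr) hk hε B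
  constructor
  · rw [intervalIntegrable_iff_integrableOn_Ioc_of_le hst]
    refine (hint.integral_prod_left).congr ?_
    filter_upwards [ae_restrict_mem measurableSet_Ioc] with r hr using (hpr r hr).symm
  · rw [pair_mollify hw hI hk hε B]
    simp only [intervalIntegral.integral_of_le hst, ← integral_mul_const]
    rw [← integral_integral_swap hint]
    exact setIntegral_congr_fun measurableSet_Ioc fun r hr => (hpr r hr).symm

end Fubini

/-! ### Families of test functions transported backwards -/

/-- Smooth families, compactly supported in a ball and bounded with all that matters by `a`,
satisfying the first order expansion of a backward solution. -/
structure IsBackwardFamily {d : ℕ} (T γ R a : ℝ) (X : ℝ → Vec d) (f : ℝ → Vec d → Vec d)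
    (ψ : ℝ → Vec d → ℝ) : Prop where
  drift : IsBddFamily f
  family : IsBddFamily ψ
  support : ∀ r x, R < ‖x‖ → ψ r x = 0
  bound : ∀ r x, |ψ r x| ≤ a
  fderiv_bound : ∀ r x, ‖fderiv ℝ (ψ r) x‖ ≤ a
  fderiv_lipschitz : ∀ r x y, ‖fderiv ℝ (ψ r) x - fderiv ℝ (ψ r) y‖ ≤ a * ‖x - y‖
  source_bound : ∀ r x, |source f ψ r x| ≤ a
  source_lipschitz : ∀ r x y, |source f ψ r x - source f ψ r y| ≤ a * ‖x - y‖
  holder : ∀ s ∈ Icc 0 T, ∀ t ∈ Icc 0 T, ∀ x, |ψ t x - ψ s x| ≤ a * |t - s| ^ γ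
  expansion : ∀ s t, 0 ≤ s → s ≤ t → t ≤ T → ∀ x,
    |ψ s x - ψ t (x + (X t - X s)) - ∫ r in s..t, source f ψ r x| ≤ a * ((t - s) ^ γ * (t - s))

/-- The projection of a time onto `[0,T]`. -/
def clamp (T r : ℝ) : ℝ := max 0 (min T r)

theorem continuous_clamp (T : ℝ) : Continuous (clamp T) :=
  continuous_const.max (continuous_const.min continuous_id)

theorem clamp_mem {T : ℝ} (hT : 0 ≤ T) (r : ℝ) : clamp T r ∈ Icc 0 T :=
  ⟨le_max_left _ _, max_le hT (min_le_left _ _)⟩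

theorem clamp_of_mem {T r : ℝ} (hr : r ∈ Icc 0 T) : clamp T r = r := by
  rw [clamp, min_eq_right hr.2, max_eq_right hr.1]

/-- Freezing the time outside `[0,T]` supplies the bounds and the measurability over the whole line
that a bounded family requires. -/
theorem IsTransported.isBddFamily {d : ℕ} {T γ R : ℝ} {X : ℝ → Vec d} {ψ : ℝ → Vec d → ℝ}
    (h : IsTransported T R X ψ) (hX : IsHolder T γ X) (hγ : 0 < γ) (hγ1 : γ ≤ 1) (hT : 0 ≤ T) :
    IsBddFamily fun r => ψ (clamp T r) where
  smooth r := h.smooth _ (clamp_mem hT r)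
  meas x := ((h.continuousOn_apply hX hγ hγ1 x).comp_continuous (continuous_clamp T)
    (clamp_mem hT)).stronglyMeasurable
  bound n := by
    obtain ⟨C, -, hC⟩ := h.bound n
    exact ⟨C, fun r x => hC _ (clamp_mem hT r) x⟩

theorem exists_source_lipschitz {d : ℕ} {f : ℝ → Vec d → Vec d} {ψ : ℝ → Vec d → ℝ}
    (hf : IsBddFamily f) (hψ : IsBddFamily ψ) :
    ∃ a, (∀ r x, |source f ψ r x| ≤ a) ∧
      ∀ r x y, |source f ψ r x - source f ψ r y| ≤ a * ‖x - y‖ := by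
  obtain ⟨N, hN⟩ := hf.exists_bound
  obtain ⟨N', hN'⟩ := hf.exists_bound_fderiv
  obtain ⟨M, hM⟩ := hf.divergence.exists_bound
  obtain ⟨M', hM'⟩ := hf.divergence.exists_bound_fderiv
  obtain ⟨C, hC⟩ := hψ.exists_bound
  obtain ⟨C', hC'⟩ := hψ.exists_bound_fderiv
  obtain ⟨C'', hC''⟩ := hψ.bound 2
  have n0 : 0 ≤ N := (norm_nonneg _).trans (hN 0 0)
  have m0 : 0 ≤ M := (norm_nonneg _).trans (hM 0 0)
  have c0 : 0 ≤ C := (norm_nonneg _).trans (hC 0 0)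
  have c1 : 0 ≤ C' := (norm_nonneg _).trans (hC' 0 0)
  refine ⟨max (C' * N + M * C) (C'' * N + C' * N' + (M' * C + M * C')), fun r x => ?_,
    fun r x y => ?_⟩
  · refine le_max_of_le_left ((abs_add_le _ _).trans (add_le_add ?_ ?_))
    · exact ((fderiv ℝ (ψ r) x).le_opNorm _).trans
        (mul_le_mul (hC' r x) (hN r x) (norm_nonneg _) c1)
    · rw [abs_mul]
      exact mul_le_mul (hM r x) (hC r x) (abs_nonneg _) m0
  · refine le_trans ?_ (mul_le_mul_of_nonneg_right (le_max_right _ _) (norm_nonneg _))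
    have e : source f ψ r x - source f ψ r y =
        ((fderiv ℝ (ψ r) x - fderiv ℝ (ψ r) y) (f r x) + fderiv ℝ (ψ r) y (f r x - f r y)) +
        ((divergence (f r) x - divergence (f r) y) * ψ r x +
          divergence (f r) y * (ψ r x - ψ r y)) := by
      simp only [source, _root_.sub_apply, map_sub]
      ring
    have h1 := norm_fderiv_sub_le (hψ.contDiff 2 r) (hC'' r) y x
    have h2 := norm_sub_le_of_norm_fderiv_le (hf.contDiff 1 r) (hN' r) y x
    have h3 := norm_sub_le_of_norm_fderiv_le (hf.divergence.contDiff 1 r) (hM' r) y x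
    have h4 := norm_sub_le_of_norm_fderiv_le (hψ.contDiff 1 r) (hC' r) y x
    have p1 : |(fderiv ℝ (ψ r) x - fderiv ℝ (ψ r) y) (f r x)| ≤ C'' * ‖x - y‖ * N :=
      (ContinuousLinearMap.le_opNorm _ _).trans
        (mul_le_mul h1 (hN r x) (norm_nonneg _) ((norm_nonneg _).trans h1))
    have p2 : |fderiv ℝ (ψ r) y (f r x - f r y)| ≤ C' * (N' * ‖x - y‖) :=
      (ContinuousLinearMap.le_opNorm _ _).trans (mul_le_mul (hC' r y) h2 (norm_nonneg _) c1)
    have p3 : |(divergence (f r) x - divergence (f r) y) * ψ r x| ≤ M' * ‖x - y‖ * C := by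
      rw [abs_mul]
      exact mul_le_mul h3 (hC r x) (abs_nonneg _) ((norm_nonneg _).trans h3)
    have p4 : |divergence (f r) y * (ψ r x - ψ r y)| ≤ M * (C' * ‖x - y‖) := by
      rw [abs_mul]
      exact mul_le_mul (hM r y) h4 (abs_nonneg _) m0
    rw [e]
    refine (abs_add_le _ _).trans ((add_le_add ((abs_add_le _ _).trans (add_le_add p1 p2))
      ((abs_add_le _ _).trans (add_le_add p3 p4))).trans (le_of_eq ?_))
    ring

theorem IsBackwardTransport.exists_isBackwardFamily {d : ℕ} {T γ R : ℝ} {X : ℝ → Vec d}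
    {f : ℝ → Vec d → Vec d} {ψ : ℝ → Vec d → ℝ} (h : IsBackwardTransport T γ R X f ψ)
    (hX : IsHolder T γ X) (hγ : 0 < γ) (hγ1 : γ ≤ 1) (hT : 0 ≤ T) (hf : IsBddFamily f) :
    ∃ a, IsBackwardFamily T γ R a X f fun r => ψ (clamp T r) := by
  have hfam := h.isBddFamily hX hγ hγ1 hT
  obtain ⟨a₁, ha₁⟩ := hfam.exists_bound
  obtain ⟨a₂, ha₂⟩ := hfam.exists_bound_fderiv
  obtain ⟨a₃, ha₃⟩ := hfam.bound 2
  obtain ⟨a₄, ha₄, ha₄'⟩ := exists_source_lipschitz hf hfam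
  obtain ⟨a₅, -, ha₅⟩ := h.abs_sub_le hX hγ hγ1
  obtain ⟨a₆, -, ha₆⟩ := h.expansion
  set a := max (max a₁ a₂) (max (max a₃ a₄) (max a₅ a₆))
  have l1 : a₁ ≤ a := le_max_of_le_left (le_max_left _ _)
  have l2 : a₂ ≤ a := le_max_of_le_left (le_max_right _ _)
  have l3 : a₃ ≤ a := le_max_of_le_right (le_max_of_le_left (le_max_left _ _))
  have l4 : a₄ ≤ a := le_max_of_le_right (le_max_of_le_left (le_max_right _ _))
  have l5 : a₅ ≤ a := le_max_of_le_right (le_max_of_le_right (le_max_left _ _))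
  have l6 : a₆ ≤ a := le_max_of_le_right (le_max_of_le_right (le_max_right _ _))
  refine ⟨a, hf, hfam, fun r x hx => ?_, fun r x => (ha₁ r x).trans l1,
    fun r x => (ha₂ r x).trans l2, fun r x y => ?_, fun r x => (ha₄ r x).trans l4,
    fun r x y => (ha₄' r x y).trans (by gcongr), fun s hs t ht x => ?_, fun s t hs hst ht x => ?_⟩
  · by_contra h0
    exact absurd (h.support _ (clamp_mem hT r) x h0) (not_le.2 hx)
  · exact (norm_fderiv_sub_le (hfam.contDiff 2 r) (ha₃ r) y x).trans (by gcongr)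
  · simp only [clamp_of_mem hs, clamp_of_mem ht]
    exact (ha₅ s hs t ht x).trans (by gcongr)
  · have hs' : s ∈ Icc 0 T := ⟨hs, hst.trans ht⟩
    have ht' : t ∈ Icc 0 T := ⟨hs.trans hst, ht⟩
    have e : ∫ r in s..t, source f (fun r => ψ (clamp T r)) r x = ∫ r in s..t, source f ψ r x := by
      refine intervalIntegral.integral_congr fun r hr => ?_
      have := uIcc_subset_Icc hs' ht' hr
      simp only [source, clamp_of_mem this]
    rw [e]
    simp only [clamp_of_mem hs', clamp_of_mem ht']
    have := sub_nonneg.2 hst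
    exact (ha₆ s t hs hst ht x).trans (by gcongr)

/-! ### Commuting mollification with the transport operator -/

section Commutator

variable {d : ℕ} {U B Λ ε κ δ a : ℝ} {w φ φ' ρ : Vec d → ℝ} {v : Vec d → Vec d} {e : Vec d → ℝ}

theorem IsC1Supported.mono_radius {R R' : ℝ} (h : IsC1Supported a R φ) (hR : R ≤ R') :
    IsC1Supported a R' φ :=
  ⟨h.contDiff, h.bound, h.fderiv_bound, fun x hx => h.support x (hR.trans_lt hx)⟩

/-- Only Lipschitz bounds of `φ` and its gradient enter, not the size of the kernel. This is what
makes the error vanish with `ε`. -/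
theorem IsMollifier.isC1Supported_mollify_sub (hρ : IsMollifier ε ρ) (hε : 0 ≤ ε) (hε1 : ε ≤ 1)
    (hφ : IsTest φ) (hs : ∀ x, B < ‖x‖ → φ x = 0) (ha : 0 ≤ a)
    (hl : ∀ x y, |φ x - φ y| ≤ a * ‖x - y‖)
    (hl' : ∀ x y, ‖fderiv ℝ φ x - fderiv ℝ φ y‖ ≤ a * ‖x - y‖) :
    IsC1Supported (a * ε) (B + 1) fun x => mollify B ρ φ x - φ x := by
  obtain ⟨c, -, hc⟩ := hφ.exists_bound
  have hm : IsTest (mollify B ρ φ) :=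
    mollify_isTest hρ.test hρ.support (.of_continuous hφ.1.continuous hc)
  refine ⟨(hm.contDiff 1).sub (hφ.contDiff 1), fun x => ?_, fun x => ?_, fun x hx => ?_⟩
  · exact hρ.abs_mollify_sub_le hφ.1.continuous hs hl ha x
  · rw [fderiv_fun_sub ((hm.contDiff 1).differentiable one_ne_zero x)
      ((hφ.contDiff 1).differentiable one_ne_zero x)]
    refine ContinuousLinearMap.opNorm_le_bound _ (by positivity) fun z => ?_
    rw [_root_.sub_apply, hρ.fderiv_mollify_apply hφ hs]
    refine (hρ.abs_mollify_sub_le (ℓ := a * ‖z‖) (hφ.fderiv_apply z).1.continuous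
      (fun y hy => by rw [fderiv_eq_zero_of_norm_lt hs hy]; rfl) (fun x y => ?_)
      (by positivity) x).trans (le_of_eq (by ring))
    rw [← _root_.sub_apply]
    refine ((fderiv ℝ φ x - fderiv ℝ φ y).le_opNorm z).trans ?_
    refine (mul_le_mul_of_nonneg_right (hl' x y) (norm_nonneg _)).trans (le_of_eq (by ring))
  · rw [mollify_eq_zero hρ.support (by linarith), hs x (by linarith), sub_zero]

/-- The first term pays for changing the function and contains the kernel bound `κ`; the second pays
for mollifying and is free of `κ`. Derivatives fall on test functions only, so no regularity of `v`
is used beyond boundedness. -/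
theorem abs_pair_transport_mollify_sub_le (hw : IsBddSlice U w) (hv : IsLocBddSlice (B + 1) Λ v e)
    (hρ : IsMollifier ε ρ) (hε : 0 ≤ ε) (hε1 : ε ≤ 1) (hκ : ∀ z, |ρ z| ≤ κ)
    (hκ' : ∀ z, ‖fderiv ℝ ρ z‖ ≤ κ) (hφ : IsTest φ) (hφ' : IsTest φ')
    (hs : ∀ x, B < ‖x‖ → φ x = 0)
    (hδ : ∀ x, |φ' x - φ x| ≤ δ) (ha : 0 ≤ a)
    (hl : ∀ x y, |φ x - φ y| ≤ a * ‖x - y‖)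
    (hl' : ∀ x y, ‖fderiv ℝ φ x - fderiv ℝ φ y‖ ≤ a * ‖x - y‖) :
    |pair w (transport v e (mollify B ρ φ')) - pair w (transport v e φ)| ≤
      U * (2 * Λ * (δ * κ * ballVolume d B) * ballVolume d (B + 1)) +
        U * (2 * Λ * (a * ε) * ballVolume d (B + 1)) := by
  obtain ⟨c, -, hc⟩ := hφ.exists_bound
  obtain ⟨c', -, hc'⟩ := hφ'.exists_bound
  have g : IsBddSlice c φ := .of_continuous hφ.1.continuous hc
  have g' : IsBddSlice c' φ' := .of_continuous hφ'.1.continuous hc'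
  have gd : IsBddSlice δ fun x => φ' x - φ x :=
    .of_continuous (hφ'.1.continuous.sub hφ.1.continuous) hδ
  have m := mollify_isTest (B := B) hρ.test hρ.support g
  have m' := mollify_isTest (B := B) hρ.test hρ.support g'
  have k1 : IsC1Supported (δ * κ * ballVolume d B) (B + 1)
      (fun x => mollify B ρ φ' x - mollify B ρ φ x) := by
    rw [← mollify_sub hρ.test.1.continuous g' g]
    exact (mollify_isC1Supported hρ.test hρ.support hκ hκ' gd).mono_radius (by linarith)
  have k2 := hρ.isC1Supported_mollify_sub hε hε1 hφ hs ha hl hl'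
  have e1 : transport v e (mollify B ρ φ') = fun x =>
      transport v e φ x + (transport v e (fun x => mollify B ρ φ' x - mollify B ρ φ x) x +
        transport v e (fun x => mollify B ρ φ x - φ x) x) := by
    funext x
    rw [transport_sub (m'.contDiff 1) (m.contDiff 1), transport_sub (m.contDiff 1) (hφ.contDiff 1)]
    ring
  have b1 := hv.isBddSupported k1
  have b2 := hv.isBddSupported k2
  obtain ⟨a₀, R₀, h0⟩ := hφ.exists_isC1Supported
  have b0 := hv.isBddSupported (φ := φ) (a := a₀)
    ⟨h0.contDiff, h0.bound, h0.fderiv_bound, fun x hx => hs x (by linarith)⟩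
  have b3 : Integrable fun x => transport v e (fun x => mollify B ρ φ' x - mollify B ρ φ x) x +
      transport v e (fun x => mollify B ρ φ x - φ x) x := b1.integrable.add b2.integrable
  rw [e1, hw.pair_add b0.integrable b3,
    hw.pair_add b1.integrable b2.integrable, add_sub_cancel_left]
  exact (abs_add_le _ _).trans (add_le_add (hw.abs_pair_le b1) (hw.abs_pair_le b2))

end Commutator

/-! ### The duality identity -/

/-- The density of `t ↦ u_t(ψ_t)`. -/
def defect {d : ℕ} (b : ℝ → Vec d → Vec d) (divb : ℝ → Vec d → ℝ) (f : ℝ → Vec d → Vec d)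
    (u ψ : ℝ → Vec d → ℝ) (r : ℝ) : ℝ :=
  pair (u r) (transport (b r) (divb r) (ψ r)) - pair (u r) (source f ψ r)

namespace IsBackwardFamily

variable {d : ℕ} {T γ R a : ℝ} {X : ℝ → Vec d} {f : ℝ → Vec d → Vec d} {ψ : ℝ → Vec d → ℝ}

theorem nonneg (h : IsBackwardFamily T γ R a X f ψ) : 0 ≤ a := (abs_nonneg _).trans (h.bound 0 0)

theorem isTest (h : IsBackwardFamily T γ R a X f ψ) (r : ℝ) : IsTest (ψ r) :=
  isTest_of_support (h.family.smooth r) (h.support r)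

theorem isC1Supported (h : IsBackwardFamily T γ R a X f ψ) (r : ℝ) : IsC1Supported a R (ψ r) :=
  ⟨h.family.contDiff 1 r, h.bound r, h.fderiv_bound r, h.support r⟩

theorem lipschitz (h : IsBackwardFamily T γ R a X f ψ) (r : ℝ) (x y : Vec d) :
    |ψ r x - ψ r y| ≤ a * ‖x - y‖ :=
  norm_sub_le_of_norm_fderiv_le (h.family.contDiff 1 r) (h.fderiv_bound r) y x

theorem stronglyMeasurable_source (h : IsBackwardFamily T γ R a X f ψ) :
    StronglyMeasurable (Function.uncurry (source f ψ)) :=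
  (isBoundedBilinearMap_apply.continuous.comp_stronglyMeasurable
    (h.family.fderiv.stronglyMeasurable_uncurry.prodMk h.drift.stronglyMeasurable_uncurry)).add
    (h.drift.divergence.stronglyMeasurable_uncurry.mul h.family.stronglyMeasurable_uncurry)

theorem continuous_source (h : IsBackwardFamily T γ R a X f ψ) (r : ℝ) :
    Continuous (source f ψ r) :=
  ((h.family.fderiv.smooth r).continuous.clm_apply (h.drift.smooth r).continuous).add
    ((h.drift.divergence.smooth r).continuous.mul (h.family.smooth r).continuous)

theorem source_support (h : IsBackwardFamily T γ R a X f ψ) (r : ℝ) {x : Vec d} (hx : R < ‖x‖) :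
    source f ψ r x = 0 := transport_eq_zero (h.isC1Supported r) hx

theorem isBddSupported_source (h : IsBackwardFamily T γ R a X f ψ) (r : ℝ) :
    IsBddSupported a R (source f ψ r) :=
  .of_continuous (h.continuous_source r) (h.source_bound r) fun _ hx => h.source_support r hx

theorem continuous_integral_source (h : IsBackwardFamily T γ R a X f ψ) (s t : ℝ) :
    Continuous fun x => ∫ r in s..t, source f ψ r x := by
  refine intervalIntegral.continuous_of_dominated_interval (bound := fun _ => a) (fun x => ?_)
    (fun x => .of_forall fun r _ => h.source_bound r x) intervalIntegrable_const
    (.of_forall fun r _ => h.continuous_source r)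
  exact (h.stronglyMeasurable_source.comp_measurable
    (measurable_id.prodMk measurable_const)).aestronglyMeasurable

theorem abs_integral_source_le (h : IsBackwardFamily T γ R a X f ψ) {s t : ℝ} (hst : s ≤ t)
    (x : Vec d) : |∫ r in s..t, source f ψ r x| ≤ a * (t - s) := by
  have := intervalIntegral.norm_integral_le_of_norm_le_const (a := s) (b := t)
    (f := fun r => source f ψ r x) fun r _ => h.source_bound r x
  rwa [abs_of_nonneg (sub_nonneg.2 hst)] at this

end IsBackwardFamily

namespace IsTransportSolution

variable {d : ℕ} {T γ t₀ R a : ℝ} {X : ℝ → Vec d} {XX : ℝ → ℝ → Matrix (Fin d) (Fin d) ℝ}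
  {b f : ℝ → Vec d → Vec d} {divb : ℝ → Vec d → ℝ} {u ψ : ℝ → Vec d → ℝ}

theorem intervalIntegrable_pair_transport (h : IsTransportSolution T γ X XX b divb u)
    (hψ : IsBackwardFamily t₀ γ R a X f ψ) {s t : ℝ} (hs : s ∈ Icc 0 T) (ht : t ∈ Icc 0 T) :
    IntervalIntegrable (fun r => pair (u r) (transport (b r) (divb r) (ψ r))) volume s t := by
  obtain ⟨Λ, hΛ⟩ := h.drift.exists_isLocBddField R
  exact intervalIntegrable_integral_slab (integrable_transport hΛ h.solution.mem
    (fun r _ => hψ.isC1Supported r) hψ.family.stronglyMeasurable_uncurry.aestronglyMeasurable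
    hψ.family.fderiv.stronglyMeasurable_uncurry.aestronglyMeasurable) hs ht

theorem intervalIntegrable_pair_source (h : IsTransportSolution T γ X XX b divb u)
    (hψ : IsBackwardFamily t₀ γ R a X f ψ) {s t : ℝ} (hs : s ∈ Icc 0 T) (ht : t ∈ Icc 0 T) :
    IntervalIntegrable (fun r => pair (u r) (source f ψ r)) volume s t := by
  obtain ⟨Λ, hΛ⟩ := hψ.drift.exists_isLocBddField T R
  exact intervalIntegrable_integral_slab (integrable_transport hΛ h.solution.mem
    (fun r _ => hψ.isC1Supported r) hψ.family.stronglyMeasurable_uncurry.aestronglyMeasurable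
    hψ.family.fderiv.stronglyMeasurable_uncurry.aestronglyMeasurable) hs ht

theorem intervalIntegrable_defect (h : IsTransportSolution T γ X XX b divb u)
    (hψ : IsBackwardFamily t₀ γ R a X f ψ) {s t : ℝ} (hs : s ∈ Icc 0 T) (ht : t ∈ Icc 0 T) :
    IntervalIntegrable (defect b divb f u ψ) volume s t :=
  (h.intervalIntegrable_pair_transport hψ hs ht).sub (h.intervalIntegrable_pair_source hψ hs ht)

/-- Over a short interval the mollified duality pairing grows like the integral of the defect. -/
theorem exists_abs_increment_sub_le (h : IsTransportSolution T γ X XX b divb u)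
    (ht₀ : t₀ ∈ Icc 0 T) (hψ : IsBackwardFamily t₀ γ R a X f ψ) :
    ∃ B C, R ≤ B ∧ 0 ≤ C ∧ ∀ ε, 0 < ε → ε ≤ 1 → ∀ ρ, IsMollifier ε ρ → ∃ K, 0 ≤ K ∧
      ∀ s t, 0 ≤ s → s ≤ t → t ≤ t₀ →
        |pair (u t) (mollify B ρ (ψ t)) - pair (u s) (mollify B ρ (ψ s)) -
          ∫ r in s..t, defect b divb f u ψ r| ≤
          K * (t - s) ^ (3 * γ) + ε * C * (t - s) := by
  obtain ⟨H, Δ, hH0, hΔ0, hX⟩ := h.exists_path_bound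
  -- `Δ` bounds every displacement of the path, so all translated supports lie in the ball of radius
  -- `B`.
  set B := R + Δ with hB
  have hRB : R ≤ B := by linarith
  obtain ⟨Λ, hΛ⟩ := h.drift.exists_isLocBddField (B + 1)
  have hΛ0 := hΛ.nonneg
  have hγ := h.exponent_pos
  have ha := hψ.nonneg
  have hT := h.time_pos.le
  set U := supNorm d T u
  have hU0 : 0 ≤ U := ENNReal.toReal_nonneg
  set V := ballVolume d B
  have hV0 : 0 ≤ V := ballVolume_nonneg d B
  set W := ballVolume d (B + 1)
  have hW0 : 0 ≤ W := ballVolume_nonneg d _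
  -- Only this constant must be independent of the mollifier, since it multiplies the linear error.
  -- `K` below may depend on `ρ`.
  refine ⟨B, U * (2 * Λ * a * W) + U * (a * W), hRB, by positivity,
    fun ε hε hε1 ρ hρ => ?_⟩
  obtain ⟨K₁, hK₁0, hK₁⟩ := h.exists_abs_translate_le B hρ.test hρ.support
  obtain ⟨K₂, hK₂0, hK₂⟩ := h.exists_abs_pair_mollify_sub_le B hρ.test hρ.support
  obtain ⟨κ, R', hκ⟩ := hρ.test.exists_isC1Supported
  have hκ0 := hκ.nonneg
  set K₃ := U * (2 * Λ * (a * κ * V) * W) + K₂ * a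
  have hK₃0 : 0 ≤ K₃ := by positivity
  refine ⟨K₁ * a + (U * (a * κ * V * W) + K₃) * T ^ (1 - 2 * γ), by positivity,
    fun s t hs hst ht => ?_⟩
  have hs₀ : s ∈ Icc 0 t₀ := ⟨hs, hst.trans ht⟩
  have ht₀' : t ∈ Icc 0 t₀ := ⟨hs.trans hst, ht⟩
  have hs' : s ∈ Icc 0 T := ⟨hs, hs₀.2.trans ht₀.2⟩
  have ht' : t ∈ Icc 0 T := ⟨ht₀'.1, ht.trans ht₀.2⟩
  have hτ0 : 0 ≤ t - s := sub_nonneg.2 hst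
  have hτ : 0 ≤ (t - s) ^ γ := Real.rpow_nonneg hτ0 _
  set v := X t - X s with hv
  have hBv : R + ‖v‖ ≤ B := by linarith [(hX s t hs hst ht'.2).2]
  have cρ := hρ.test.1.continuous
  have cψ : ∀ r, Continuous (ψ r) := fun r => (hψ.family.smooth r).continuous
  have gψ : ∀ r, IsBddSlice a (ψ r) := fun r => .of_continuous (cψ r) (hψ.bound r)
  have gS : ∀ r, IsBddSlice a (source f ψ r) := fun r =>
    .of_continuous (hψ.continuous_source r) (hψ.source_bound r)
  set I : Vec d → ℝ := fun x => ∫ r in s..t, source f ψ r x with hI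
  have gI : IsBddSlice (a * (t - s)) I := .of_continuous (hψ.continuous_integral_source s t)
    (hψ.abs_integral_source_le hst)
  have gv : IsBddSlice a fun x => ψ t (x + v) := .of_continuous
    ((cψ t).comp (continuous_id.add continuous_const)) fun x => hψ.bound t _
  have ge : IsBddSlice (a * ((t - s) ^ γ * (t - s))) fun x => ψ s x - ψ t (x + v) - I x :=
    .of_continuous (((cψ s).sub ((cψ t).comp (continuous_id.add continuous_const))).sub
      (hψ.continuous_integral_source s t)) (hψ.expansion s t hs hst ht)
  have tests : ∀ {c : ℝ} {g : Vec d → ℝ}, IsBddSlice c g → Integrable (mollify B ρ g) :=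
    fun hg => (mollify_isTest hρ.test hρ.support hg).integrable
  have gE : IsBddSlice (a + a) fun x => ψ s x - ψ t (x + v) := (gψ s).sub gv
  -- the increment of the test function
  have e1 : pair (u s) (fun x => mollify B ρ (ψ t) (x + v)) = pair (u s) (mollify B ρ (ψ s)) -
      (∫ r in s..t, pair (u s) (mollify B ρ (source f ψ r))) -
      pair (u s) (mollify B ρ fun x => ψ s x - ψ t (x + v) - I x) := by
    have e2 : (fun x => mollify B ρ (ψ t) (x + v)) = mollify B ρ fun x => ψ t (x + v) :=
      funext fun x => mollify_translate (hψ.support t) hBv x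
    have i0 : Integrable fun x => mollify B ρ (ψ s) x - mollify B ρ (fun x => ψ t (x + v)) x :=
      (tests (gψ s)).sub (tests gv)
    rw [e2, mollify_sub cρ gE gI, mollify_sub cρ (gψ s) gv,
      (h.slice hs').pair_sub i0 (tests gI),
      (h.slice hs').pair_sub (tests (gψ s)) (tests gv),
      (pair_mollify_integral (h.slice hs') hρ.test hρ.support B hst
        hψ.stronglyMeasurable_source.aestronglyMeasurable (fun r _ => gS r)
        (fun r _ => hψ.source_bound r) gI).2]
    ring
  have i1 := (pair_mollify_integral (h.slice hs') hρ.test hρ.support B hst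
        hψ.stronglyMeasurable_source.aestronglyMeasurable (fun r _ => gS r)
        (fun r _ => hψ.source_bound r) gI).1
  have hφ1 := mollify_isC1Supported (B := B) hρ.test hρ.support hκ.bound hκ.fderiv_bound (gψ t)
  have i2 := h.intervalIntegrable_drift hφ1 hs' ht'
  have i3 := h.intervalIntegrable_defect hψ hs' ht'
  have b1 := hK₁ s t hs hst ht'.2 a (ψ t) (cψ t) (hψ.bound t)
  have b2 : |pair (u s) (mollify B ρ fun x => ψ s x - ψ t (x + v) - I x)| ≤
      U * (a * ((t - s) ^ γ * (t - s)) * κ * V * W) :=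
    (h.slice hs').abs_pair_le ((mollify_isC1Supported hρ.test hρ.support hκ.bound
      hκ.fderiv_bound ge).mono_radius (by linarith)).isBddSupported
  -- Three replacements in the integrand: `ψ t` by `ψ r` and `u s` by `u r`, each of order `(t -
  -- s)^γ` with a constant depending on the kernel, and removal of the mollifier, of order `ε`.
  have b3 : |∫ r in s..t, (pair (u r) (transport (b r) (divb r) (mollify B ρ (ψ t))) -
      pair (u s) (mollify B ρ (source f ψ r)) - defect b divb f u ψ r)| ≤
      (K₃ * (t - s) ^ γ + ε * (U * (2 * Λ * a * W) + U * (a * W))) * (t - s) := by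
    have hb : ∀ᵐ r, r ∈ uIoc s t →
        ‖pair (u r) (transport (b r) (divb r) (mollify B ρ (ψ t))) -
          pair (u s) (mollify B ρ (source f ψ r)) - defect b divb f u ψ r‖ ≤
        K₃ * (t - s) ^ γ + ε * (U * (2 * Λ * a * W) + U * (a * W)) := by
      filter_upwards [h.ae_slices hΛ hs' ht'] with r hr hrm
      obtain ⟨hw, hbs⟩ := hr hrm
      rw [uIoc_of_le hst] at hrm
      have hr₀ : r ∈ Icc 0 t₀ := ⟨hs.trans hrm.1.le, hrm.2.trans ht⟩
      have d1 : ∀ x, |ψ t x - ψ r x| ≤ a * (t - s) ^ γ := fun x => by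
        refine (hψ.holder r hr₀ t ht₀' x).trans ?_
        have h1 : |t - r| = t - r := abs_of_nonneg (by linarith [hrm.2])
        have h2 : t - r ≤ t - s := by linarith [hrm.1]
        rw [h1]
        have h3 : 0 ≤ t - r := by linarith [hrm.2]
        gcongr
      have c1 := abs_pair_transport_mollify_sub_le hw hbs hρ hε.le hε1 hκ.bound hκ.fderiv_bound
        (hψ.isTest r) (hψ.isTest t) (fun x hx => hψ.support r x (hRB.trans_lt hx)) d1 ha
        (hψ.lipschitz r) (hψ.fderiv_lipschitz r)
      have c2 : |pair (u r) (fun x => mollify B ρ (source f ψ r) x - source f ψ r x)| ≤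
          U * (a * ε * W) := by
        refine hw.abs_pair_le (.of_continuous ((mollify_isTest hρ.test hρ.support
          (gS r)).1.continuous.sub (hψ.continuous_source r))
          (hρ.abs_mollify_sub_le (hψ.continuous_source r)
            (fun y hy => hψ.source_support r (hRB.trans_lt hy)) (hψ.source_lipschitz r) ha)
          fun x hx => ?_)
        rw [mollify_eq_zero hρ.support (by linarith), hψ.source_support r (by linarith), sub_zero]
      rw [hw.pair_sub (tests (gS r)) (hψ.isBddSupported_source r).integrable] at c2
      have c3 : |pair (u r) (mollify B ρ (source f ψ r)) -
          pair (u s) (mollify B ρ (source f ψ r))| ≤ K₂ * a * (t - s) ^ γ := by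
        refine (hK₂ s r hs hrm.1.le (hr₀.2.trans ht₀.2) a _ (hψ.continuous_source r)
          (hψ.source_bound r)).trans ?_
        have h3 : 0 ≤ r - s := by linarith [hrm.1]
        have h2 : r - s ≤ t - s := by linarith [hrm.2]
        gcongr
      have e : pair (u r) (transport (b r) (divb r) (mollify B ρ (ψ t))) -
          pair (u s) (mollify B ρ (source f ψ r)) - defect b divb f u ψ r =
          (pair (u r) (transport (b r) (divb r) (mollify B ρ (ψ t))) -
            pair (u r) (transport (b r) (divb r) (ψ r))) -
          (pair (u r) (mollify B ρ (source f ψ r)) - pair (u r) (source f ψ r)) +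
          (pair (u r) (mollify B ρ (source f ψ r)) -
            pair (u s) (mollify B ρ (source f ψ r))) := by
        rw [defect]; ring
      rw [e]
      refine ((abs_add_le _ _).trans (add_le_add ((abs_sub _ _).trans (add_le_add c1 c2))
        c3)).trans (le_of_eq ?_)
      simp only [K₃]
      ring
    have := intervalIntegral.norm_integral_le_of_norm_le_const_ae hb
    rwa [abs_of_nonneg hτ0] at this
  rw [intervalIntegral.integral_sub (i2.sub i1) i3, intervalIntegral.integral_sub i2 i1] at b3
  have e : pair (u t) (mollify B ρ (ψ t)) - pair (u s) (mollify B ρ (ψ s)) -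
      ∫ r in s..t, defect b divb f u ψ r =
      (pair (u t) (mollify B ρ (ψ t)) - pair (u s) (fun x => mollify B ρ (ψ t) (x + v)) -
        driftIntegral b divb u s t (mollify B ρ (ψ t))) -
      pair (u s) (mollify B ρ fun x => ψ s x - ψ t (x + v) - I x) +
      ((∫ r in s..t, pair (u r) (transport (b r) (divb r) (mollify B ρ (ψ t)))) -
        (∫ r in s..t, pair (u s) (mollify B ρ (source f ψ r))) -
        ∫ r in s..t, defect b divb f u ψ r) := by
    rw [e1, driftIntegral]; ring
  -- Here `γ ≤ 1/2` enters: `1 + γ ≥ 3γ`.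
  have p : (t - s) ^ γ * (t - s) ≤ T ^ (1 - 2 * γ) * (t - s) ^ (3 * γ) := by
    have h1 : 0 ≤ 1 - 2 * γ := by linarith [h.exponent_le]
    have e : (t - s) ^ γ * (t - s) = (t - s) ^ (1 - 2 * γ) * (t - s) ^ (3 * γ) := by
      rw [← Real.rpow_add_of_nonneg hτ0 h1 (by positivity)]
      conv_lhs => rw [← Real.rpow_one (t - s), ← Real.rpow_mul hτ0,
        ← Real.rpow_add_of_nonneg hτ0 (by linarith) zero_le_one]
      congr 1
      ring
    rw [e]
    gcongr
    linarith [ht'.2]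
  rw [e]
  refine ((abs_add_le _ _).trans (add_le_add ((abs_sub _ _).trans (add_le_add b1 b2))
    b3)).trans ?_
  calc _ = K₁ * a * (t - s) ^ (3 * γ) +
        (U * (a * κ * V * W) + K₃) * ((t - s) ^ γ * (t - s)) +
        ε * (U * (2 * Λ * a * W) + U * (a * W)) * (t - s) := by ring
    _ ≤ K₁ * a * (t - s) ^ (3 * γ) +
        (U * (a * κ * V * W) + K₃) * (T ^ (1 - 2 * γ) * (t - s) ^ (3 * γ)) +
        ε * (U * (2 * Λ * a * W) + U * (a * W)) * (t - s) := by gcongr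
    _ = _ := by ring

/-- The order of limits is essential. For a fixed mollifier the superlinear error is removed by
refining the partition, leaving `ε C t₀` and the cost of unmollifying at the final time; only then
does `ε` tend to `0`. -/
theorem pair_eq_integral_defect (h : IsTransportSolution T γ X XX b divb u)
    (ht₀ : t₀ ∈ Icc 0 T) (hψ : IsBackwardFamily t₀ γ R a X f ψ) :
    pair (u t₀) (ψ t₀) = ∫ r in (0 : ℝ)..t₀, defect b divb f u ψ r := by
  obtain ⟨B, C, hRB, hC0, H⟩ := h.exists_abs_increment_sub_le ht₀ hψ
  have h0 : (0 : ℝ) ∈ Icc 0 T := ⟨le_rfl, h.time_pos.le⟩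
  have ha := hψ.nonneg
  set U := supNorm d T u
  set W := ballVolume d (B + 1)
  have hU0 : 0 ≤ U := ENNReal.toReal_nonneg
  have hW0 : 0 ≤ W := ballVolume_nonneg d _
  have hc : ∀ r, IsBddSlice a (ψ r) := fun r =>
    .of_continuous (hψ.family.smooth r).continuous (hψ.bound r)
  have key : ∀ ε, 0 < ε → ε ≤ 1 →
      |pair (u t₀) (ψ t₀) - ∫ r in (0 : ℝ)..t₀, defect b divb f u ψ r| ≤
        ε * (C * t₀ + U * (a * W)) := by
    intro ε hε hε1
    obtain ⟨ρ, hρ⟩ := exists_isMollifier d hε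
    obtain ⟨K, hK0, hK⟩ := H ε hε hε1 ρ hρ
    have b1 := abs_sub_le_of_local (J := fun t => pair (u t) (mollify B ρ (ψ t)) -
      ∫ r in (0 : ℝ)..t, defect b divb f u ψ r) (ε := ε * C) ht₀.1 hK0
      (by linarith [h.lt_exponent] : 1 < 3 * γ) fun s t hs hst ht => by
        have e : (∫ r in (0 : ℝ)..t, defect b divb f u ψ r) -
            (∫ r in (0 : ℝ)..s, defect b divb f u ψ r) = ∫ r in s..t, defect b divb f u ψ r :=
          intervalIntegral.integral_interval_sub_left
            (h.intervalIntegrable_defect hψ h0 ⟨hs.trans hst, ht.trans ht₀.2⟩)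
            (h.intervalIntegrable_defect hψ h0 ⟨hs, (hst.trans ht).trans ht₀.2⟩)
        have := hK s t hs hst ht
        rw [← e] at this
        convert this using 2
        ring
    simp only [intervalIntegral.integral_same, sub_zero] at b1
    rw [h.pair_zero_eq_zero (mollify_isTest hρ.test hρ.support (hc 0)), sub_zero] at b1
    have k2 := hρ.isC1Supported_mollify_sub hε.le hε1 (hψ.isTest t₀)
      (fun x hx => hψ.support t₀ x (hRB.trans_lt hx)) ha (hψ.lipschitz t₀)
      (hψ.fderiv_lipschitz t₀)
    have b2 := (h.slice ht₀).abs_pair_le k2.isBddSupported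
    rw [(h.slice ht₀).pair_sub (mollify_isTest hρ.test hρ.support (hc t₀)).integrable
      (hψ.isTest t₀).integrable] at b2
    have e : pair (u t₀) (ψ t₀) - ∫ r in (0 : ℝ)..t₀, defect b divb f u ψ r =
        (pair (u t₀) (mollify B ρ (ψ t₀)) - ∫ r in (0 : ℝ)..t₀, defect b divb f u ψ r) -
        (pair (u t₀) (mollify B ρ (ψ t₀)) - pair (u t₀) (ψ t₀)) := by ring
    rw [e]
    refine ((abs_sub _ _).trans (add_le_add b1 b2)).trans (le_of_eq ?_)
    ring
  refine sub_eq_zero.1 (abs_nonpos_iff.1 ?_)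
  refine tendsto_const_mul_le (b := C * t₀ + U * (a * W)) fun ε hε => ?_
  refine (key (min ε 1) (by positivity) (min_le_right _ _)).trans ?_
  have := ht₀.1
  gcongr
  exact min_le_left _ _

end IsTransportSolution

/-! ### Distributional divergences -/

theorem integrable_clm_apply {d : ℕ} {A : Vec d → Vec d →L[ℝ] ℝ} (hA : Continuous A)
    (hc : HasCompactSupport A) {v : Vec d → Vec d} (hv : LocallyIntegrable v) :
    Integrable fun x => A x (v x) := by
  have h1 : LocallyIntegrable fun x => ‖v x‖ := hv.mono hv.aestronglyMeasurable.norm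
    (.of_forall fun x => by simp)
  refine (h1.integrable_smul_left_of_hasCompactSupport hA.norm hc.norm).mono'
    (isBoundedBilinearMap_apply.continuous.comp_aestronglyMeasurable
      (hA.aestronglyMeasurable.prodMk hv.aestronglyMeasurable))
    (.of_forall fun x => (A x).le_opNorm _)

theorem IsTest.mul {d : ℕ} {φ φ' : Vec d → ℝ} (h : IsTest φ) (h' : IsTest φ') :
    IsTest fun x => φ x * φ' x := ⟨h.1.mul h'.1, h.2.mul_right⟩

namespace IsWeakDiv

variable {d : ℕ} {v v' : Vec d → Vec d} {g g' : Vec d → ℝ} {ψ : Vec d → ℝ}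

theorem sub (h : IsWeakDiv v g) (h' : IsWeakDiv v' g') :
    IsWeakDiv (fun x => v x - v' x) fun x => g x - g' x := by
  refine ⟨h.field_int.sub h'.field_int, h.div_int.sub h'.div_int, fun φ hφ => ?_⟩
  have c := (hφ.contDiff 1).continuous_fderiv one_ne_zero
  have k := hφ.2.fderiv ℝ
  have j : ∀ {g : Vec d → ℝ}, LocallyIntegrable g → Integrable fun x => g x * φ x := fun hg =>
    hg.integrable_smul_right_of_hasCompactSupport hφ.1.continuous hφ.2
  simp only [map_sub, sub_mul]
  rw [integral_sub (integrable_clm_apply c k h.field_int) (integrable_clm_apply c k h'.field_int),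
    integral_sub (j h.div_int) (j h'.div_int), h.parts φ hφ, h'.parts φ hφ]
  ring

/-- Test the equation for `v` with `φ ψ` and apply the product rule. -/
theorem smul_test (h : IsWeakDiv v g) (hψ : IsTest ψ) :
    IsWeakDiv (fun x => ψ x • v x) fun x => fderiv ℝ ψ x (v x) + g x * ψ x := by
  have c := (hψ.contDiff 1).continuous_fderiv one_ne_zero
  have k := hψ.2.fderiv ℝ
  have j : ∀ {φ : Vec d → ℝ}, IsTest φ → Integrable fun x => g x * φ x := fun hφ =>
    h.div_int.integrable_smul_right_of_hasCompactSupport hφ.1.continuous hφ.2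
  refine ⟨(h.field_int.integrable_smul_left_of_hasCompactSupport hψ.1.continuous
    hψ.2).locallyIntegrable, ((integrable_clm_apply c k h.field_int).add (j hψ)).locallyIntegrable,
    fun φ hφ => ?_⟩
  have c' := (hφ.contDiff 1).continuous_fderiv one_ne_zero
  have P := h.parts _ (hφ.mul hψ)
  have e : ∀ x, fderiv ℝ (fun x => φ x * ψ x) x (v x) =
      φ x * fderiv ℝ ψ x (v x) + ψ x * fderiv ℝ φ x (v x) := fun x => by
    rw [fderiv_fun_mul ((hφ.contDiff 1).differentiable one_ne_zero x)
      ((hψ.contDiff 1).differentiable one_ne_zero x)]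
    rfl
  have i1 : Integrable fun x => φ x * fderiv ℝ ψ x (v x) :=
    integrable_clm_apply (A := fun x => φ x • fderiv ℝ ψ x) (hφ.1.continuous.smul c) hφ.2.smul_right
      h.field_int
  have i2 : Integrable fun x => ψ x * fderiv ℝ φ x (v x) :=
    integrable_clm_apply (A := fun x => ψ x • fderiv ℝ φ x) (hψ.1.continuous.smul c') hψ.2.smul_right
      h.field_int
  simp only [e] at P
  rw [integral_add i1 i2] at P
  simp only [map_smul, smul_eq_mul, add_mul]
  have e2 : ∀ x, fderiv ℝ ψ x (v x) * φ x + g x * ψ x * φ x =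
      φ x * fderiv ℝ ψ x (v x) + g x * (φ x * ψ x) := fun x => by ring
  simp only [e2]
  rw [integral_add i1 (j (hφ.mul hψ))]
  linarith

/-- The divergence theorem for `C^1` fields. -/
theorem of_contDiff (hv : ContDiff ℝ 1 v) : IsWeakDiv v (divergence v) := by
  have hcd : Continuous (divergence v) := by
    unfold divergence
    have := hv.continuous_fderiv one_ne_zero
    fun_prop
  refine ⟨hv.continuous.locallyIntegrable, hcd.locallyIntegrable, fun φ hφ => ?_⟩
  have hvi : ∀ i, ContDiff ℝ 1 fun x => v x i := fun i => by fun_prop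
  have hd : ∀ i x, fderiv ℝ (fun x => v x i) x (EuclideanSpace.single i 1) =
      (fderiv ℝ v x (EuclideanSpace.single i 1)) i := fun i x => by
    have : HasFDerivAt (fun x => v x i) ((EuclideanSpace.proj (𝕜 := ℝ) i).comp (fderiv ℝ v x)) x :=
      (EuclideanSpace.proj (𝕜 := ℝ) i).hasFDerivAt.comp x
        (hv.differentiable one_ne_zero x).hasFDerivAt
    rw [this.fderiv]
    rfl
  have I : ∀ {k : Vec d → ℝ}, Continuous k → ∀ {φ : Vec d → ℝ}, IsTest φ →
      Integrable fun x => k x * φ x := fun hk _ hφ =>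
    (hk.mul hφ.1.continuous).integrable_of_hasCompactSupport hφ.2.mul_left
  have cd : ∀ i, Continuous fun x => fderiv ℝ (fun x => v x i) x (EuclideanSpace.single i 1) :=
    fun i => ((hvi i).continuous_fderiv one_ne_zero).clm_apply continuous_const
  have P : ∀ i, ∫ x, v x i * pd i φ x =
      -∫ x, fderiv ℝ (fun x => v x i) x (EuclideanSpace.single i 1) * φ x := fun i =>
    integral_mul_fderiv_eq_neg_fderiv_mul_of_integrable (I (cd i) hφ)
      (I (hvi i).continuous (hφ.pd i)) (I (hvi i).continuous hφ)
      (fun x _ => (hvi i).differentiable one_ne_zero x)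
      fun x _ => (hφ.contDiff 1).differentiable one_ne_zero x
  have e1 : ∀ x, fderiv ℝ φ x (v x) = ∑ i, v x i * pd i φ x := fun x => by
    rw [fderiv_apply_eq_sum_pd]
    exact Finset.sum_congr rfl fun i _ => mul_comm _ _
  have e2 : ∀ x, divergence v x * φ x =
      ∑ i, fderiv ℝ (fun x => v x i) x (EuclideanSpace.single i 1) * φ x := fun x => by
    rw [divergence, Finset.sum_mul]
    exact Finset.sum_congr rfl fun i _ => by rw [hd]
  simp only [e1, e2]
  rw [integral_finsetSum _ fun i _ => I (hvi i).continuous (hφ.pd i),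
    integral_finsetSum _ fun i _ => I (cd i) hφ, ← Finset.sum_neg_distrib]
  exact Finset.sum_congr rfl fun i _ => P i

end IsWeakDiv

/-! ### The divergence of the difference of the drifts -/

section Difference

variable {d : ℕ} {T γ t₀ R a : ℝ} {X : ℝ → Vec d} {XX : ℝ → ℝ → Matrix (Fin d) (Fin d) ℝ}
  {b b' f : ℝ → Vec d → Vec d} {divb : ℝ → Vec d → ℝ} {u ψ ψ' : ℝ → Vec d → ℝ}

theorem divDiff_eq {r : ℝ} (hf : f r = b' r) (hψ : ψ r = ψ' r) :
    divDiff b divb b' ψ r = transport (fun x => b r x - f r x)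
      (fun x => divb r x - divergence (f r) x) (ψ' r) := by
  funext x
  rw [divDiff, hf, hψ, transport]

theorem ae_isWeakDiv_divDiff (hb : IsLinDrift T b divb) (ht₀ : t₀ ∈ Icc 0 T)
    (hψ : IsBackwardFamily t₀ γ R a X f ψ')
    (hfb : ∀ᵐ t ∂(volume.restrict (Icc 0 T)), f t = b' t) (he : ∀ q ∈ Icc 0 t₀, ψ q = ψ' q) :
    ∀ᵐ q ∂(volume.restrict (Icc 0 t₀)),
      IsWeakDiv (fun x => ψ q x • (b q x - b' q x)) (divDiff b divb b' ψ q) := by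
  have hm : volume.restrict (Icc 0 t₀) ≤ volume.restrict (Icc 0 T) :=
    Measure.restrict_mono (Icc_subset_Icc_right ht₀.2) le_rfl
  filter_upwards [ae_mono hm hb.isDiv, ae_mono hm hfb, ae_restrict_mem measurableSet_Icc]
    with q h1 h2 h3
  rw [divDiff_eq h2 (he q h3), he q h3, ← h2]
  exact (h1.sub (.of_contDiff (hψ.drift.contDiff 1 q))).smul_test (hψ.isTest q)

namespace IsTransportSolution

theorem integrable_mul_divDiff (h : IsTransportSolution T γ X XX b divb u) (ht₀ : t₀ ∈ Icc 0 T)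
    (hψ : IsBackwardFamily t₀ γ R a X f ψ')
    (hfb : ∀ᵐ t ∂(volume.restrict (Icc 0 T)), f t = b' t) (he : ∀ q ∈ Icc 0 t₀, ψ q = ψ' q) :
    Integrable (fun p : ℝ × Vec d => u p.1 p.2 * divDiff b divb b' ψ p.1 p.2) (slab d t₀) := by
  obtain ⟨Λ, hΛ⟩ := h.drift.exists_isLocBddField R
  obtain ⟨Λ', hΛ'⟩ := hψ.drift.exists_isLocBddField t₀ R
  have hi := integrable_transport ((hΛ.mono ht₀.2).sub hΛ')
    (h.solution.mem.mono_measure (slab_mono d ht₀.2)) (fun r _ => hψ.isC1Supported r)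
    hψ.family.stronglyMeasurable_uncurry.aestronglyMeasurable
    hψ.family.fderiv.stronglyMeasurable_uncurry.aestronglyMeasurable
  refine hi.congr ?_
  filter_upwards [ae_mono (slab_mono d ht₀.2) (ae_slab_of_ae hfb), ae_mem_slab d t₀] with p h1 h2
  rw [divDiff_eq h1 (he _ h2)]

theorem pair_eq_integral_divDiff (h : IsTransportSolution T γ X XX b divb u)
    (ht₀ : t₀ ∈ Icc 0 T) (hψ : IsBackwardFamily t₀ γ R a X f ψ')
    (hfb : ∀ᵐ t ∂(volume.restrict (Icc 0 T)), f t = b' t) (he : ∀ q ∈ Icc 0 t₀, ψ q = ψ' q) :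
    pair (u t₀) (ψ t₀) = ∫ q in (0 : ℝ)..t₀, pair (u q) (divDiff b divb b' ψ q) := by
  obtain ⟨Λ, hΛ⟩ := h.drift.exists_isLocBddField R
  rw [he t₀ ⟨ht₀.1, le_rfl⟩, h.pair_eq_integral_defect ht₀ hψ]
  refine intervalIntegral.integral_congr_ae ?_
  filter_upwards [h.ae_slices hΛ ⟨le_rfl, h.time_pos.le⟩ ht₀,
    (ae_restrict_iff' measurableSet_Icc).1 hfb] with r h1 h2 hr
  obtain ⟨hw, hs⟩ := h1 hr
  rw [uIoc_of_le ht₀.1] at hr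
  have hr₀ : r ∈ Icc 0 t₀ := ⟨hr.1.le, hr.2⟩
  rw [divDiff_eq (h2 ⟨hr₀.1, hr₀.2.trans ht₀.2⟩) (he r hr₀), defect,
    ← hw.pair_sub (hs.isBddSupported (hψ.isC1Supported r)).integrable
      (hψ.isBddSupported_source r).integrable]
  congr 1
  funext x
  simp only [transport, source, map_sub]
  ring

end IsTransportSolution

end Difference

/-! ### The estimate -/

/-- In extended nonnegative reals no integrability of `φ` is needed. -/
theorem IsBddSlice.enorm_pair_le {d : ℕ} {U : ℝ} {w φ : Vec d → ℝ} (hw : IsBddSlice U w) :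
    ENNReal.ofReal |pair w φ| ≤ ENNReal.ofReal U * ∫⁻ x, ENNReal.ofReal |φ x| := by
  rw [← Real.enorm_eq_ofReal_abs, pair, ← lintegral_const_mul' _ _ ENNReal.ofReal_ne_top]
  refine (enorm_integral_le_lintegral_enorm _).trans (lintegral_mono_ae ?_)
  filter_upwards [hw.bound] with x hx
  rw [Real.enorm_eq_ofReal_abs, abs_mul, ← ENNReal.ofReal_mul hw.nonneg]
  gcongr

theorem ofReal_abs_intervalIntegral_le {F : ℝ → ℝ} {t T : ℝ} (ht : t ∈ Icc 0 T) {A : ℝ≥0∞}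
    (hF : ∀ᵐ q ∂(volume.restrict (Icc 0 t)), ENNReal.ofReal |F q| ≤ A) :
    ENNReal.ofReal |∫ q in (0 : ℝ)..t, F q| ≤ ENNReal.ofReal T * A := by
  rw [intervalIntegral.integral_of_le ht.1, ← integral_Icc_eq_integral_Ioc,
    ← Real.enorm_eq_ofReal_abs]
  refine (enorm_integral_le_lintegral_enorm _).trans ?_
  calc ∫⁻ q in Icc 0 t, ‖F q‖ₑ ≤ ∫⁻ q in Icc 0 t, A := lintegral_mono_ae (by
        filter_upwards [hF] with q hq
        rwa [Real.enorm_eq_ofReal_abs])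
    _ = A * ENNReal.ofReal t := by simp
    _ ≤ _ := by
        rw [mul_comm]
        gcongr
        exact ht.2

theorem exp_backG_le {d : ℕ} {T M : ℝ} {f : ℝ → Vec d → Vec d} {Φ : ℝ → ℝ → Vec d → Vec d}
    (hM : ∀ t x, |divergence (f t) x| ≤ M) {q t₀ : ℝ} (hq : 0 ≤ q) (hqt : q ≤ t₀)
    (ht₀ : t₀ ≤ T) (x : Vec d) : Real.exp (backG f Φ t₀ q x) ≤ Real.exp (M * T) := by
  have hM0 : 0 ≤ M := (abs_nonneg _).trans (hM 0 0)
  have h1 := intervalIntegral.norm_integral_le_of_norm_le_const (a := q) (b := t₀)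
    (f := fun r => divergence (f r) (Φ q r x)) fun r _ => hM r _
  rw [abs_of_nonneg (sub_nonneg.2 hqt)] at h1
  refine Real.exp_le_exp.2 (((le_abs_self _).trans h1).trans ?_)
  gcongr
  linarith

namespace IsRegularFlow

variable {d : ℕ} {T γ : ℝ} {f : ℝ → Vec d → Vec d} {X : ℝ → Vec d} {Φ : ℝ → ℝ → Vec d → Vec d}

theorem contDiff_backG (h : IsRegularFlow T γ f X Φ) {s t : ℝ} (hs : 0 ≤ s) (hst : s ≤ t)
    (ht : t ≤ T) : ContDiff ℝ 1 (backG f Φ t s) :=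
  h.isSized_backG.contDiff 1 ⟨(s, t), hs, hst, ht⟩

theorem norm_fderiv_backSol_le (h : IsRegularFlow T γ f X Φ) {M K : ℝ}
    (hM : ∀ t x, |divergence (f t) x| ≤ M) {φ₀ : Vec d → ℝ} (hφ : ContDiff ℝ 1 φ₀)
    (hK : ∀ x, |φ₀ x| ≤ K) (hK' : ∀ x, ‖fderiv ℝ φ₀ x‖ ≤ K) {q t₀ : ℝ} (hq : 0 ≤ q)
    (hqt : q ≤ t₀) (ht₀ : t₀ ≤ T) (x : Vec d) :
    ‖fderiv ℝ (backSol f Φ φ₀ t₀ q) x‖ ≤ K * Real.exp (M * T) *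
      (‖fderiv ℝ (Φ q t₀) x‖ + ‖fderiv ℝ (backG f Φ t₀ q) x‖) := by
  have hK0 : 0 ≤ K := (abs_nonneg _).trans (hK 0)
  have hΦ := ((h.contDiff_flow hq hqt ht₀).differentiable one_ne_zero x).hasFDerivAt
  have hG := ((h.contDiff_backG hq hqt ht₀).differentiable one_ne_zero x).hasFDerivAt
  have h1 := ((hφ.differentiable one_ne_zero (Φ q t₀ x)).hasFDerivAt.comp x hΦ).mul hG.exp
  have e : backSol f Φ φ₀ t₀ q = (φ₀ ∘ Φ q t₀) * fun x => Real.exp (backG f Φ t₀ q x) := rfl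
  rw [e, h1.fderiv]
  refine (norm_add_le _ _).trans ?_
  have hE := exp_backG_le (Φ := Φ) hM hq hqt ht₀ x
  have b1 : ‖(φ₀ ∘ Φ q t₀) x • Real.exp (backG f Φ t₀ q x) • fderiv ℝ (backG f Φ t₀ q) x‖ ≤
      K * (Real.exp (M * T) * ‖fderiv ℝ (backG f Φ t₀ q) x‖) := by
    rw [norm_smul, norm_smul, Real.norm_of_nonneg (Real.exp_pos _).le]
    have := hK (Φ q t₀ x)
    rw [← Real.norm_eq_abs] at this
    exact mul_le_mul this (by gcongr) (by positivity) hK0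
  have b2 : ‖Real.exp (backG f Φ t₀ q x) • (fderiv ℝ φ₀ (Φ q t₀ x)).comp (fderiv ℝ (Φ q t₀) x)‖ ≤
      Real.exp (M * T) * (K * ‖fderiv ℝ (Φ q t₀) x‖) := by
    rw [norm_smul, Real.norm_of_nonneg (Real.exp_pos _).le]
    refine mul_le_mul hE ((ContinuousLinearMap.opNorm_comp_le _ _).trans ?_) (norm_nonneg _)
      (Real.exp_pos _).le
    gcongr
    exact hK' _
  refine (add_le_add b1 b2).trans (le_of_eq ?_)
  ring

/-- The backward solution itself is bounded by a constant; the factor `‖DΦ‖` is inserted with the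
lower bound from the Liouville formula, at the cost of a second exponential. -/
theorem abs_backSol_le (h : IsRegularFlow T γ f X Φ) (hd : 1 ≤ d) {M K : ℝ}
    (hM : ∀ t x, |divergence (f t) x| ≤ M) {φ₀ : Vec d → ℝ} (hK : ∀ x, |φ₀ x| ≤ K) {q t₀ : ℝ}
    (hq : 0 ≤ q) (hqt : q ≤ t₀) (ht₀ : t₀ ≤ T) (x : Vec d) :
    |backSol f Φ φ₀ t₀ q x| ≤ K * Real.exp (M * T) ^ 2 * ‖fderiv ℝ (Φ q t₀) x‖ := by
  have hK0 : 0 ≤ K := (abs_nonneg _).trans (hK 0)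
  have h1 := h.exp_le_norm_fderiv_flow hd hM hq hqt ht₀ x
  have h2 := exp_backG_le (Φ := Φ) hM hq hqt ht₀ x
  have h3 : 1 ≤ Real.exp (M * T) * ‖fderiv ℝ (Φ q t₀) x‖ := by
    have := mul_le_mul_of_nonneg_left h1 (Real.exp_pos (M * T)).le
    rwa [← Real.exp_add, add_neg_cancel, Real.exp_zero] at this
  rw [backSol, abs_mul, abs_of_pos (Real.exp_pos _)]
  calc _ ≤ K * Real.exp (M * T) := mul_le_mul (hK _) h2 (Real.exp_pos _).le hK0
    _ ≤ K * Real.exp (M * T) * (Real.exp (M * T) * ‖fderiv ℝ (Φ q t₀) x‖) :=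
        le_mul_of_one_le_right (by positivity) h3
    _ = _ := by ring

end IsRegularFlow

theorem abs_divDiff_le {d : ℕ} {b b' : ℝ → Vec d → Vec d} {divb : ℝ → Vec d → ℝ}
    {ψ : ℝ → Vec d → ℝ} {q A : ℝ} {x : Vec d} (h1 : ‖fderiv ℝ (ψ q) x‖ ≤ A)
    (h2 : |ψ q x| ≤ A) : |divDiff b divb b' ψ q x| ≤
      (|divb q x - divergence (b' q) x| + ‖b q x - b' q x‖) * A := by
  rw [divDiff, add_comm, add_mul]
  refine (abs_add_le _ _).trans (add_le_add ?_ ?_)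
  · rw [abs_mul]; gcongr
  · rw [mul_comm]
    exact ((fderiv ℝ (ψ q) x).le_opNorm _).trans (by gcongr)

end

end RoughTransport

/-! ### Strong solution, duality identity and estimate combined -/

theorem mainTheorem9 (d : ℕ) (hd : 1 ≤ d) (T : ℝ) (hT : 0 < T) (K M : ℝ) :
    ∃ C : ℝ≥0, ∀ (γ : ℝ), 1 / 3 < γ → γ ≤ 1 / 2 →
      ∀ (X : ℝ → Vec d) (XX : ℝ → ℝ → Matrix (Fin d) (Fin d) ℝ),
      IsGeometricRoughPath T γ X XX →
      ∀ (b : ℝ → Vec d → Vec d) (divb : ℝ → Vec d → ℝ), IsLinDrift T b divb →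
      ∀ (b' : ℝ → Vec d → Vec d), IsSmoothDrift T b' →
      (∀ᵐ t ∂(volume.restrict (Icc 0 T)), ∀ x, |divergence (b' t) x| ≤ M) →
      ∀ (Φ : ℝ → ℝ → Vec d → Vec d), IsFlow T b' X Φ →
      ∀ (u : ℝ → Vec d → ℝ), IsWeakControlledSolution T γ X XX b divb (fun _ => 0) u →
      ∀ (φ₀ : Vec d → ℝ), IsTest φ₀ →
      (∀ x, |φ₀ x| ≤ K) → (∀ x, ‖fderiv ℝ φ₀ x‖ ≤ K) →
      ∀ (Rφ : ℝ), tsupport φ₀ ⊆ Metric.closedBall 0 Rφ →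
      ∀ t₀ ∈ Icc 0 T,
        -- the test function is a backward strong solution of the rough continuity equation
        ((∀ q ∈ Icc 0 t₀, ContDiff ℝ 2 (backSol b' Φ φ₀ t₀ q)) ∧
          IsStrongControlledSolution t₀ γ X XX b' (fun t => divergence (b' t))
            (backSol b' Φ φ₀ t₀)
            (fun t x i j => -pd j (pd i (backSol b' Φ φ₀ t₀ t)) x) ∧
          ∀ x, backSol b' Φ φ₀ t₀ t₀ x = φ₀ x) ∧
        -- the duality identity
        ((∀ᵐ q ∂(volume.restrict (Icc 0 t₀)),
            IsWeakDiv (fun x => backSol b' Φ φ₀ t₀ q x • (b q x - b' q x))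
              (divDiff b divb b' (backSol b' Φ φ₀ t₀) q)) ∧
          Integrable
            (fun p : ℝ × Vec d => u p.1 p.2 * divDiff b divb b' (backSol b' Φ φ₀ t₀) p.1 p.2)
            (slab d t₀) ∧
          pair (u t₀) φ₀ =
            ∫ q in (0 : ℝ)..t₀, pair (u q) (divDiff b divb b' (backSol b' Φ φ₀ t₀) q)) ∧
        -- the estimate
        ENNReal.ofReal |pair (u t₀) φ₀| ≤
          C * eLpNorm (Function.uncurry u) ∞ (slab d T) *
            essSup (fun q => ∫⁻ x in Metric.closedBall (0 : Vec d) (supportRadius T γ Rφ b' X),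
                ENNReal.ofReal ((|divb q x - divergence (b' q) x| + ‖b q x - b' q x‖) *
                  (‖fderiv ℝ (Φ q t₀) x‖ + ‖fderiv ℝ (backG b' Φ t₀ q) x‖)))
              (volume.restrict (Icc 0 t₀)) := by
  -- `K` and `M` are fixed before any function is given and may be negative.
  set M₀ := max M 0 with hM₀
  set K₀ := max K 0 with hK₀
  set E := Real.exp (M₀ * T) with hE
  have hE1 : 1 ≤ E := Real.one_le_exp (mul_nonneg (le_max_right _ _) hT.le)
  have hK₀0 : 0 ≤ K₀ := le_max_right _ _
  refine ⟨T.toNNReal * (K₀ * E ^ 2).toNNReal, ?_⟩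
  intro γ hγ hγ2 X XX hX b divb hb b' hb' hM Φ hΦ u hu φ₀ hφ hK hK' Rφ hR t₀ ht₀
  have hγ0 : 0 < γ := by linarith
  have hγ1 : γ ≤ 1 := by linarith
  have hsol : IsTransportSolution T γ X XX b divb u := ⟨hT, hγ, hγ2, hX, hb, hu⟩
  obtain ⟨f, hf, hfb, hfM, hfN⟩ := hb'.exists_regular (M := M₀) (le_max_right _ _)
    (by filter_upwards [hM] with t ht x using (ht x).trans (le_max_left _ _))
  have hflow : IsRegularFlow T γ f X Φ := ⟨hγ0, hf, hX.holder, hΦ.congr hfb⟩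
  set ψ := backSol b' Φ φ₀ t₀ with hψd
  set N := (eLpNorm (Function.uncurry b') ∞ (slab d T)).toReal with hN
  set r := T * N + T ^ γ * holderSeminorm T γ X with hr
  have hr0 : 0 ≤ r := add_nonneg (mul_nonneg hT.le ENNReal.toReal_nonneg)
    (mul_nonneg (Real.rpow_nonneg hT.le _) (holderSeminorm_nonneg _ _ _))
  have hψ : IsBackwardTransport t₀ γ (Rφ + r) X b' ψ :=
    hflow.isBackwardTransport hγ1 hfb hφ hfN hR ht₀
  -- The strong equation is needed for `b'` itself, while the duality argument needs a drift that is
  -- regular at every time; the two backward solutions coincide on `[0,t₀]`.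
  have hψf : IsBackwardTransport t₀ γ (Rφ + r) X f (backSol f Φ φ₀ t₀) :=
    hflow.isBackwardTransport hγ1 (.of_forall fun _ => rfl) hφ hfN hR ht₀
  obtain ⟨a, hfam⟩ := hψf.exists_isBackwardFamily (hX.holder.mono ht₀.2) hγ0 hγ1 ht₀.1 hf
  have hψe : ∀ q ∈ Icc 0 t₀, ψ q = backSol f Φ φ₀ t₀ q := fun q hq => by
    funext x
    rw [hψd, backSol, backG_congr hfb hq.1 hq.2 ht₀.2, backSol]
  have he : ∀ q ∈ Icc 0 t₀, ψ q = backSol f Φ φ₀ t₀ (clamp t₀ q) := fun q hq => by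
    rw [clamp_of_mem hq, hψe q hq]
  have hself : ψ t₀ = φ₀ := funext fun x => backSol_self hΦ φ₀ ht₀ x
  have hdual := hsol.pair_eq_integral_divDiff ht₀ hfam hfb he
  rw [hself] at hdual
  refine ⟨⟨fun q hq => hψ.contDiff hq 2, hψ.isStrongControlledSolution (hX.mono ht₀.2) hγ hγ2,
    fun x => congrFun hself x⟩, ⟨ae_isWeakDiv_divDiff hb ht₀ hfam hfb he,
    hsol.integrable_mul_divDiff ht₀ hfam hfb he, hdual⟩, ?_⟩
  set S := essSup (fun q => ∫⁻ x in Metric.closedBall (0 : Vec d) (supportRadius T γ Rφ b' X),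
    ENNReal.ofReal ((|divb q x - divergence (b' q) x| + ‖b q x - b' q x‖) *
      (‖fderiv ℝ (Φ q t₀) x‖ + ‖fderiv ℝ (backG b' Φ t₀ q) x‖))) (volume.restrict (Icc 0 t₀))
    with hS
  have hU : eLpNorm (Function.uncurry u) ∞ (slab d T) = ENNReal.ofReal (supNorm d T u) :=
    (ENNReal.ofReal_toReal hu.mem.eLpNorm_ne_top).symm
  -- The support spreads by at most one displacement `r`; the radius in the statement allows two.
  have hRr : Rφ + r ≤ supportRadius T γ Rφ b' X := by
    rw [supportRadius]; linarith
  have key : ∀ᵐ q ∂(volume.restrict (Icc 0 t₀)),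
      ENNReal.ofReal |pair (u q) (divDiff b divb b' ψ q)| ≤
        ENNReal.ofReal (supNorm d T u) * (ENNReal.ofReal (K₀ * E ^ 2) * S) := by
    filter_upwards [ENNReal.ae_le_essSup fun q => ∫⁻ x in Metric.closedBall (0 : Vec d)
      (supportRadius T γ Rφ b' X), ENNReal.ofReal ((|divb q x - divergence (b' q) x| +
        ‖b q x - b' q x‖) * (‖fderiv ℝ (Φ q t₀) x‖ + ‖fderiv ℝ (backG b' Φ t₀ q) x‖)),
      ae_restrict_mem measurableSet_Icc] with q hq hqm
    refine ((hsol.slice ⟨hqm.1, hqm.2.trans ht₀.2⟩).enorm_pair_le).trans ?_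
    gcongr
    have hsupp : ∫⁻ x, ENNReal.ofReal |divDiff b divb b' ψ q x| =
        ∫⁻ x in Metric.closedBall (0 : Vec d) (supportRadius T γ Rφ b' X),
          ENNReal.ofReal |divDiff b divb b' ψ q x| := by
      refine (setLIntegral_eq_of_support_subset fun x hx => ?_).symm
      by_contra hn
      have hx' : Rφ + r < ‖x‖ := hRr.trans_lt (by simpa using hn)
      have h0 : ∀ y, Rφ + r < ‖y‖ → ψ q y = 0 := fun y hy => by
        by_contra h0
        exact absurd (hψ.support q hqm y h0) (not_le.2 hy)
      exact hx (by simp [divDiff, h0 x hx', fderiv_eq_zero_of_norm_lt h0 hx'])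
    rw [hsupp]
    refine le_trans ?_ (mul_le_mul_right hq _)
    rw [← lintegral_const_mul' _ _ ENNReal.ofReal_ne_top]
    refine lintegral_mono fun x => ?_
    rw [← ENNReal.ofReal_mul (by positivity)]
    refine ENNReal.ofReal_le_ofReal ?_
    have hG : backG b' Φ t₀ q = backG f Φ t₀ q := backG_congr hfb hqm.1 hqm.2 ht₀.2
    have b1 := hflow.norm_fderiv_backSol_le hfM (hφ.contDiff 1)
      (fun x => (hK x).trans (le_max_left K 0)) (fun x => (hK' x).trans (le_max_left K 0))
      hqm.1 hqm.2 ht₀.2 x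
    have b2 := hflow.abs_backSol_le hd hfM (fun x => (hK x).trans (le_max_left K 0))
      hqm.1 hqm.2 ht₀.2 x
    rw [← hψe q hqm] at b1 b2
    rw [hG]
    -- The common bound must cover the gradient, which costs one factor `E`, and the function
    -- itself, which costs two.
    refine (abs_divDiff_le (A := K₀ * E ^ 2 *
      (‖fderiv ℝ (Φ q t₀) x‖ + ‖fderiv ℝ (backG f Φ t₀ q) x‖)) ?_ ?_).trans (le_of_eq (by ring))
    · refine b1.trans ?_
      gcongr
      exact le_self_pow₀ hE1 two_ne_zero
    · refine b2.trans ?_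
      gcongr
      exact le_add_of_nonneg_right (norm_nonneg _)
  rw [hdual, hU, ENNReal.coe_mul]
  refine (ofReal_abs_intervalIntegral_le ht₀ key).trans (le_of_eq ?_)
  simp only [ENNReal.ofReal]
  ring
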